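/- Let $\mathcal{E}$ be a bicomplete closed symmetric monoidal category with unit $I$, let $\mathcal{P}$ be a symmetric operad in $\mathcal{E}$ and let $A$ be a $\mathcal{P}$-algebra. An $A$-module under $\mathcal{P}$ is an object $M$ of $\mathcal{E}$ with action maps $$\mu_{n,k}:\mathcal{P}(n)\otimes A^{\otimes k-1}\otimes M\otimes A^{\otimes n-k}\to M,\qquad 1\le k\le n,$$ which are unital (the operad unit $I\to\mathcal{P}(1)$ acts through $\mu_{1,1}$ as the identity), associative (compatible with the composition of $\mathcal{P}$, the $\mathcal{P}$-algebra structure of $A$ and the maps $\mu$ themselves) and equivariant (for each $n$ they factor through the coinvariants $\mathcal{P}(n)\otimes_{\Sigma_n}\coprod_{k}A^{\otimes k-1}\otimes M\otimes A^{\otimes n-k}$). A morphism is a morphism of $\mathcal{E}$ commuting with all $\mu_{n,k}$. Let $\mathrm{Mod}_{\mathcal{P}}(A)$ be the category of $A$-modules under $\mathcal{P}$. An enveloping operad of $A$ is an operad $\mathcal{P}_A$ with an operad map $\eta:\mathcal{P}\to\mathcal{P}_A$ and a $\mathcal{P}$-algebra map $\bar\eta:A\to\eta^*\mathcal{P}_A(0)$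 such that for each operad $\mathcal{Q}$, each operad map $\phi:\mathcal{P}\to\mathcal{Q}$ and each $\mathcal{P}$-algebra map $\psi:A\to\phi^*\mathcal{Q}(0)$ there is a unique operad map $\theta:\mathcal{P}_A\to\mathcal{Q}$ with $\theta\eta=\phi$ and $\theta(0)\bar\eta=\psi$. Then an enveloping operad $\mathcal{P}_A$ of $A$ exists, and for each enveloping operad $\mathcal{P}_A$ the category of modules over the monoid $\mathcal{P}_A(1)$ of its unary operations is canonically isomorphic to $\mathrm{Mod}_{\mathcal{P}}(A)$: there is an isomorphism of categories, commuting strictly with the forgetful functors to $\mathcal{E}$, which sends a $\mathcal{P}_A(1)$-module $M$ to the object $M$ with the action maps $$\mathcal{P}(n)\otimes A^{\otimes k-1}\otimes M\otimes A^{\otimes n-k}\cong\bigl(\mathcal{P}(n)\otimes A^{\otimes k-1}\otimes I\otimes A^{\otimes n-k}\bigr)\otimes M\to\mathcal{P}_A(1)\otimes M\to M,$$ where the first map is the symmetry, the second one is induced by $\eta$, $\bar\eta$, the operad unit $I\to\mathcal{P}_A(1)$ and the operad composition $\mathcal{P}_A(n)\otimes\mathcal{P}_A(0)^{\otimes k-1}\otimes\mathcal{P}_A(1)\otimes\mathcal{P}_A(0)^{\otimes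 n-k}\to\mathcal{P}_A(1)$, and the last one is the action of $\mathcal{P}_A(1)$ on $M$. (The monoid $\mathcal{P}_A(1)$ is called the enveloping algebra $\mathrm{Env}_{\mathcal{P}}(A)$.) -/

import Mathlib

open CategoryTheory MonoidalCategory Limits

universe v u

noncomputable section

namespace OperadTheory

/-! ### Indices and marked families -/

/-- The lexicographic bijection between the disjoint union of the sets `{0, …, n i - 1}` and
`{0, …, ∑ i, n i - 1}`. -/
abbrev flat {s : ℕ} (n : Fin s → ℕ) : (Σ i, Fin (n i)) ≃ Fin (∑ i, n i) := finSigmaFinEquiv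

theorem flat_castSucc {s : ℕ} (n : Fin (s + 1) → ℕ) (i : Fin s) (j : Fin (n i.castSucc)) :
    Fin.cast (Fin.sum_univ_castSucc n).symm
      ((flat (fun i : Fin s => n i.castSucc) ⟨i, j⟩).castAdd (n (Fin.last s))) =
    flat n ⟨i.castSucc, j⟩ := by
  apply Fin.ext
  simp [flat, finSigmaFinEquiv_apply]

theorem flat_last {s : ℕ} (n : Fin (s + 1) → ℕ) (j : Fin (n (Fin.last s))) :
    Fin.cast (Fin.sum_univ_castSucc n).symm
      (j.natAdd (∑ i : Fin s, n i.castSucc)) =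
    flat n ⟨Fin.last s, j⟩ := by
  apply Fin.ext
  simp [flat, finSigmaFinEquiv_apply]
  rfl

/-- The family with the object `M` at the index `k` and the object `A` at all other indices. -/
def mark {ι : Type} [DecidableEq ι] {C : Type u} (A M : C) (k i : ι) : C := if i = k then M else A

theorem mark_self {ι : Type} [DecidableEq ι] {C : Type u} (A M : C) (k : ι) :
    mark A M k k = M := if_pos rfl

theorem mark_of_ne {ι : Type} [DecidableEq ι] {C : Type u} (A M : C) {k i : ι} (h : i ≠ k) :
    mark A M k i = A := if_neg h

theorem mark_equiv {ι κ : Type} [DecidableEq ι] [DecidableEq κ] {C : Type u}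
    (A M : C) (e : ι ≃ κ) (k i : ι) :
    mark A M (e k) (e i) = mark A M k i := by
  simp [mark]

theorem mark_flat_same {s : ℕ} (n : Fin s → ℕ) {C : Type u} (A M : C) (l : Fin s)
    (r : Fin (n l)) (i : Fin s) (h : i = l) (j : Fin (n i)) :
    mark A M (flat n ⟨l, r⟩) (flat n ⟨i, j⟩) = mark A M (Fin.cast (congrArg n h.symm) r) j := by
  subst h
  simp [mark]

theorem mark_flat_ne {s : ℕ} (n : Fin s → ℕ) {C : Type u} (A M : C) (l : Fin s)
    (r : Fin (n l)) (i : Fin s) (h : i ≠ l) (j : Fin (n i)) :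
    mark A M (flat n ⟨l, r⟩) (flat n ⟨i, j⟩) = A :=
  mark_of_ne A M fun h' => h (congrArg Sigma.fst ((flat n).injective h'))

variable {C : Type u} [Category.{v} C] [MonoidalCategory C]

/-! ### Finite tensor products of families -/

/-- The tensor product `X 0 ⊗ X 1 ⊗ ⋯ ⊗ X (n-1)`, bracketed to the left and starting with the
unit object. -/
def tens : {n : ℕ} → (Fin n → C) → C
  | 0, _ => 𝟙_ C
  | n + 1, X => tens (fun i : Fin n => X i.castSucc) ⊗ X (Fin.last n)

/-- Functoriality of `tens` in the family. -/
def tensMap : {n : ℕ} → {X Y : Fin n → C} → (∀ i, X i ⟶ Y i) → (tens X ⟶ tens Y)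
  | 0, _, _, _ => 𝟙 (𝟙_ C)
  | n + 1, _, _, f => tensMap (fun i : Fin n => f i.castSucc) ⊗ₘ f (Fin.last n)

/-- Equal families have the same tensor product. -/
def tensCongr {n : ℕ} {X Y : Fin n → C} (h : ∀ i, X i = Y i) : tens X ≅ tens Y :=
  eqToIso (congrArg tens (funext h))

/-- The tensor product of a family with one member. -/
def tensOne (X : Fin 1 → C) : tens X ≅ X 0 := λ_ (X 0)

/-- The canonical isomorphism between a tensor power of the unit object and the unit object. -/
def tensUnits : (n : ℕ) → (tens (fun _ : Fin n => 𝟙_ C) ≅ 𝟙_ C)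
  | 0 => Iso.refl _
  | n + 1 => whiskerRightIso (tensUnits n) (𝟙_ C) ≪≫ λ_ (𝟙_ C)

/-- The associativity isomorphism
`X 0 ⊗ ⋯ ⊗ X (a+b-1) ≅ (X 0 ⊗ ⋯ ⊗ X (a-1)) ⊗ (X a ⊗ ⋯ ⊗ X (a+b-1))`. -/
def tensSplit : {a b : ℕ} → (X : Fin (a + b) → C) →
    (tens X ≅ tens (fun i : Fin a => X (i.castAdd b)) ⊗ tens (fun j : Fin b => X (j.natAdd a)))
  | _, 0, X => (ρ_ (tens X)).symm
  | _, b + 1, X =>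
    whiskerRightIso (tensSplit (b := b) (fun i => X i.castSucc)) (X (Fin.last _)) ≪≫ α_ _ _ _

/-- Reindexing along an equality of lengths. -/
def tensCast {m n : ℕ} (h : m = n) (X : Fin n → C) :
    tens X ≅ tens (fun i : Fin m => X (Fin.cast h i)) :=
  eqToIso (by subst h; rfl)

section Symmetric

variable [SymmetricCategory C]

theorem castSucc_succAbove_castSucc' {n : ℕ} (k : Fin (n + 1)) (i : Fin n) :
    (k.succAbove i).castSucc = k.castSucc.succAbove i.castSucc := by
  simp [Fin.succAbove, Fin.lt_def, apply_ite Fin.castSucc]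

theorem castSucc_succAbove_last' {n : ℕ} (k : Fin (n + 1)) :
    Fin.last (n + 1) = k.castSucc.succAbove (Fin.last n) := by
  rw [Fin.succAbove_of_le_castSucc _ _ (Fin.castSucc_le_castSucc_iff.mpr (Fin.le_last k))]
  rfl

/-- The symmetry isomorphism that moves the factor with index `k` to the end, keeping the order
of the other factors. -/
def tensExtract : {n : ℕ} → (X : Fin (n + 1) → C) → (k : Fin (n + 1)) →
    (tens X ≅ tens (fun i : Fin n => X (k.succAbove i)) ⊗ X k)
  | 0, X, k => whiskerLeftIso (𝟙_ C) (eqToIso (congrArg X (Fin.ext (by omega) : Fin.last 0 = k)))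
  | n + 1, X, k =>
    Fin.lastCases (motive := fun k : Fin (n + 2) =>
        tens X ≅ tens (fun i : Fin (n + 1) => X (k.succAbove i)) ⊗ X k)
      (whiskerRightIso (tensCongr fun i => by rw [Fin.succAbove_last]) (X (Fin.last _)))
      (fun k =>
        whiskerRightIso (tensExtract (fun i => X i.castSucc) k) (X (Fin.last _)) ≪≫
        α_ _ _ _ ≪≫ whiskerLeftIso _ (β_ _ _) ≪≫ (α_ _ _ _).symm ≪≫
        whiskerRightIso
          (tensCongr (fun i => congrArg X (castSucc_succAbove_castSucc' k i)) ⊗ᵢ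
            eqToIso (congrArg X (castSucc_succAbove_last' k)))
          (X k.castSucc))
      k

/-- The bijection obtained from `e` by removing the last element and its image. -/
def dropLast {m n : ℕ} (e : Fin (m + 1) ≃ Fin (n + 1)) : Fin m ≃ Fin n :=
  (finSuccAboveEquiv (Fin.last m)).trans
    ((e.subtypeEquiv (fun a => by simp)).trans (finSuccAboveEquiv (e (Fin.last m))).symm)

theorem succAbove_dropLast {m n : ℕ} (e : Fin (m + 1) ≃ Fin (n + 1)) (i : Fin m) :
    (e (Fin.last m)).succAbove (dropLast e i) = e i.castSucc := by
  exact congrArg Subtype.val ((finSuccAboveEquiv (e (Fin.last m))).apply_symm_apply _) |>.trans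
    (congrArg e (Fin.succAbove_last_apply i))

/-- The symmetry isomorphism `⨂ j, X j ≅ ⨂ i, X (e i)` that permutes the factors along a
bijection `e`. -/
def tensPerm : {m n : ℕ} → (e : Fin m ≃ Fin n) → (X : Fin n → C) →
    (tens X ≅ tens (fun i => X (e i)))
  | 0, 0, _, _ => Iso.refl _
  | 0, _ + 1, e, _ => (e.symm 0).elim0
  | _ + 1, 0, e, _ => (e 0).elim0
  | _ + 1, _ + 1, e, X =>
    tensExtract X (e (Fin.last _)) ≪≫
      whiskerRightIso
        (tensPerm (dropLast e) (fun j => X ((e (Fin.last _)).succAbove j)) ≪≫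
          tensCongr (fun i => congrArg X (succAbove_dropLast e i)))
        (X (e (Fin.last _)))

/-- Given morphisms `f i : A i ⊗ (⨂ j, Y (i, j)) ⟶ B i`, the morphism
`(⨂ i, A i) ⊗ (⨂ (i, j), Y (i, j)) ⟶ ⨂ i, B i` which distributes the factors of the second tensor
product (ordered lexicographically) to their blocks and then applies `f i` in the block `i`. -/
def blockMap : {s : ℕ} → (n : Fin s → ℕ) → (A B : Fin s → C) → (Y : Fin (∑ i, n i) → C) →
    (∀ i, A i ⊗ tens (fun j : Fin (n i) => Y (flat n ⟨i, j⟩)) ⟶ B i) →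
    (tens A ⊗ tens Y ⟶ tens B)
  | 0, _, _, _, Y, _ => (λ_ (tens Y)).hom ≫ (tensCast (Fin.sum_univ_zero _).symm Y).hom
  | s + 1, n, A, B, Y, f =>
    tens A ◁ ((tensCast (Fin.sum_univ_castSucc n).symm Y).hom ≫ (tensSplit _).hom) ≫
      tensorμ _ _ _ _ ≫
      (blockMap (fun i : Fin s => n i.castSucc) (fun i => A i.castSucc) (fun i => B i.castSucc) _
          (fun i => A i.castSucc ◁ (tensCongr fun j => congrArg Y (flat_castSucc n i j)).hom ≫
            f i.castSucc) ⊗ₘ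
        (A (Fin.last s) ◁ (tensCongr fun j => congrArg Y (flat_last n j)).hom ≫ f (Fin.last s)))

end Symmetric


/-! ### Elementary properties of the canonical morphisms -/

theorem tensMap_id {n : ℕ} (X : Fin n → C) : tensMap (fun i => 𝟙 (X i)) = 𝟙 (tens X) := by
  induction n with
  | zero => rfl
  | succ n ih => simp [tensMap, ih, tens]

theorem tensMap_comp {n : ℕ} {X Y Z : Fin n → C} (f : ∀ i, X i ⟶ Y i) (g : ∀ i, Y i ⟶ Z i) :
    tensMap (fun i => f i ≫ g i) = tensMap f ≫ tensMap g := by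
  induction n with
  | zero => exact (Category.id_comp _).symm
  | succ n ih =>
    refine Eq.trans ?_ (tensorHom_comp_tensorHom _ _ _ _).symm
    rw [← ih]
    rfl

theorem tensOne_inv_naturality {X Y : C} (f : X ⟶ Y) :
    f ≫ (tensOne fun _ => Y).inv = (tensOne fun _ => X).inv ≫ tensMap (fun _ : Fin 1 => f) := by
  refine (leftUnitor_inv_naturality _).trans ?_
  rw [← id_tensorHom]
  rfl

theorem tens_eq {m n : ℕ} (h : m = n) (Z : Fin m → C) (W : Fin n → C)
    (hZ : ∀ j, Z (Fin.cast h.symm j) = W j) : tens Z = tens W := by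
  subst h
  exact congrArg tens (funext hZ)

theorem tensSplit_zero {b : ℕ} (X : Fin (0 + b) → C)
    (h : tens X = tens (fun j : Fin b => X (j.natAdd 0))) :
    (tensSplit X).hom ≫ (λ_ (tens (fun j : Fin b => X (j.natAdd 0)))).hom = eqToHom h := by
  induction b with
  | zero =>
    have e : (ρ_ (𝟙_ C)).inv ≫ (λ_ (𝟙_ C)).hom = 𝟙 (𝟙_ C) := by
      rw [unitors_equal, Iso.inv_hom_id]
    exact e
  | succ b ih =>
    have aux : ∀ {T V D E : C} (t : T ⟶ 𝟙_ C ⊗ V) (k : T = V) (k' : T ⊗ D = E) (l : V ⊗ D = E),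
        t ≫ (λ_ V).hom = eqToHom k → (t ▷ D ≫ (α_ _ _ _).hom) ≫ (λ_ _).hom =
          eqToHom (k'.trans l.symm) := by
      rintro T V D E t rfl rfl - ht
      rw [Category.assoc, leftUnitor_tensor_hom, Iso.hom_inv_id_assoc, ← comp_whiskerRight, ht]
      simp
    have hk : tens (fun i : Fin (0 + b) => X i.castSucc) =
        tens (fun j : Fin b => X (j.natAdd 0).castSucc) :=
      tens_eq (Nat.zero_add b) _ _ fun j => congrArg X (by ext; simp)
    exact aux _ hk h rfl (ih (fun i => X i.castSucc) hk)

theorem tensSplit_of_eq_zero {a b : ℕ} (ha : a = 0) (X : Fin (a + b) → C)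
    (h : tens X = tens (fun j : Fin b => X (j.natAdd a)))
    (h' : tens (fun i : Fin a => X (i.castAdd b)) = 𝟙_ C) :
    (tensSplit X).hom ≫ eqToHom h' ▷ _ ≫ (λ_ _).hom = eqToHom h := by
  subst ha
  rw [← tensSplit_zero X h]
  exact congrArg _ ((congrArg (· ≫ _) (id_whiskerRight _ _)).trans (Category.id_comp _))

section Symmetric

variable [SymmetricCategory C]

theorem blockMap_comp {s : ℕ} (n : Fin s → ℕ) (A B B' : Fin s → C) (Y : Fin (∑ i, n i) → C)
    (f : ∀ i, A i ⊗ tens (fun j : Fin (n i) => Y (flat n ⟨i, j⟩)) ⟶ B i) (g : ∀ i, B i ⟶ B' i) :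
    blockMap n A B' Y (fun i => f i ≫ g i) = blockMap n A B Y f ≫ tensMap g := by
  induction s with
  | zero => exact (Category.comp_id _).symm
  | succ s ih =>
    refine Eq.trans ?_ (Category.assoc _ _ _).symm
    refine congrArg _ (Eq.trans ?_ (Category.assoc _ _ _).symm)
    refine congrArg _ (Eq.trans ?_ (tensorHom_comp_tensorHom _ _ _ _).symm)
    rw [← ih]
    simp only [Category.assoc]

theorem tensMap_blockMap_aux {A A' D D' T U V B E : C} {a : A ⟶ A'} {d : D ⟶ D'}
    {p : T ⟶ U ⊗ V} {b : A ⊗ U ⟶ B} {b' : A' ⊗ U ⟶ B} {e : D ⊗ V ⟶ E} {e' : D' ⊗ V ⟶ E}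
    (hb : a ▷ U ≫ b' = b) (he : d ▷ V ≫ e' = e) :
    (a ⊗ₘ d) ▷ T ≫ (A' ⊗ D') ◁ p ≫ tensorμ A' D' U V ≫ (b' ⊗ₘ e') =
      (A ⊗ D) ◁ p ≫ tensorμ A D U V ≫ (b ⊗ₘ e) := by
  subst hb he
  rw [← whisker_exchange_assoc, tensorμ_natural_left_assoc, tensorHom_comp_tensorHom]

theorem tensMap_blockMap {s : ℕ} (n : Fin s → ℕ) (A A' B : Fin s → C) (Y : Fin (∑ i, n i) → C)
    (f : ∀ i, A' i ⊗ tens (fun j : Fin (n i) => Y (flat n ⟨i, j⟩)) ⟶ B i) (g : ∀ i, A i ⟶ A' i) :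
    tensMap g ▷ tens Y ≫ blockMap n A' B Y f = blockMap n A B Y (fun i => g i ▷ _ ≫ f i) := by
  induction s with
  | zero => exact (congrArg (· ≫ _) (id_whiskerRight _ _)).trans (Category.id_comp _)
  | succ s ih =>
    refine tensMap_blockMap_aux (Eq.trans (ih _ _ _ _ _ _ _) ?_) ?_
    · simp only [whisker_exchange_assoc]
    · simp only [whisker_exchange_assoc]

theorem blockMap_one_aux {A U V T W B : C} (p : T ⟶ U ⊗ V) (u : U ⟶ 𝟙_ C) (c : V ⟶ W)
    (f : A ⊗ W ⟶ B) :
    (𝟙_ C ⊗ A) ◁ p ≫ tensorμ (𝟙_ C) A U V ≫ (((λ_ U).hom ≫ u) ⊗ₘ (A ◁ c ≫ f)) =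
      (λ_ A).hom ▷ T ≫ A ◁ (p ≫ u ▷ V ≫ (λ_ V).hom ≫ c) ≫ f ≫ (λ_ B).inv := by
  have h1 : tensorμ (𝟙_ C) A U V ≫ (((λ_ U).hom ≫ u) ⊗ₘ (A ◁ c ≫ f)) =
      (𝟙_ C ⊗ A) ◁ (u ▷ V) ≫ tensorμ (𝟙_ C) A (𝟙_ C) V ≫
        ((λ_ (𝟙_ C)).hom ⊗ₘ 𝟙 _) ≫ (𝟙_ C) ◁ (A ◁ c ≫ f) := by
    have := tensorμ_natural_right (𝟙_ C) A u (𝟙 V)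
    rw [tensorHom_id] at this
    rw [reassoc_of% this]
    congr 1
    rw [tensorHom_comp_tensorHom_assoc, ← id_tensorHom (𝟙_ C) (A ◁ c ≫ f),
      tensorHom_comp_tensorHom]
    simp
  have h2 : tensorμ (𝟙_ C) A (𝟙_ C) V ≫ ((λ_ (𝟙_ C)).hom ⊗ₘ 𝟙 _) =
      (λ_ A).hom ▷ (𝟙_ C ⊗ V) ≫ A ◁ (λ_ V).hom ≫ (λ_ _).inv := by
    simp [tensorμ]
  rw [h1, reassoc_of% h2]
  simp

theorem blockMap_one (n : Fin 1 → ℕ) (A B : Fin 1 → C) (Y : Fin (∑ i, n i) → C)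
    (f : ∀ i, A i ⊗ tens (fun j : Fin (n i) => Y (flat n ⟨i, j⟩)) ⟶ B i)
    (h : tens Y = tens (fun j : Fin (n 0) => Y (flat n ⟨0, j⟩))) :
    blockMap n A B Y f =
      (tensOne A).hom ▷ tens Y ≫ A 0 ◁ eqToHom h ≫ f 0 ≫ (tensOne B).inv := by
  refine (blockMap_one_aux _ _ _ _).trans ?_
  refine congrArg (fun z => (tensOne A).hom ▷ tens Y ≫ A 0 ◁ z ≫ f 0 ≫ (tensOne B).inv) ?_
  rw [Category.assoc]
  have := tensSplit_of_eq_zero (Fin.sum_univ_zero _)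
    (fun x : Fin (∑ i : Fin 0, n i.castSucc + n (Fin.last 0)) =>
      Y (Fin.cast (Fin.sum_univ_castSucc n).symm x))
    (tens_eq (by simp) _ _ fun j => congrArg Y (by ext; simp))
    (tens_eq (Fin.sum_univ_zero _) _ (fun i : Fin 0 => i.elim0) fun j => j.elim0)
  refine (congrArg ((tensCast _ _).hom ≫ ·) ((reassoc_of% this) _)).trans ?_
  simp [tensCast, tensCongr]

theorem tensPerm_one {m : ℕ} (e : Fin m ≃ Fin 1) (X : C)
    (h : tens (fun _ : Fin m => X) = tens (fun _ : Fin 1 => X)) :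
    (tensPerm e fun _ => X).hom ≫ eqToHom h = 𝟙 _ := by
  obtain rfl : m = 1 := by simpa using Fintype.card_congr e
  have : (tensPerm e fun _ => X).hom = 𝟙 _ := by
    have aux : ((𝟙_ C ◁ᵢ Iso.refl X) ≪≫ ((Iso.refl (𝟙_ C) ≪≫ Iso.refl (𝟙_ C)) ▷ᵢ X)).hom =
        𝟙 (𝟙_ C ⊗ X) := by
      simp
    exact aux
  rw [this]
  simp

/-! ### Relabellings of the inputs of composite operations -/

/-- The bijection `j ↔ (0, j)` between the inputs of `q` and those of `1(q)`. -/
def oneCompEquiv (n : ℕ) : Fin n ≃ Fin (∑ _i : Fin 1, n) :=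
  (Equiv.uniqueSigma fun _ : Fin 1 => Fin n).symm.trans (flat fun _ : Fin 1 => n)

/-- The bijection `i ↔ (i, 0)` between the inputs of `p` and those of `p(1, …, 1)`. -/
def compOneEquiv (n : ℕ) : Fin n ≃ Fin (∑ _i : Fin n, 1) :=
  (Equiv.sigmaUnique (Fin n) fun _ => Fin 1).symm.trans (flat fun _ : Fin n => 1)

/-- The bijection `(i, (j, x)) ↔ ((i, j), x)` between the inputs of two iterated composites. -/
def assocEquiv {s : ℕ} (n : Fin s → ℕ) (m : Fin (∑ i, n i) → ℕ) :
    Fin (∑ i, ∑ j, m (flat n ⟨i, j⟩)) ≃ Fin (∑ x, m x) :=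
  (flat fun i => ∑ j, m (flat n ⟨i, j⟩)).symm.trans
    ((Equiv.sigmaCongrRight fun i => (flat fun j => m (flat n ⟨i, j⟩)).symm).trans
      ((Equiv.sigmaAssoc fun i j => Fin (m (flat n ⟨i, j⟩))).symm.trans
        ((Equiv.sigmaCongrLeft (β := fun x => Fin (m x)) (flat n)).trans (flat m))))

/-- The block permutation `(i, j) ↦ (σ i, j)`. -/
def blockEquiv {s t : ℕ} (σ : Fin s ≃ Fin t) (n : Fin t → ℕ) :
    Fin (∑ i, n (σ i)) ≃ Fin (∑ i, n i) :=
  (flat fun i => n (σ i)).symm.trans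
    ((Equiv.sigmaCongrLeft (β := fun i => Fin (n i)) σ).trans (flat n))

/-- The sum `(i, j) ↦ (i, τ i j)` of a family of bijections. -/
def sumEquiv {s : ℕ} {n n' : Fin s → ℕ} (τ : ∀ i, Fin (n i) ≃ Fin (n' i)) :
    Fin (∑ i, n i) ≃ Fin (∑ i, n' i) :=
  (flat n).symm.trans ((Equiv.sigmaCongrRight τ).trans (flat n'))

/-! ### Symmetric operads -/

variable (C) in
/-- A symmetric operad in a symmetric monoidal category. The objects `obj n` carry actions of the
symmetric groups, written covariantly and for all bijections `Fin m ≃ Fin n` (which forces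
`m = n`): the operation `act e p` has as its input number `e i` the input number `i` of `p`. -/
structure SymOperad where
  /-- The object of `n`-ary operations. -/
  obj : ℕ → C
  /-- The symmetric group actions. -/
  act : ∀ {m n : ℕ}, (Fin m ≃ Fin n) → (obj m ⟶ obj n)
  /-- The operad unit. -/
  one : 𝟙_ C ⟶ obj 1
  /-- The operad composition `p, (q i) ↦ p(q 0, …, q (s-1))`. -/
  comp : ∀ (s : ℕ) (n : Fin s → ℕ), obj s ⊗ tens (fun i => obj (n i)) ⟶ obj (∑ i, n i)
  act_refl : ∀ n : ℕ, act (Equiv.refl (Fin n)) = 𝟙 (obj n)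
  act_trans : ∀ {l m n : ℕ} (e : Fin l ≃ Fin m) (e' : Fin m ≃ Fin n),
    act (e.trans e') = act e ≫ act e'
  one_comp : ∀ n : ℕ,
    one ▷ tens (fun _ : Fin 1 => obj n) ≫ comp 1 (fun _ => n) =
      (λ_ _).hom ≫ (tensOne fun _ => obj n).hom ≫ act (oneCompEquiv n)
  comp_one : ∀ n : ℕ,
    obj n ◁ tensMap (fun _ : Fin n => one) ≫ comp n (fun _ => 1) =
      obj n ◁ (tensUnits n).hom ≫ (ρ_ (obj n)).hom ≫ act (compOneEquiv n)
  comp_assoc : ∀ (s : ℕ) (n : Fin s → ℕ) (m : Fin (∑ i, n i) → ℕ),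
    comp s n ▷ tens (fun x => obj (m x)) ≫ comp (∑ i, n i) m =
      (α_ _ _ _).hom ≫
        obj s ◁ blockMap n (fun i => obj (n i)) (fun i => obj (∑ j, m (flat n ⟨i, j⟩)))
          (fun x => obj (m x)) (fun i => comp (n i) (fun j => m (flat n ⟨i, j⟩))) ≫
        comp s (fun i => ∑ j, m (flat n ⟨i, j⟩)) ≫ act (assocEquiv n m)
  act_comp : ∀ {s t : ℕ} (σ : Fin s ≃ Fin t) (n : Fin t → ℕ),
    act σ ▷ tens (fun i => obj (n i)) ≫ comp t n =
      obj s ◁ (tensPerm σ fun i => obj (n i)).hom ≫ comp s (fun i => n (σ i)) ≫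
        act (blockEquiv σ n)
  comp_act : ∀ {s : ℕ} (n n' : Fin s → ℕ) (τ : ∀ i, Fin (n i) ≃ Fin (n' i)),
    obj s ◁ tensMap (fun i => act (τ i)) ≫ comp s n' = comp s n ≫ act (sumEquiv τ)

/-- A morphism of symmetric operads. -/
@[ext]
structure SymOperad.Hom (P Q : SymOperad C) where
  app : ∀ n : ℕ, P.obj n ⟶ Q.obj n
  act_app : ∀ {m n : ℕ} (e : Fin m ≃ Fin n), P.act e ≫ app n = app m ≫ Q.act e
  one_app : P.one ≫ app 1 = Q.one
  comp_app : ∀ (s : ℕ) (n : Fin s → ℕ),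
    P.comp s n ≫ app (∑ i, n i) = (app s ⊗ₘ tensMap (fun i => app (n i))) ≫ Q.comp s n

/-- An algebra over a symmetric operad. -/
structure SymOperad.Algebra (P : SymOperad C) where
  /-- The underlying object. -/
  X : C
  /-- The action maps. -/
  smul : ∀ n : ℕ, P.obj n ⊗ tens (fun _ : Fin n => X) ⟶ X
  one_smul : P.one ▷ tens (fun _ : Fin 1 => X) ≫ smul 1 = (λ_ _).hom ≫ (tensOne fun _ => X).hom
  comp_smul : ∀ (s : ℕ) (n : Fin s → ℕ),
    P.comp s n ▷ tens (fun _ : Fin (∑ i, n i) => X) ≫ smul (∑ i, n i) =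
      (α_ _ _ _).hom ≫
        P.obj s ◁ blockMap n (fun i => P.obj (n i)) (fun _ => X) (fun _ => X)
          (fun i => smul (n i)) ≫
        smul s
  act_smul : ∀ {m n : ℕ} (e : Fin m ≃ Fin n),
    P.act e ▷ tens (fun _ : Fin n => X) ≫ smul n =
      P.obj m ◁ (tensPerm e fun _ => X).hom ≫ smul m

/-- A morphism of algebras over a symmetric operad. -/
@[ext]
structure SymOperad.Algebra.Hom {P : SymOperad C} (A B : P.Algebra) where
  hom : A.X ⟶ B.X
  smul_hom : ∀ n : ℕ, A.smul n ≫ hom = P.obj n ◁ tensMap (fun _ => hom) ≫ B.smul n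

namespace SymOperad

/-- Composition of morphisms of operads. -/
def Hom.comp {P Q R : SymOperad C} (φ : P.Hom Q) (θ : Q.Hom R) : P.Hom R where
  app n := φ.app n ≫ θ.app n
  act_app e := by rw [← Category.assoc, φ.act_app, Category.assoc, θ.act_app, Category.assoc]
  one_app := by rw [← Category.assoc, φ.one_app, θ.one_app]
  comp_app s n := by
    rw [← Category.assoc, φ.comp_app, Category.assoc, θ.comp_app, tensMap_comp,
      tensorHom_comp_tensorHom_assoc]

/-- Restriction of an algebra along a morphism of operads. -/
def Algebra.restrict {P Q : SymOperad C} (φ : P.Hom Q) (B : Q.Algebra) : P.Algebra where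
  X := B.X
  smul n := φ.app n ▷ tens (fun _ : Fin n => B.X) ≫ B.smul n
  one_smul := by rw [← comp_whiskerRight_assoc, φ.one_app, B.one_smul]
  comp_smul s n := by
    rw [← comp_whiskerRight_assoc, φ.comp_app, comp_whiskerRight_assoc, B.comp_smul,
      ← tensMap_blockMap]
    simp only [MonoidalCategory.whiskerLeft_comp, Category.assoc]
    rw [tensorHom_def']
    simp only [comp_whiskerRight, Category.assoc]
    rw [associator_naturality_left_assoc, whisker_exchange_assoc, associator_naturality_middle_assoc,
      whisker_exchange_assoc]
  act_smul e := by
    rw [← comp_whiskerRight_assoc, φ.act_app, comp_whiskerRight_assoc, B.act_smul,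
      whisker_exchange_assoc]

/-- The `Q`-algebra `Q(0)`, with the action maps given by the operad composition. -/
def zeroAlgebra (Q : SymOperad C) : Q.Algebra where
  X := Q.obj 0
  smul n := Q.comp n (fun _ => 0) ≫ Q.act (finCongr (by simp))
  one_smul := by
    rw [reassoc_of% Q.one_comp 0, ← Q.act_trans,
      Subsingleton.elim ((oneCompEquiv 0).trans _) (Equiv.refl (Fin 0)), Q.act_refl,
      Category.comp_id]
  comp_smul s n := by
    have key := Q.comp_act (fun i => ∑ _j : Fin (n i), 0) (fun _ => 0) (fun i => finCongr (by simp))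
    rw [blockMap_comp, reassoc_of% Q.comp_assoc s n (fun _ => 0), MonoidalCategory.whiskerLeft_comp,
      Category.assoc, reassoc_of% key, ← Q.act_trans, ← Q.act_trans]
    congr 4
    exact Subsingleton.elim _ _
  act_smul e := by
    rw [reassoc_of% Q.act_comp e (fun _ => 0), ← Q.act_trans]
    congr 3
    exact Subsingleton.elim _ _

theorem act_subsingleton (P : SymOperad C) {m n : ℕ} (h : n ≤ 1) (e e' : Fin m ≃ Fin n) :
    P.act e = P.act e' := by
  have : Subsingleton (Fin n) := Fin.subsingleton_iff_le_one.mpr h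
  exact congrArg P.act (Subsingleton.elim _ _)

/-- The multiplication of unary operations. -/
def unaryMul (P : SymOperad C) : P.obj 1 ⊗ P.obj 1 ⟶ P.obj 1 :=
  P.obj 1 ◁ (tensOne fun _ => P.obj 1).inv ≫ P.comp 1 (fun _ => 1) ≫ P.act (oneCompEquiv 1).symm

theorem unary_one_mul (P : SymOperad C) :
    P.one ▷ P.obj 1 ≫ P.unaryMul = (λ_ (P.obj 1)).hom := by
  rw [unaryMul, ← whisker_exchange_assoc, reassoc_of% P.one_comp 1, ← P.act_trans,
    Equiv.self_trans_symm, P.act_refl, Category.comp_id, leftUnitor_naturality_assoc,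
    Iso.inv_hom_id, Category.comp_id]

theorem unary_mul_one (P : SymOperad C) :
    P.obj 1 ◁ P.one ≫ P.unaryMul = (ρ_ (P.obj 1)).hom := by
  have h2 : (tensOne fun _ => 𝟙_ C).inv ≫ (tensUnits 1).hom = 𝟙 (𝟙_ C) := by
    have : (λ_ (𝟙_ C)).inv ≫ 𝟙 (𝟙_ C) ▷ 𝟙_ C ≫ (λ_ (𝟙_ C)).hom = 𝟙 (𝟙_ C) := by simp
    exact this
  rw [unaryMul, ← MonoidalCategory.whiskerLeft_comp_assoc, tensOne_inv_naturality,
    MonoidalCategory.whiskerLeft_comp_assoc, reassoc_of% P.comp_one 1, ← P.act_trans,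
    ← MonoidalCategory.whiskerLeft_comp_assoc, h2,
    P.act_subsingleton le_rfl _ (Equiv.refl (Fin 1)), P.act_refl]
  simp

theorem unary_mul_assoc (P : SymOperad C) :
    P.unaryMul ▷ P.obj 1 ≫ P.unaryMul =
      (α_ _ _ _).hom ≫ P.obj 1 ◁ P.unaryMul ≫ P.unaryMul := by
  have hN : tens (fun _ : Fin (∑ _i : Fin 1, 1) => P.obj 1) =
      tens (fun _ : Fin 1 => P.obj 1) := tens_eq (by simp) _ _ fun _ => rfl
  have h1 := tensPerm_one (oneCompEquiv 1).symm (P.obj 1) hN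
  have h2 := P.act_comp (oneCompEquiv 1).symm (fun _ => 1)
  have h3 := P.comp_assoc 1 (fun _ => 1) (fun _ => 1)
  rw [blockMap_one _ _ _ _ _ hN] at h3
  have h4 := P.comp_act (s := 1) (fun _ => ∑ _j : Fin 1, 1) (fun _ => 1)
    (fun _ => (oneCompEquiv 1).symm)
  have hl : P.unaryMul ▷ P.obj 1 ≫ P.unaryMul =
      (α_ _ _ _).hom ≫ P.obj 1 ◁ P.obj 1 ◁ (tensOne fun _ => P.obj 1).inv ≫
        P.obj 1 ◁ P.comp 1 (fun _ => 1) ≫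
        P.obj 1 ◁ (tensOne fun _ => P.obj (∑ _j : Fin 1, 1)).inv ≫
        P.comp 1 (fun _ => ∑ _j : Fin 1, 1) ≫ P.act (assocEquiv (fun _ : Fin 1 => 1) fun _ => 1) ≫
        P.act (blockEquiv (oneCompEquiv 1).symm fun _ => 1) ≫ P.act (oneCompEquiv 1).symm := by
    have hk : P.obj 1 ◁ (tensOne fun _ => P.obj 1).inv ≫
        P.obj 1 ◁ (tensPerm (oneCompEquiv 1).symm fun _ => P.obj 1).hom ≫
        P.obj 1 ◁ eqToHom hN = P.obj 1 ◁ (tensOne fun _ => P.obj 1).inv := by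
      rw [← MonoidalCategory.whiskerLeft_comp, h1, MonoidalCategory.whiskerLeft_id,
        Category.comp_id]
    simp only [unaryMul, comp_whiskerRight, Category.assoc]
    rw [← whisker_exchange_assoc, reassoc_of% h2,
      ← whisker_exchange_assoc (P.comp 1 fun _ => 1),
      ← whisker_exchange_assoc (P.comp 1 fun _ => 1), reassoc_of% h3]
    simp only [MonoidalCategory.whiskerLeft_comp, Category.assoc]
    simp only [tensor_whiskerLeft, Category.assoc, whisker_assoc, Iso.inv_hom_id_assoc]
    have hk' : P.obj 1 ◁ (tensOne fun _ => P.obj 1).inv ▷ P.obj 1 ≫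
        P.obj 1 ◁ tens (fun _ : Fin 1 => P.obj 1) ◁ (tensOne fun _ => P.obj 1).inv ≫
        P.obj 1 ◁ tens (fun _ : Fin 1 => P.obj 1) ◁
          (tensPerm (oneCompEquiv 1).symm fun _ => P.obj 1).hom ≫
        P.obj 1 ◁ (tensOne fun _ => P.obj 1).hom ▷ tens (fun _ => P.obj 1) ≫
        P.obj 1 ◁ P.obj 1 ◁ eqToHom hN = P.obj 1 ◁ P.obj 1 ◁ (tensOne fun _ => P.obj 1).inv := by
      simp only [← MonoidalCategory.whiskerLeft_comp]
      rw [whisker_exchange_assoc, whisker_exchange_assoc, ← comp_whiskerRight_assoc,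
        Iso.inv_hom_id, id_whiskerRight, Category.id_comp]
      exact congrArg _ hk
    exact congrArg _ ((reassoc_of% hk') _)
  have hr : P.obj 1 ◁ P.unaryMul ≫ P.unaryMul =
      P.obj 1 ◁ P.obj 1 ◁ (tensOne fun _ => P.obj 1).inv ≫
        P.obj 1 ◁ P.comp 1 (fun _ => 1) ≫
        P.obj 1 ◁ (tensOne fun _ => P.obj (∑ _j : Fin 1, 1)).inv ≫
        P.comp 1 (fun _ => ∑ _j : Fin 1, 1) ≫
        P.act (sumEquiv fun _ : Fin 1 => (oneCompEquiv 1).symm) ≫ P.act (oneCompEquiv 1).symm := by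
    have hk : P.obj 1 ◁ P.act (oneCompEquiv 1).symm ≫ P.obj 1 ◁ (tensOne fun _ => P.obj 1).inv =
        P.obj 1 ◁ (tensOne fun _ => P.obj (∑ _j : Fin 1, 1)).inv ≫
          P.obj 1 ◁ tensMap (fun _ : Fin 1 => P.act (oneCompEquiv 1).symm) := by
      rw [← MonoidalCategory.whiskerLeft_comp, tensOne_inv_naturality,
        MonoidalCategory.whiskerLeft_comp]
    simp only [unaryMul, MonoidalCategory.whiskerLeft_comp, Category.assoc]
    rw [reassoc_of% hk, reassoc_of% h4]
  rw [hl, hr]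
  simp only [← P.act_trans]
  rw [P.act_subsingleton le_rfl]

/-- The monoid `P(1)` of unary operations. -/
instance monObjUnary (P : SymOperad C) : MonObj (P.obj 1) where
  one := P.one
  mul := P.unaryMul
  one_mul := P.unary_one_mul
  mul_one := P.unary_mul_one
  mul_assoc := P.unary_mul_assoc

end SymOperad

/-! ### Modules over an algebra over an operad -/

/-- The morphism of families which is `f` at the index `k` and the identity elsewhere. -/
def markMap {ι : Type} [DecidableEq ι] (A : C) {M N : C} (f : M ⟶ N) (k i : ι) :
    mark A M k i ⟶ mark A N k i :=
  if h : i = k then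
    eqToHom (by rw [h, mark_self]) ≫ f ≫ eqToHom (by rw [h, mark_self])
  else eqToHom (by rw [mark_of_ne A M h, mark_of_ne A N h])

theorem markMap_id {ι : Type} [DecidableEq ι] (A M : C) (k i : ι) :
    markMap A (𝟙 M) k i = 𝟙 _ := by
  by_cases h : i = k <;> simp [markMap, h]

theorem markMap_comp {ι : Type} [DecidableEq ι] (A : C) {L M N : C} (f : L ⟶ M) (g : M ⟶ N)
    (k i : ι) : markMap A (f ≫ g) k i = markMap A f k i ≫ markMap A g k i := by
  by_cases h : i = k <;> simp [markMap, h]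

/-- Given action maps `μ` on `M` and the index `(l, r)` of the factor `M`, the map on the factors
of the block `i`: the module action map of `M` if `i = l`, and the algebra action map of `A`
otherwise. -/
def blockAct {P : SymOperad C} (A : P.Algebra) (M : C)
    (μ : ∀ {n : ℕ} (k : Fin n), P.obj n ⊗ tens (mark A.X M k) ⟶ M)
    {s : ℕ} (n : Fin s → ℕ) (l : Fin s) (r : Fin (n l)) (i : Fin s) :
    P.obj (n i) ⊗ tens (fun j : Fin (n i) => mark A.X M (flat n ⟨l, r⟩) (flat n ⟨i, j⟩)) ⟶
      mark A.X M l i :=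
  if h : i = l then
    P.obj (n i) ◁ (tensCongr fun j => mark_flat_same n A.X M l r i h j).hom ≫
      μ (Fin.cast (congrArg n h.symm) r) ≫ eqToHom (by rw [h, mark_self])
  else
    P.obj (n i) ◁ (tensCongr fun j => mark_flat_ne n A.X M l r i h j).hom ≫
      A.smul (n i) ≫ eqToHom (mark_of_ne A.X M h).symm

/-- The structure of an `A`-module (under `P`) on an object `M`. The index `k : Fin n` is the
position of the factor `M`. -/
@[ext]
structure ModuleStr {P : SymOperad C} (A : P.Algebra) (M : C) where
  /-- The action maps `P(n) ⊗ A ⊗ ⋯ ⊗ A ⊗ M ⊗ A ⊗ ⋯ ⊗ A ⟶ M`. -/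
  smul : ∀ {n : ℕ} (k : Fin n), P.obj n ⊗ tens (mark A.X M k) ⟶ M
  one_smul : P.one ▷ tens (mark A.X M (0 : Fin 1)) ≫ smul 0 =
    (λ_ _).hom ≫ (tensOne (mark A.X M (0 : Fin 1))).hom ≫ eqToHom (mark_self A.X M 0)
  comp_smul : ∀ (s : ℕ) (n : Fin s → ℕ) (l : Fin s) (r : Fin (n l)),
    P.comp s n ▷ tens (mark A.X M (flat n ⟨l, r⟩)) ≫ smul (flat n ⟨l, r⟩) =
      (α_ _ _ _).hom ≫
        P.obj s ◁ blockMap n (fun i => P.obj (n i)) (mark A.X M l) (mark A.X M (flat n ⟨l, r⟩))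
          (blockAct A M smul n l r) ≫
        smul l
  act_smul : ∀ {m n : ℕ} (e : Fin m ≃ Fin n) (k : Fin m),
    P.act e ▷ tens (mark A.X M (e k)) ≫ smul (e k) =
      P.obj m ◁ ((tensPerm e (mark A.X M (e k))).hom ≫
        (tensCongr fun i => mark_equiv A.X M e k i).hom) ≫ smul k

/-- An `A`-module under `P`. -/
structure OperadModule {P : SymOperad C} (A : P.Algebra) where
  /-- The underlying object. -/
  X : C
  /-- The module structure. -/
  str : ModuleStr A X

/-- A morphism of `A`-modules under `P`. -/
@[ext]
structure OperadModule.Hom {P : SymOperad C} {A : P.Algebra} (M N : OperadModule A) where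
  hom : M.X ⟶ N.X
  smul_hom : ∀ {n : ℕ} (k : Fin n),
    M.str.smul k ≫ hom = P.obj n ◁ tensMap (markMap A.X hom k) ≫ N.str.smul k

/-- The category of `A`-modules under `P`. -/
instance {P : SymOperad C} (A : P.Algebra) : Category (OperadModule A) where
  Hom M N := M.Hom N
  id M :=
    { hom := 𝟙 M.X
      smul_hom := fun k => by
        have : markMap A.X (𝟙 M.X) k = fun i => 𝟙 (mark A.X M.X k i) :=
          funext fun i => markMap_id A.X M.X k i
        simp [this, tensMap_id] }
  comp f g :=
    { hom := f.hom ≫ g.hom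
      smul_hom := fun k => by
        have : markMap A.X (f.hom ≫ g.hom) k =
            fun i => markMap A.X f.hom k i ≫ markMap A.X g.hom k i :=
          funext fun i => markMap_comp A.X f.hom g.hom k i
        rw [this, tensMap_comp, ← Category.assoc, f.smul_hom, Category.assoc, g.smul_hom,
          MonoidalCategory.whiskerLeft_comp, Category.assoc] }
  id_comp f := OperadModule.Hom.ext (Category.id_comp f.hom)
  comp_id f := OperadModule.Hom.ext (Category.comp_id f.hom)
  assoc f g h := OperadModule.Hom.ext (Category.assoc f.hom g.hom h.hom)

/-- The forgetful functor from `A`-modules under `P` to the underlying category. -/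
def OperadModule.forget {P : SymOperad C} (A : P.Algebra) : OperadModule A ⥤ C where
  obj M := M.X
  map f := f.hom

/-! ### The enveloping operad -/

/-- An enveloping operad of the `P`-algebra `A`: an operad `P_A` with a universal pair consisting of
an operad morphism `η : P ⟶ P_A` and a morphism of `P`-algebras `A ⟶ η^* P_A(0)`. -/
structure EnvelopingOperad {P : SymOperad C} (A : P.Algebra) where
  /-- The enveloping operad `P_A`. -/
  operad : SymOperad C
  /-- The universal operad morphism. -/
  η : P.Hom operad
  /-- The universal morphism of `P`-algebras. -/
  ηAlg : A.Hom (operad.zeroAlgebra.restrict η)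
  existsUnique_hom : ∀ (Q : SymOperad C) (φ : P.Hom Q) (ψ : A.Hom (Q.zeroAlgebra.restrict φ)),
    ∃! θ : operad.Hom Q, η.comp θ = φ ∧ ηAlg.hom ≫ θ.app 0 = ψ.hom

/-- The morphism `Q(n+1) ⊗ Q(0) ⊗ ⋯ ⊗ Q(0) ⟶ Q(1)` which sends `q, b 0, …, b (n-1)` to the operation
`q(b 0, …, b (k-1), 1, b k, …, b (n-1))`. -/
def plugConstants (Q : SymOperad C) {n : ℕ} (k : Fin (n + 1)) :
    Q.obj (n + 1) ⊗ tens (fun _ : Fin n => Q.obj 0) ⟶ Q.obj 1 :=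
  Q.obj (n + 1) ◁
      ((ρ_ _).inv ≫ tens (fun _ : Fin n => Q.obj 0) ◁ Q.one ≫
        ((tensCongr (fun i : Fin n => by rw [if_neg (Fin.succAbove_ne k i)])).hom ⊗ₘ
          eqToHom (by rw [if_pos rfl])) ≫
        (tensExtract (fun i : Fin (n + 1) => Q.obj (if i = k then 1 else 0)) k).inv) ≫
    Q.comp (n + 1) (fun i => if i = k then 1 else 0) ≫ Q.act (finCongr (by simp))

/-- For a module `M` over the monoid `P_A(1)`, the action map
`P(n+1) ⊗ A ⊗ ⋯ ⊗ A ⊗ M ⊗ A ⊗ ⋯ ⊗ A ⟶ M` (with `M` at the position `k`) which sends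
`p, a 0, …, a (k-1), x, a k, …, a (n-1)` to `p(a 0, …, a (k-1), 1, a k, …, a (n-1)) • x`, where the
operation acting on `x` is the unary operation of `P_A` obtained via the universal pair. -/
def EnvelopingOperad.smul {P : SymOperad C} {A : P.Algebra} (E : EnvelopingOperad A)
    (M : Mod C (E.operad.obj 1)) {n : ℕ} (k : Fin (n + 1)) :
    P.obj (n + 1) ⊗ tens (mark A.X M.X k) ⟶ M.X :=
  P.obj (n + 1) ◁ ((tensExtract (mark A.X M.X k) k).hom ≫
      ((tensCongr fun i => mark_of_ne A.X M.X (Fin.succAbove_ne k i)).hom ⊗ₘ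
        eqToHom (mark_self A.X M.X k))) ≫
    (α_ _ _ _).inv ≫
    ((E.η.app (n + 1) ⊗ₘ tensMap (fun _ : Fin n => E.ηAlg.hom)) ≫ plugConstants E.operad k) ▷ M.X ≫
    ModObj.smul (M := E.operad.obj 1) (X := M.X)

end Symmetric

end OperadTheory

end

/-!
Let `A` be an algebra over the operad `P`. The operations of the enveloping operad with `n` inputs
should be the terms `p(a 0, …, a (k-1), x 0, …, x (n-1))`, in which `p` is an operation of `P`, the
`a i` are constants from `A` and each variable occurs once, modulo the evaluation of subterms
without variables in `A`. Accordingly, `envObj A n` is defined to be the quotient of the coproduct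
of the objects `P(k+n) ⊗ A ⊗ ⋯ ⊗ A` by the relations
`p(q 0, …, q (k-1), 1, …, 1), a ∼ p, (q 0 a, …, q (k-1) a)`.

Constructions and verifications with terms make sense in a general symmetric monoidal category by
means of generalized elements. An element of `X` (`Elt X`) is a morphism to `X` from a tensor
product of objects which are attached to distinct named variables. Elements `x` of `X` and `y` of
`Y` without a common variable have a product `x ⋆ y`. Since the variables carry names, products are
commutative and associative up to the structure morphisms, with no permutation of variables to be
tracked. A morphism out of `X ⊗ Y` is determined by its effect on products of elements from
detecting sets (`Detecting.mul`, `Detecting.eq_of_map_eq`). So the elements of an operad form an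
operad of sets (`SymOperad.elts`), and the same holds for algebras and modules.

For an operad of sets, the terms with labels in a set form a monad (`Term.bind`), and operations
can be identified with terms labelled by their inputs (`SetOperad.opTerm_injective`). The axioms
for an operad then become the laws of a monad. A linear term `t` with constants in `A` represents
an element `cls A t` of `envObj A n`. These elements are detecting (`detecting_clsSet`), and a
function of terms which respects the evaluation of subterms (`Step`), and which is given by
morphisms on terms in standard form, is induced by a morphism (`exists_desc`). This is where the
closedness of the category is used: tensoring preserves the colimit which defines `envObj A n`.
Renaming and substitution of terms give the operad structure of `envOperad A`. Its universal
property holds since a term can be interpreted in every operad `Q` under `P` with a map of algebras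
from `A` to the constants of `Q` (`interp`, `Step.interp_eq`), and since each term represents its
own interpretation in `envOperad A` (`op_cls`).

A linear term with one variable is of the form `p(a 0, …, x, …, a (n-1))`. It acts on a module
under `P` through the action maps of the module (`ev`), and the axioms for a module say that this
action respects the evaluation of subterms (`Step.ev_eq`) and the substitution of terms
(`ev_subst`). So the module becomes a module over the unary operations of the enveloping operad
(`exists_act`). Conversely, an action of the unary operations restricts along the operations which
are denoted by terms to the action maps of a module (`exists_denotes`, `isModuleAction_actionMap`).
The two constructions are inverse to each other since the unary operations which are denoted by
terms are detecting; this holds for every enveloping operad, by its comparison with `envOperad A`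
(`detecting_denotes`).
-/

open CategoryTheory MonoidalCategory Limits

noncomputable section

namespace OperadTheory

/-! ### Generalized elements -/

section Elements

variable {C : Type u} [Category.{v} C] [MonoidalCategory C]

/-- The tensor product of the objects occurring in a list, where `none` marks an unused position.
The positions of the list are thought of as names of variables, and an entry `some c` as a variable
of type `c`. -/
def stage : List (Option C) → C
  | [] => 𝟙_ C
  | none :: l => stage l
  | some c :: l => c ⊗ stage l

/-- The morphisms from a stage to `X`. -/
abbrev StageMap {C : Type u} [Category.{v} C] [MonoidalCategory C] (X : C) : Type max u v :=
  Σ l : List (Option C), stage l ⟶ X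

theorem assoc_inv_left_comp (c : C) {T S A B D : C} (t : T ⟶ S ⊗ D) (s : S ⟶ A ⊗ B) :
    (c ◁ t ≫ (α_ c S D).inv) ≫ (c ◁ s ≫ (α_ c A B).inv) ▷ D ≫ (α_ (c ⊗ A) B D).hom =
      c ◁ (t ≫ s ▷ D ≫ (α_ A B D).hom) ≫ (α_ c A (B ⊗ D)).inv := by
  simp

theorem assoc_inv_right_comp (c : C) {T S A B : C} (t : T ⟶ A ⊗ S) (s : S ⟶ B) :
    c ◁ (t ≫ A ◁ s) ≫ (α_ c A B).inv = (c ◁ t ≫ (α_ c A S).inv) ≫ (c ⊗ A) ◁ s := by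
  simp

variable [SymmetricCategory C]

/-- The union of two lists of variables, together with the symmetry that separates the variables of
the two lists. It is `none` if a position is used in both lists. -/
def shuffle : (l l' : List (Option C)) →
    Option (Σ k : List (Option C), stage k ≅ stage l ⊗ stage l')
  | [], l' => some ⟨l', (λ_ _).symm⟩
  | a :: l, [] => some ⟨a :: l, (ρ_ _).symm⟩
  | none :: l, none :: l' => (shuffle l l').map fun s => ⟨none :: s.1, s.2⟩
  | some c :: l, none :: l' =>
    (shuffle l l').map fun s => ⟨some c :: s.1, whiskerLeftIso c s.2 ≪≫ (α_ _ _ _).symm⟩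
  | none :: l, some c :: l' =>
    (shuffle l l').map fun s => ⟨some c :: s.1, whiskerLeftIso c s.2 ≪≫ (α_ _ _ _).symm ≪≫
      whiskerRightIso (β_ _ _) _ ≪≫ α_ _ _ _⟩
  | some _ :: _, some _ :: _ => none

theorem shuffle_nil (l : List (Option C)) :
    shuffle l [] = some ⟨l, (ρ_ (stage l)).symm⟩ := by
  cases l with
  | nil =>
    simp only [shuffle]
    congr 2
    ext
    simp [stage, unitors_inv_equal]
  | cons a l => simp [shuffle]

/-- The symmetry that inserts `c` behind `A`. -/
def insertSnd (c A B : C) : c ⊗ (A ⊗ B) ⟶ A ⊗ (c ⊗ B) :=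
  (α_ c A B).inv ≫ (β_ c A).hom ▷ B ≫ (α_ A c B).hom

theorem insertSnd_natural (c : C) {A A' B B' : C} (f : A ⟶ A') (g : B ⟶ B') :
    insertSnd c A B ≫ (f ⊗ₘ (c ◁ g)) = c ◁ (f ⊗ₘ g) ≫ insertSnd c A' B' := by
  simp only [insertSnd, Category.assoc, ← id_tensorHom, ← tensorHom_id]
  rw [associator_inv_naturality_assoc, ← associator_naturality, tensorHom_comp_tensorHom_assoc,
    tensorHom_comp_tensorHom_assoc, ← BraidedCategory.braiding_naturality]
  simp

theorem insertSnd_left (c : C) {A A' : C} (f : A ⟶ A') (B : C) :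
    insertSnd c A B ≫ f ▷ (c ⊗ B) = c ◁ f ▷ B ≫ insertSnd c A' B := by
  simpa using insertSnd_natural c f (𝟙 B)

theorem insertSnd_right (c A : C) {B B' : C} (g : B ⟶ B') :
    insertSnd c A B ≫ A ◁ c ◁ g = c ◁ A ◁ g ≫ insertSnd c A B' := by
  simpa using insertSnd_natural c (𝟙 A) g

theorem insertSnd_braiding (c A B : C) :
    insertSnd c A B ≫ (β_ A (c ⊗ B)).hom = c ◁ (β_ A B).hom ≫ (α_ c B A).inv := by
  simp only [insertSnd, BraidedCategory.braiding_tensor_right_hom, Category.assoc,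
    Iso.hom_inv_id_assoc]
  rw [← comp_whiskerRight_assoc, SymmetricCategory.symmetry, id_whiskerRight, Category.id_comp,
    Iso.inv_hom_id_assoc]

theorem assoc_inv_braiding (c A B : C) :
    (α_ c A B).inv ≫ (β_ (c ⊗ A) B).hom = c ◁ (β_ A B).hom ≫ insertSnd c B A := by
  simp [insertSnd, BraidedCategory.braiding_tensor_left_hom]

theorem insertSnd_assoc (c A B D : C) :
    insertSnd c (A ⊗ B) D ≫ (α_ _ _ _).hom =
      c ◁ (α_ _ _ _).hom ≫ insertSnd c A (B ⊗ D) ≫ A ◁ insertSnd c B D := by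
  simp only [insertSnd, BraidedCategory.braiding_tensor_right_hom]
  monoidal

theorem assoc_inv_insertSnd (c A B D : C) :
    (α_ c (A ⊗ B) D).inv ≫ insertSnd c A B ▷ D ≫ (α_ _ _ _).hom =
      c ◁ (α_ _ _ _).hom ≫ insertSnd c A (B ⊗ D) ≫ A ◁ (α_ _ _ _).inv := by
  simp only [insertSnd]
  monoidal

theorem insertSnd_comm (c : C) {S A B : C} (s : S ⟶ A ⊗ B) :
    (c ◁ s ≫ insertSnd c A B) ≫ (β_ A (c ⊗ B)).hom =
      c ◁ (s ≫ (β_ A B).hom) ≫ (α_ c B A).inv := by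
  rw [Category.assoc, insertSnd_braiding, MonoidalCategory.whiskerLeft_comp, Category.assoc]

theorem assoc_inv_comm (c : C) {S A B : C} (s : S ⟶ A ⊗ B) :
    (c ◁ s ≫ (α_ c A B).inv) ≫ (β_ (c ⊗ A) B).hom =
      c ◁ (s ≫ (β_ A B).hom) ≫ insertSnd c B A := by
  rw [Category.assoc, assoc_inv_braiding, MonoidalCategory.whiskerLeft_comp, Category.assoc]

theorem insertSnd_left_comp (c : C) {T S A B D : C} (t : T ⟶ S ⊗ D) (s : S ⟶ A ⊗ B) :
    (c ◁ t ≫ insertSnd c S D) ≫ s ▷ (c ⊗ D) ≫ (α_ A B (c ⊗ D)).hom =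
      c ◁ (t ≫ s ▷ D ≫ (α_ A B D).hom) ≫ insertSnd c A (B ⊗ D) ≫ A ◁ insertSnd c B D := by
  rw [Category.assoc, reassoc_of% insertSnd_left c s D, insertSnd_assoc]
  simp

theorem insertSnd_right_comp (c : C) {T S A B E : C} (t : T ⟶ A ⊗ S) (s : S ⟶ B)
    (r : c ⊗ B ⟶ E) :
    (c ◁ t ≫ insertSnd c A S) ≫ A ◁ (c ◁ s ≫ r) =
      c ◁ (t ≫ A ◁ s) ≫ insertSnd c A B ≫ A ◁ r := by
  rw [Category.assoc, MonoidalCategory.whiskerLeft_comp, reassoc_of% insertSnd_right c A s]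
  simp

theorem assoc_inv_insertSnd_comp (c : C) {T S A B D : C} (t : T ⟶ S ⊗ D) (s : S ⟶ A ⊗ B) :
    (c ◁ t ≫ (α_ c S D).inv) ≫ (c ◁ s ≫ insertSnd c A B) ▷ D ≫ (α_ A (c ⊗ B) D).hom =
      c ◁ (t ≫ s ▷ D ≫ (α_ A B D).hom) ≫ insertSnd c A (B ⊗ D) ≫ A ◁ (α_ c B D).inv := by
  rw [comp_whiskerRight, Category.assoc, Category.assoc, ← associator_inv_naturality_middle_assoc,
    assoc_inv_insertSnd]
  simp

/-- Merging two lists in the opposite order gives the same list, and the two isomorphisms differ by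
the symmetry: the factors of a stage are ordered by position and not by their origin. -/
theorem shuffle_comm (l l' : List (Option C)) :
    (shuffle l l').map (fun s => (⟨s.1, s.2.hom ≫ (β_ _ _).hom⟩ : StageMap _)) =
      (shuffle l' l).map fun s => ⟨s.1, s.2.hom⟩ := by
  induction l generalizing l' with
  | nil =>
    rw [shuffle_nil]
    simp [shuffle, stage]
  | cons a l ih =>
    cases l' with
    | nil =>
      rw [shuffle_nil]
      simp [shuffle, stage]
    | cons b l' =>
      have ih := ih l'
      cases a with
      | none =>
        cases b with
        | none =>
          have := congrArg (Option.map fun s : StageMap _ => (⟨none :: s.1, s.2⟩ : StageMap _)) ih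
          simp only [shuffle, Option.map_map, Function.comp_def] at this ⊢
          exact this
        | some c =>
          have := congrArg (Option.map fun s : StageMap _ =>
            (⟨some c :: s.1, c ◁ s.2 ≫ (α_ _ _ _).inv⟩ : StageMap _)) ih
          simp only [shuffle, Option.map_map, Function.comp_def] at this ⊢
          refine Eq.trans ?_ this
          refine congrArg (fun f => Option.map f _) (funext fun s => congrArg (Sigma.mk _) ?_)
          exact insertSnd_comm c s.2.hom
      | some c =>
        cases b with
        | none =>
          have := congrArg (Option.map fun s : StageMap _ =>
            (⟨some c :: s.1, c ◁ s.2 ≫ insertSnd c _ _⟩ : StageMap _)) ih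
          simp only [shuffle, Option.map_map, Function.comp_def] at this ⊢
          refine Eq.trans ?_ this
          refine congrArg (fun f => Option.map f _) (funext fun s => congrArg (Sigma.mk _) ?_)
          exact assoc_inv_comm c s.2.hom
        | some d => simp [shuffle]

/-- Merging three lists in two ways gives the same list, and the two isomorphisms differ by the
associator. -/
theorem shuffle_assoc (l l' l'' : List (Option C)) :
    ((shuffle l l').bind fun s => (shuffle s.1 l'').map fun t =>
      (⟨t.1, t.2.hom ≫ s.2.hom ▷ _ ≫ (α_ _ _ _).hom⟩ : StageMap _)) =
    (shuffle l' l'').bind fun s => (shuffle l s.1).map fun t => ⟨t.1, t.2.hom ≫ _ ◁ s.2.hom⟩ := by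
  induction l generalizing l' l'' with
  | nil =>
    simp only [shuffle, Option.bind_some, Option.map_some]
    cases shuffle l' l'' with
    | none => rfl
    | some s =>
      simp only [Option.map_some, Option.bind_some]
      refine congrArg some (congrArg (Sigma.mk _) ?_)
      simp [stage]
  | cons a l ih =>
    cases l' with
    | nil =>
      simp only [shuffle, Option.bind_some]
      refine congrArg (fun f => Option.map f _) (funext fun s => congrArg (Sigma.mk _) ?_)
      simp [stage]
    | cons b l' =>
      cases l'' with
      | nil =>
        simp only [shuffle_nil, Option.bind_some, Option.map_some]
        cases shuffle (a :: l) (b :: l') with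
        | none => rfl
        | some s =>
          simp only [Option.map_some, Option.bind_some]
          refine congrArg some (congrArg (Sigma.mk _) ?_)
          simp [stage]
      | cons d' l'' =>
        have ih := ih l' l''
        cases a with
        | none =>
          cases b with
          | none =>
            cases d' with
            | none =>
              have := congrArg
                (Option.map fun s : StageMap _ => (⟨none :: s.1, s.2⟩ : StageMap _)) ih
              simp only [shuffle, Option.map_map, Function.comp_def, Option.map_bind,
                Option.bind_map] at this ⊢
              exact this
            | some c =>
              have := congrArg (Option.map fun s : StageMap _ =>
                (⟨some c :: s.1, c ◁ s.2 ≫ insertSnd c _ _ ≫ _ ◁ insertSnd c _ _⟩ :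
                  StageMap _)) ih
              simp only [shuffle, Option.map_map, Function.comp_def, Option.map_bind,
                Option.bind_map] at this ⊢
              refine Eq.trans ?_ (this.trans ?_)
              · refine congrArg (Option.bind _) (funext fun s => congrArg (fun f => Option.map f _)
                  (funext fun t => congrArg (Sigma.mk _) ?_))
                exact insertSnd_left_comp c t.2.hom s.2.hom
              · refine congrArg (Option.bind _) (funext fun s => congrArg (fun f => Option.map f _)
                  (funext fun t => congrArg (Sigma.mk _) ?_))
                exact (insertSnd_right_comp c t.2.hom s.2.hom _).symm
          | some c =>
            cases d' with
            | none =>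
              have := congrArg (Option.map fun s : StageMap _ =>
                (⟨some c :: s.1, c ◁ s.2 ≫ insertSnd c _ _ ≫ _ ◁ (α_ _ _ _).inv⟩ :
                  StageMap _)) ih
              simp only [shuffle, Option.map_map, Function.comp_def, Option.map_bind,
                Option.bind_map] at this ⊢
              refine Eq.trans ?_ (this.trans ?_)
              · refine congrArg (Option.bind _) (funext fun s => congrArg (fun f => Option.map f _)
                  (funext fun t => congrArg (Sigma.mk _) ?_))
                exact assoc_inv_insertSnd_comp c t.2.hom s.2.hom
              · refine congrArg (Option.bind _) (funext fun s => congrArg (fun f => Option.map f _)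
                  (funext fun t => congrArg (Sigma.mk _) ?_))
                exact (insertSnd_right_comp c t.2.hom s.2.hom _).symm
            | some d =>
              simp only [shuffle, Option.map_none, Option.bind_map, Function.comp_def,
                Option.bind_none, Option.bind_fun_none]
        | some c =>
          cases b with
          | none =>
            cases d' with
            | none =>
              have := congrArg (Option.map fun s : StageMap _ =>
                (⟨some c :: s.1, c ◁ s.2 ≫ (α_ _ _ _).inv⟩ : StageMap _)) ih
              simp only [shuffle, Option.map_map, Function.comp_def, Option.map_bind,
                Option.bind_map] at this ⊢
              refine Eq.trans ?_ (this.trans ?_)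
              · refine congrArg (Option.bind _) (funext fun s => congrArg (fun f => Option.map f _)
                  (funext fun t => congrArg (Sigma.mk _) ?_))
                exact assoc_inv_left_comp c t.2.hom s.2.hom
              · refine congrArg (Option.bind _) (funext fun s => congrArg (fun f => Option.map f _)
                  (funext fun t => congrArg (Sigma.mk _) ?_))
                exact assoc_inv_right_comp c t.2.hom s.2.hom
            | some d =>
              simp only [shuffle, Option.map_none, Option.bind_map, Function.comp_def,
                Option.bind_fun_none]
          | some d =>
            cases d' <;>
              simp only [shuffle, Option.map_none, Option.bind_map, Function.comp_def,
                Option.bind_none, Option.bind_fun_none]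

end Elements

section Elements

variable {C : Type u} [Category.{v} C] [MonoidalCategory C]

/-- The generalized elements of `X`: the morphisms from a stage to `X`, together with an absorbing
element `none`, which is the product of elements which share a variable. -/
def Elt (X : C) : Type max u v := Option (StageMap X)

/-- The action of a morphism on generalized elements. -/
def Elt.map {X Y : C} (f : X ⟶ Y) (x : Elt X) : Elt Y :=
  Option.map (fun s => ⟨s.1, s.2 ≫ f⟩) x

variable (C) in
/-- The element of the unit object which contains no variables. -/
def Elt.unit : Elt (𝟙_ C) := some ⟨[], 𝟙 (𝟙_ C)⟩

@[simp]
theorem Elt.map_id {X : C} (x : Elt X) : Elt.map (𝟙 X) x = x := by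
  cases x <;> simp [Elt.map] <;> rfl

@[simp]
theorem Elt.map_comp {X Y Z : C} (f : X ⟶ Y) (g : Y ⟶ Z) (x : Elt X) :
    Elt.map (f ≫ g) x = Elt.map g (Elt.map f x) := by
  cases x <;> simp [Elt.map] <;> rfl

/-- Applies an equation between morphisms to an element. -/
theorem Elt.congr_map {X Y : C} {f g : X ⟶ Y} (h : f = g) (x : Elt X) :
    Elt.map f x = Elt.map g x := by rw [h]

theorem Elt.map_hom_inv {X Y : C} (e : X ≅ Y) (x : Elt X) :
    Elt.map e.inv (Elt.map e.hom x) = x := by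
  rw [← Elt.map_comp, Iso.hom_inv_id, Elt.map_id]

theorem Elt.map_inv_eq {X Y : C} (e : X ≅ Y) {x : Elt X} {y : Elt Y} (h : Elt.map e.hom x = y) :
    Elt.map e.inv y = x := by
  rw [← h, Elt.map_hom_inv]

theorem Elt.map_eqToHom {ι : Type*} {X : ι → C} (x : ∀ i, Elt (X i)) {i j : ι} (h : i = j)
    (h' : X i = X j) : Elt.map (eqToHom h') (x i) = x j := by
  subst h
  simp

variable [SymmetricCategory C]

/-- The product of two elements, which is `none` if they share a variable. The variables of the
product are ordered by position, so that the product is commutative and associative up to the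
symmetry and the associator, without a permutation of the domain. -/
def Elt.mul {X Y : C} (x : Elt X) (y : Elt Y) : Elt (X ⊗ Y) :=
  Option.bind x fun s => Option.bind y fun t =>
    (shuffle s.1 t.1).map fun k => ⟨k.1, k.2.hom ≫ (s.2 ⊗ₘ t.2)⟩

/-- The product of two elements. -/
infixl:72 " ⋆ " => Elt.mul

@[simp]
theorem Elt.map_tensorHom {X X' Y Y' : C} (f : X ⟶ X') (g : Y ⟶ Y') (x : Elt X) (y : Elt Y) :
    Elt.map (f ⊗ₘ g) (x ⋆ y) = Elt.map f x ⋆ Elt.map g y := by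
  rcases x with _ | s
  · rfl
  rcases y with _ | t
  · rfl
  simp only [Elt.map, Elt.mul, Option.bind_some, Option.map_map, Option.map_some]
  congr 1
  funext k
  simp

@[simp]
theorem Elt.map_whiskerLeft {X Y Y' : C} (g : Y ⟶ Y') (x : Elt X) (y : Elt Y) :
    Elt.map (X ◁ g) (x ⋆ y) = x ⋆ Elt.map g y := by
  rw [← id_tensorHom, Elt.map_tensorHom, Elt.map_id]

@[simp]
theorem Elt.map_whiskerRight {X X' Y : C} (f : X ⟶ X') (x : Elt X) (y : Elt Y) :
    Elt.map (f ▷ Y) (x ⋆ y) = Elt.map f x ⋆ y := by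
  rw [← tensorHom_id, Elt.map_tensorHom, Elt.map_id]

@[simp]
theorem Elt.map_braiding_hom {X Y : C} (x : Elt X) (y : Elt Y) :
    Elt.map (β_ X Y).hom (x ⋆ y) = y ⋆ x := by
  rcases x with _ | s
  · rcases y with _ | t <;> rfl
  rcases y with _ | t
  · rfl
  have := congrArg (Option.map fun k : StageMap _ => (⟨k.1, k.2 ≫ (t.2 ⊗ₘ s.2)⟩ : StageMap _))
    (shuffle_comm s.1 t.1)
  simp only [Option.map_map, Function.comp_def] at this
  simp only [Elt.map, Elt.mul, Option.bind_some, Option.map_map, ← this]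
  congr 1
  funext k
  simp

@[simp]
theorem Elt.map_associator_hom {X Y Z : C} (x : Elt X) (y : Elt Y) (z : Elt Z) :
    Elt.map (α_ X Y Z).hom (x ⋆ y ⋆ z) = x ⋆ (y ⋆ z) := by
  rcases x with _ | s
  · rfl
  rcases y with _ | t
  · rfl
  rcases z with _ | r
  · simp [Elt.map, Elt.mul]
    rfl
  have := congrArg
    (Option.map fun k : StageMap _ => (⟨k.1, k.2 ≫ (s.2 ⊗ₘ (t.2 ⊗ₘ r.2))⟩ : StageMap _))
    (shuffle_assoc s.1 t.1 r.1)
  simp only [Option.map_map, Function.comp_def, Option.map_bind] at this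
  simp only [Elt.map, Elt.mul, Option.bind_some, Option.map_map, Option.map_bind, Option.bind_map,
    Function.comp_def] at this ⊢
  refine Eq.trans ?_ (this.trans ?_)
  · congr 1
    funext k
    congr 1
    funext l
    congr 1
    simp [MonoidalCategory.tensorHom_def]
  · congr 1
    funext k
    congr 1
    funext l
    congr 1
    simp [MonoidalCategory.tensorHom_def']

@[simp]
theorem Elt.map_associator_inv {X Y Z : C} (x : Elt X) (y : Elt Y) (z : Elt Z) :
    Elt.map (α_ X Y Z).inv (x ⋆ (y ⋆ z)) = x ⋆ y ⋆ z :=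
  Elt.map_inv_eq _ (Elt.map_associator_hom x y z)

@[simp]
theorem Elt.map_leftUnitor_hom {X : C} (x : Elt X) :
    Elt.map (λ_ X).hom (Elt.unit C ⋆ x) = x := by
  rcases x with _ | s
  · rfl
  · simp [Elt.map, Elt.mul, Elt.unit, shuffle, stage]
    rfl

@[simp]
theorem Elt.map_leftUnitor_inv {X : C} (x : Elt X) :
    Elt.map (λ_ X).inv x = Elt.unit C ⋆ x :=
  Elt.map_inv_eq _ (Elt.map_leftUnitor_hom x)

@[simp]
theorem Elt.map_rightUnitor_hom {X : C} (x : Elt X) :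
    Elt.map (ρ_ X).hom (x ⋆ Elt.unit C) = x := by
  rw [← Elt.map_braiding_hom, ← Elt.map_comp, braiding_rightUnitor, Elt.map_leftUnitor_hom]

@[simp]
theorem Elt.map_rightUnitor_inv {X : C} (x : Elt X) :
    Elt.map (ρ_ X).inv x = x ⋆ Elt.unit C :=
  Elt.map_inv_eq _ (Elt.map_rightUnitor_hom x)

@[simp]
theorem Elt.map_tensorμ {X Y Z W : C} (x : Elt X) (y : Elt Y) (z : Elt Z) (w : Elt W) :
    Elt.map (tensorμ X Y Z W) (x ⋆ y ⋆ (z ⋆ w)) = x ⋆ z ⋆ (y ⋆ w) := by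
  simp [tensorμ]

/-! ### Elements of finite tensor products -/

/-- The product of a finite family of elements. -/
def tprod : {n : ℕ} → {X : Fin n → C} → (∀ i, Elt (X i)) → Elt (tens X)
  | 0, _, _ => Elt.unit C
  | _ + 1, _, x => tprod (fun i => x i.castSucc) ⋆ x (Fin.last _)

theorem tprod_succ {n : ℕ} {X : Fin (n + 1) → C} (x : ∀ i, Elt (X i)) :
    tprod x = (tprod fun i => x i.castSucc) ⋆ x (Fin.last _) := rfl

@[simp]
theorem map_tensMap {n : ℕ} {X Y : Fin n → C} (f : ∀ i, X i ⟶ Y i) (x : ∀ i, Elt (X i)) :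
    Elt.map (tensMap f) (tprod x) = tprod fun i => Elt.map (f i) (x i) := by
  induction n with
  | zero => exact Elt.map_id _
  | succ n ih =>
    refine (Elt.map_tensorHom _ _ _ _).trans ?_
    rw [ih]
    rfl

@[simp]
theorem map_tensCongr_hom {n : ℕ} {X Y : Fin n → C} (h : ∀ i, X i = Y i) (x : ∀ i, Elt (X i)) :
    Elt.map (tensCongr h).hom (tprod x) = tprod fun i => Elt.map (eqToHom (h i)) (x i) := by
  obtain rfl : X = Y := funext h
  simp [tensCongr]

@[simp]
theorem map_tensOne_hom {X : Fin 1 → C} (x : ∀ i, Elt (X i)) :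
    Elt.map (tensOne X).hom (tprod x) = x 0 :=
  Elt.map_leftUnitor_hom (x 0)

@[simp]
theorem map_tensOne_inv {X : C} (x : Elt X) :
    Elt.map (tensOne fun _ => X).inv x = tprod fun _ => x :=
  Elt.map_leftUnitor_inv x

@[simp]
theorem map_tensUnits_hom (n : ℕ) :
    Elt.map (tensUnits n).hom (tprod fun _ : Fin n => Elt.unit C) = Elt.unit C := by
  induction n with
  | zero => exact Elt.map_id _
  | succ n ih =>
    refine (Elt.map_comp _ _ _).trans ?_
    rw [tprod_succ]
    exact (congrArg _ ((Elt.map_whiskerRight _ _ _).trans (by rw [ih]))).trans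
      (Elt.map_leftUnitor_hom _)

@[simp]
theorem map_tensUnits_inv (n : ℕ) :
    Elt.map (tensUnits n).inv (Elt.unit C) = tprod fun _ : Fin n => Elt.unit C :=
  Elt.map_inv_eq _ (map_tensUnits_hom n)

@[simp]
theorem map_tensSplit_hom {a b : ℕ} {X : Fin (a + b) → C} (x : ∀ i, Elt (X i)) :
    Elt.map (tensSplit X).hom (tprod x) =
      (tprod fun i : Fin a => x (i.castAdd b)) ⋆ tprod fun j : Fin b => x (j.natAdd a) := by
  induction b with
  | zero => exact Elt.map_rightUnitor_inv _
  | succ b ih =>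
    refine (Elt.map_comp _ _ _).trans ?_
    refine (congrArg _ ((Elt.map_whiskerRight _ _ _).trans
      (congrArg (· ⋆ x (Fin.last _)) (ih _)))).trans ?_
    exact Elt.map_associator_hom _ _ _

@[simp]
theorem map_tensSplit_inv {a b : ℕ} {X : Fin (a + b) → C} (x : ∀ i, Elt (X i)) :
    Elt.map (tensSplit X).inv
      ((tprod fun i : Fin a => x (i.castAdd b)) ⋆ tprod fun j : Fin b => x (j.natAdd a)) =
    tprod x :=
  Elt.map_inv_eq _ (map_tensSplit_hom x)

@[simp]
theorem map_tensCast_hom {m n : ℕ} (h : m = n) {X : Fin n → C} (x : ∀ i, Elt (X i)) :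
    Elt.map (tensCast h X).hom (tprod x) = tprod fun i => x (Fin.cast h i) := by
  subst h
  exact Elt.map_id _

theorem tensExtract_last {n : ℕ} (X : Fin (n + 2) → C) :
    tensExtract X (Fin.last (n + 1)) =
      whiskerRightIso (tensCongr fun i => by rw [Fin.succAbove_last]) (X (Fin.last _)) := by
  delta tensExtract
  exact Fin.lastCases_last

theorem tensExtract_castSucc {n : ℕ} (X : Fin (n + 2) → C) (k : Fin (n + 1)) :
    tensExtract X k.castSucc =
      whiskerRightIso (tensExtract (fun i => X i.castSucc) k) (X (Fin.last _)) ≪≫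
        α_ _ _ _ ≪≫ whiskerLeftIso _ (β_ _ _) ≪≫ (α_ _ _ _).symm ≪≫
        whiskerRightIso
          (tensCongr (fun i => congrArg X (castSucc_succAbove_castSucc' k i)) ⊗ᵢ
            eqToIso (congrArg X (castSucc_succAbove_last' k)))
          (X k.castSucc) := by
  delta tensExtract
  exact Fin.lastCases_castSucc k

theorem Elt.map_swap_last {X Y Z W : C} (g : X ⊗ Z ⟶ W) (x : Elt X) (y : Elt Y) (z : Elt Z) :
    Elt.map ((α_ X Y Z).hom ≫ X ◁ (β_ Y Z).hom ≫ (α_ X Z Y).inv ≫ g ▷ Y) (x ⋆ y ⋆ z) =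
      Elt.map g (x ⋆ z) ⋆ y := by
  simp

@[simp]
theorem map_tensExtract_hom {n : ℕ} {X : Fin (n + 1) → C} (x : ∀ i, Elt (X i))
    (k : Fin (n + 1)) :
    Elt.map (tensExtract X k).hom (tprod x) = (tprod fun i => x (k.succAbove i)) ⋆ x k := by
  induction n with
  | zero =>
    refine (Elt.map_whiskerLeft _ _ _).trans ?_
    have h : Fin.last 0 = k := by omega
    exact congrArg (Elt.unit C ⋆ ·) (Elt.map_eqToHom x h (congrArg X h))
  | succ n ih =>
    refine Fin.lastCases ?_ (fun k => ?_) k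
    · rw [tensExtract_last]
      refine (Elt.map_whiskerRight _ _ _).trans ?_
      refine congrArg (· ⋆ x (Fin.last _)) ((map_tensCongr_hom _ _).trans ?_)
      exact congrArg tprod (funext fun i => Elt.map_eqToHom x (by rw [Fin.succAbove_last]) _)
    · rw [tensExtract_castSucc, tprod_succ]
      refine (Elt.map_comp _ _ _).trans ?_
      refine (congrArg _ ((Elt.map_whiskerRight _ _ _).trans
        (congrArg (· ⋆ x (Fin.last _)) (ih (fun i => x i.castSucc) k)))).trans ?_
      refine (Elt.map_swap_last _ _ _ _).trans (congrArg (· ⋆ x k.castSucc) ?_)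
      refine (Elt.map_tensorHom _ _ _ _).trans ?_
      rw [map_tensCongr_hom]
      refine congrArg₂ Elt.mul ?_ ?_
      · exact congrArg tprod (funext fun i =>
          Elt.map_eqToHom x (castSucc_succAbove_castSucc' k i) _)
      · have h := castSucc_succAbove_last' k
        exact Elt.map_eqToHom x h (congrArg X h)

@[simp]
theorem map_tensExtract_inv {n : ℕ} {X : Fin (n + 1) → C} (x : ∀ i, Elt (X i))
    (k : Fin (n + 1)) :
    Elt.map (tensExtract X k).inv ((tprod fun i => x (k.succAbove i)) ⋆ x k) = tprod x :=
  Elt.map_inv_eq _ (map_tensExtract_hom x k)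

@[simp]
theorem map_tensPerm_hom {m n : ℕ} (e : Fin m ≃ Fin n) {X : Fin n → C} (x : ∀ i, Elt (X i)) :
    Elt.map (tensPerm e X).hom (tprod x) = tprod fun i => x (e i) := by
  induction m generalizing n with
  | zero =>
    cases n with
    | zero => exact Elt.map_id _
    | succ n => exact (e.symm 0).elim0
  | succ m ih =>
    cases n with
    | zero => exact (e 0).elim0
    | succ n =>
      refine (Elt.map_comp _ _ _).trans ?_
      rw [map_tensExtract_hom]
      refine (Elt.map_whiskerRight _ _ _).trans ?_
      refine congrArg (· ⋆ x (e (Fin.last _))) ?_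
      refine (Elt.map_comp _ _ _).trans ?_
      refine (congrArg _ (ih _ _)).trans ?_
      refine (map_tensCongr_hom _ _).trans ?_
      exact congrArg tprod (funext fun i => Elt.map_eqToHom x (succAbove_dropLast e i) _)

@[simp]
theorem map_blockMap {s : ℕ} (n : Fin s → ℕ) {A B : Fin s → C} {Y : Fin (∑ i, n i) → C}
    (f : ∀ i, A i ⊗ tens (fun j : Fin (n i) => Y (flat n ⟨i, j⟩)) ⟶ B i)
    (a : ∀ i, Elt (A i)) (y : ∀ x, Elt (Y x)) :
    Elt.map (blockMap n A B Y f) (tprod a ⋆ tprod y) =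
      tprod fun i => Elt.map (f i) (a i ⋆ tprod fun j => y (flat n ⟨i, j⟩)) := by
  induction s with
  | zero =>
    refine (Elt.map_comp _ _ _).trans ?_
    refine (congrArg _ (Elt.map_leftUnitor_hom _)).trans ?_
    exact map_tensCast_hom _ _
  | succ s ih =>
    refine (Elt.map_comp _ _ _).trans ?_
    refine (congrArg _ (Elt.map_whiskerLeft _ _ _)).trans ?_
    rw [Elt.map_comp, map_tensCast_hom, map_tensSplit_hom]
    refine (Elt.map_comp _ _ _).trans ?_
    refine (congrArg _ (Elt.map_tensorμ _ _ _ _)).trans ?_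
    refine (Elt.map_tensorHom _ _ _ _).trans ?_
    refine congrArg₂ Elt.mul ?_ ?_
    · refine (ih _ _ _ _).trans ?_
      refine congrArg tprod (funext fun i => ?_)
      rw [Elt.map_comp, Elt.map_whiskerLeft, map_tensCongr_hom]
      refine congrArg (fun z => Elt.map _ (a i.castSucc ⋆ tprod z)) (funext fun j => ?_)
      exact Elt.map_eqToHom y (flat_castSucc n i j) _
    · rw [Elt.map_comp, Elt.map_whiskerLeft, map_tensCongr_hom]
      refine congrArg (fun z => Elt.map _ (a (Fin.last s) ⋆ tprod z)) (funext fun j => ?_)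
      exact Elt.map_eqToHom y (flat_last n j) _

end Elements

/-! ### Detecting sets of elements -/

section Elements

variable {C : Type u}

/-- None of the first `N` positions of the list is used. -/
def Fresh : ℕ → List (Option C) → Prop
  | 0, _ => True
  | _ + 1, [] => True
  | N + 1, none :: l => Fresh N l
  | _ + 1, some _ :: _ => False

theorem Fresh.mono {N N' : ℕ} (h : N ≤ N') {l : List (Option C)} (hl : Fresh N' l) :
    Fresh N l := by
  induction N generalizing N' l with
  | zero => trivial
  | succ N ih =>
    obtain ⟨N', rfl⟩ : ∃ M, N' = M + 1 := ⟨N' - 1, by omega⟩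
    rcases l with _ | ⟨_ | c, l⟩
    · trivial
    · exact ih (by omega) hl
    · exact hl

/-- A list with one entry whose first `N` positions are unused. -/
def freshList (X : C) : ℕ → List (Option C)
  | 0 => [some X]
  | N + 1 => none :: freshList X N

theorem fresh_freshList (X : C) (N : ℕ) : Fresh N (freshList X N) := by
  induction N with
  | zero => trivial
  | succ N ih => exact ih

variable [Category.{v} C] [MonoidalCategory C]

/-- The tensor product over a list with the single entry `X`. -/
def stageFreshList (X : C) : (N : ℕ) → (stage (freshList X N) ≅ X)
  | 0 => ρ_ X
  | N + 1 => stageFreshList X N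

/-- A set `D` of elements of `X` is detecting if morphisms out of `X ⊗ Y` which agree on the
elements of `D`, with a free second variable, are equal. Moreover it is required to suffice that
they agree on the elements of `D` which avoid the first `N` positions: a product is only meaningful
for elements without a common variable, so that this is needed for `Detecting.mul`. -/
def Detecting {X : C} (D : Set (Elt X)) : Prop :=
  ∀ (N : ℕ) ⦃Y Z : C⦄ (f g : X ⊗ Y ⟶ Z),
    (∀ (l : List (Option C)) (h : stage l ⟶ X), Fresh N l → D (some ⟨l, h⟩) →
      h ▷ Y ≫ f = h ▷ Y ≫ g) → f = g

theorem Detecting.mono {X : C} {D D' : Set (Elt X)} (h : D ⊆ D') (hD : Detecting D) :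
    Detecting D' :=
  fun N _ _ f g hfg => hD N f g fun l k hl hk => hfg l k hl (h hk)

theorem detecting_univ (X : C) : Detecting (Set.univ : Set (Elt X)) := by
  intro N Y Z f g h
  have := h _ (stageFreshList X N).hom (fresh_freshList X N) trivial
  rw [← cancel_epi ((stageFreshList X N).hom ▷ Y)]
  exact this

/-- Morphisms which agree on the elements of a detecting set are equal. -/
theorem Detecting.eq_of_map_eq {X Z : C} {D : Set (Elt X)} (hD : Detecting D) {f g : X ⟶ Z}
    (h : ∀ x ∈ D, Elt.map f x = Elt.map g x) : f = g := by
  rw [← cancel_epi (ρ_ X).hom]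
  refine hD 0 _ _ fun l k _ hk => ?_
  have : k ≫ f = k ≫ g := eq_of_heq (Sigma.mk.inj (Option.some.inj (h _ hk))).2
  simp [this]

/-- If the morphisms `ι j` are jointly epimorphic, also after tensoring, then the images of
detecting sets are detecting. -/
theorem Detecting.map {J : Type*} {G : J → C} {X : C} (ι : ∀ j, G j ⟶ X)
    (hι : ∀ ⦃Y Z : C⦄ (f g : X ⊗ Y ⟶ Z), (∀ j, ι j ▷ Y ≫ f = ι j ▷ Y ≫ g) → f = g)
    {D : ∀ j, Set (Elt (G j))} (hD : ∀ j, Detecting (D j)) :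
    Detecting {z | ∃ j, ∃ x ∈ D j, z = Elt.map (ι j) x} := by
  intro N Y Z f g h
  refine hι _ _ fun j => hD j N _ _ fun l k hl hk => ?_
  simpa using h l (k ≫ ι j) hl ⟨j, _, hk, rfl⟩

variable [SymmetricCategory C]

theorem exists_shuffle {N : ℕ} {l l' : List (Option C)} (h : l.length ≤ N) (h' : Fresh N l') :
    ∃ s, shuffle l l' = some s := by
  induction l generalizing l' N with
  | nil => exact ⟨_, rfl⟩
  | cons a l ih =>
    obtain ⟨N, rfl⟩ : ∃ M, N = M + 1 := ⟨N - 1, by simp at h; omega⟩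
    have hlN : l.length ≤ N := by simpa using h
    rcases l' with _ | ⟨_ | c, l'⟩
    · exact ⟨_, rfl⟩
    · obtain ⟨s, hs⟩ := ih (l' := l') hlN h'
      cases a <;> exact ⟨_, congrArg (Option.map _) hs⟩
    · exact h'.elim

theorem Fresh.shuffle {N : ℕ} {l l' : List (Option C)} (h : Fresh N l) (h' : Fresh N l')
    {s : Σ k, stage k ≅ stage l ⊗ stage l'} (hs : shuffle l l' = some s) : Fresh N s.1 := by
  induction l generalizing l' N with
  | nil =>
    obtain rfl : _ = s := Option.some_injective _ hs
    exact h'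
  | cons a l ih =>
    rcases N with _ | N
    · trivial
    rcases l' with _ | ⟨b, l'⟩
    · obtain rfl : _ = s := Option.some_injective _ hs
      exact h
    · cases a with
      | none =>
        cases b with
        | none =>
          simp only [OperadTheory.shuffle, Option.map_eq_some_iff] at hs
          obtain ⟨t, ht, rfl⟩ := hs
          exact ih h h' ht
        | some c => exact h'.elim
      | some c => exact h.elim

/-- The products of elements of two sets. -/
def mulSet {X Y : C} (D : Set (Elt X)) (D' : Set (Elt Y)) : Set (Elt (X ⊗ Y)) :=
  Set.image2 Elt.mul D D'

/-- Products of elements of detecting sets are detecting. In order to test a morphism out of a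
tensor product, an element of the first factor is chosen first. It uses finitely many positions, and
those are to be avoided by the element of the second factor. -/
theorem Detecting.mul {X X' : C} {D : Set (Elt X)} {D' : Set (Elt X')} (hD : Detecting D)
    (hD' : Detecting D') : Detecting (mulSet D D') := by
  intro N Y Z f g h
  rw [← cancel_epi (α_ X X' Y).inv]
  refine hD N _ _ fun l k hl hk => ?_
  rw [← cancel_epi ((α_ _ _ _).inv ≫ (β_ X' (stage l)).hom ▷ Y ≫ (α_ _ _ _).hom)]
  refine hD' (max N l.length) _ _ fun l' k' hl' hk' => ?_
  obtain ⟨s, hs⟩ := exists_shuffle (le_max_right _ _) hl'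
  have := h s.1 (s.2.hom ≫ (k ⊗ₘ k')) (hl.shuffle (hl'.mono (le_max_left _ _)) hs)
    ⟨_, hk, _, hk', by simp [Elt.mul, hs]; rfl⟩
  rw [comp_whiskerRight, Category.assoc, Category.assoc, cancel_epi, tensorHom_def'] at this
  have key : ∀ f : (X ⊗ X') ⊗ Y ⟶ Z, k' ▷ (stage l ⊗ Y) ≫
      ((α_ X' (stage l) Y).inv ≫ (β_ X' (stage l)).hom ▷ Y ≫ (α_ (stage l) X' Y).hom) ≫
        k ▷ (X' ⊗ Y) ≫ (α_ X X' Y).inv ≫ f =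
      ((α_ _ _ _).inv ≫ (β_ _ _).hom ▷ Y) ≫ (stage l ◁ k' ≫ k ▷ X') ▷ Y ≫ f := by
    intro f
    simp only [Category.assoc, whiskerRight_tensor, comp_whiskerRight, Iso.hom_inv_id_assoc]
    rw [← comp_whiskerRight_assoc, ← comp_whiskerRight_assoc,
      BraidedCategory.braiding_naturality_left]
    simp
  rw [key, key, this]

theorem detecting_tens {n : ℕ} {X : Fin n → C} {D : ∀ i, Set (Elt (X i))}
    (hD : ∀ i, Detecting (D i)) :
    Detecting {z | ∃ x : ∀ i, Elt (X i), (∀ i, x i ∈ D i) ∧ z = tprod x} := by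
  induction n with
  | zero =>
    intro N Y Z f g h
    have := h [] (𝟙 _) (by cases N <;> trivial) ⟨fun i => i.elim0, fun i => i.elim0, rfl⟩
    have e : ∀ f : 𝟙_ C ⊗ Y ⟶ Z, 𝟙 (𝟙_ C) ▷ Y ≫ f = f := fun f => by simp
    exact (e f).symm.trans (this.trans (e g))
  | succ n ih =>
    refine (((ih fun i => hD i.castSucc).mul (hD (Fin.last n))).mono ?_ : _)
    rintro _ ⟨_, ⟨x, hx, rfl⟩, y, hy, rfl⟩
    refine ⟨Fin.lastCases y x, fun i => ?_, ?_⟩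
    · refine Fin.lastCases ?_ (fun i => ?_) i
      · simpa using hy
      · simpa using hx i
    · rw [tprod_succ]
      simp only [Fin.lastCases_last, Fin.lastCases_castSucc]
      rfl

end Elements

/-! ### Operads of sets and their terms -/

section Terms

universe w w₁ w₂ w₃

/-- A symmetric operad in the category of sets. -/
structure SetOperad where
  /-- The set of `n`-ary operations. -/
  obj : ℕ → Type w
  /-- The relabelling of the inputs along a bijection. -/
  act : ∀ {m n : ℕ}, (Fin m ≃ Fin n) → obj m → obj n
  /-- The unit. -/
  one : obj 1
  /-- The composition of operations. -/
  comp : ∀ {s : ℕ} (n : Fin s → ℕ), obj s → (∀ i, obj (n i)) → obj (∑ i, n i)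
  act_refl : ∀ {n : ℕ} (p : obj n), act (Equiv.refl (Fin n)) p = p
  act_trans : ∀ {l m n : ℕ} (e : Fin l ≃ Fin m) (e' : Fin m ≃ Fin n) (p : obj l),
    act (e.trans e') p = act e' (act e p)
  one_comp : ∀ {n : ℕ} (q : obj n), comp (fun _ : Fin 1 => n) one (fun _ => q) =
    act (oneCompEquiv n) q
  comp_one : ∀ {n : ℕ} (p : obj n), comp (fun _ : Fin n => 1) p (fun _ => one) =
    act (compOneEquiv n) p
  comp_assoc : ∀ {s : ℕ} (n : Fin s → ℕ) (m : Fin (∑ i, n i) → ℕ) (p : obj s)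
    (q : ∀ i, obj (n i)) (r : ∀ x, obj (m x)),
    comp m (comp n p q) r = act (assocEquiv n m) (comp (fun i => ∑ j, m (flat n ⟨i, j⟩)) p
      fun i => comp (fun j => m (flat n ⟨i, j⟩)) (q i) fun j => r (flat n ⟨i, j⟩))
  act_comp : ∀ {s t : ℕ} (σ : Fin s ≃ Fin t) (n : Fin t → ℕ) (p : obj s) (q : ∀ i, obj (n i)),
    comp n (act σ p) q =
      act (blockEquiv σ n) (comp (fun i => n (σ i)) p fun i => q (σ i))
  comp_act : ∀ {s : ℕ} (n n' : Fin s → ℕ) (τ : ∀ i, Fin (n i) ≃ Fin (n' i)) (p : obj s)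
    (q : ∀ i, obj (n i)), comp n' p (fun i => act (τ i) (q i)) = act (sumEquiv τ) (comp n p q)

@[simp]
theorem oneCompEquiv_apply (n : ℕ) (j : Fin n) :
    oneCompEquiv n j = flat (fun _ : Fin 1 => n) ⟨0, j⟩ := rfl

@[simp]
theorem compOneEquiv_apply (n : ℕ) (j : Fin n) :
    compOneEquiv n j = flat (fun _ : Fin n => 1) ⟨j, 0⟩ := rfl

@[simp]
theorem blockEquiv_flat {s t : ℕ} (σ : Fin s ≃ Fin t) (n : Fin t → ℕ) (i : Fin s)
    (j : Fin (n (σ i))) :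
    blockEquiv σ n (flat (fun i => n (σ i)) ⟨i, j⟩) = flat n ⟨σ i, j⟩ := by
  simp [blockEquiv]

@[simp]
theorem sumEquiv_flat {s : ℕ} {n n' : Fin s → ℕ} (τ : ∀ i, Fin (n i) ≃ Fin (n' i)) (i : Fin s)
    (j : Fin (n i)) : sumEquiv τ (flat n ⟨i, j⟩) = flat n' ⟨i, τ i j⟩ := by
  simp [sumEquiv]

@[simp]
theorem assocEquiv_flat {s : ℕ} (n : Fin s → ℕ) (m : Fin (∑ i, n i) → ℕ) (i : Fin s)
    (j : Fin (n i)) (x : Fin (m (flat n ⟨i, j⟩))) :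
    assocEquiv n m (flat (fun i => ∑ j, m (flat n ⟨i, j⟩))
      ⟨i, flat (fun j => m (flat n ⟨i, j⟩)) ⟨j, x⟩⟩) = flat m ⟨flat n ⟨i, j⟩, x⟩ := by
  simp [assocEquiv, Equiv.sigmaAssoc]

/-- A family of labels of the inputs of a composite operation, given in blocks. -/
def blockLabel {s : ℕ} (n : Fin s → ℕ) {Λ : Type*} (y : ∀ i, Fin (n i) → Λ) (j : Fin (∑ i, n i)) :
    Λ := y ((flat n).symm j).1 ((flat n).symm j).2

@[simp]
theorem blockLabel_flat {s : ℕ} (n : Fin s → ℕ) {Λ : Type*} (y : ∀ i, Fin (n i) → Λ)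
    (i : Fin s) (j : Fin (n i)) : blockLabel n y (flat n ⟨i, j⟩) = y i j := by
  rw [blockLabel, Equiv.symm_apply_apply]

namespace SetOperad

variable (O : SetOperad.{w})

/-- An operation with labelled inputs. -/
structure RawTerm (Λ : Type w₁) where
  /-- The number of inputs. -/
  arity : ℕ
  /-- The operation. -/
  op : O.obj arity
  /-- The labels of the inputs. -/
  label : Fin arity → Λ

/-- Two labelled operations are identified if they differ by a bijection of the inputs. -/
instance termSetoid (Λ : Type w₁) : Setoid (O.RawTerm Λ) where
  r t t' := ∃ e : Fin t.arity ≃ Fin t'.arity, O.act e t.op = t'.op ∧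
    ∀ i, t'.label (e i) = t.label i
  iseqv :=
    { refl := fun t => ⟨Equiv.refl _, O.act_refl _, fun _ => rfl⟩
      symm := by
        rintro ⟨m, p, x⟩ ⟨n, q, y⟩ ⟨e, h', h⟩
        dsimp only at e h' h
        subst h'
        refine ⟨e.symm, ?_, fun i => ?_⟩
        · rw [← O.act_trans, Equiv.self_trans_symm, O.act_refl]
        · exact (h _).symm.trans (congrArg y (e.apply_symm_apply i))
      trans := by
        rintro ⟨l, p, x⟩ ⟨m, q, y⟩ ⟨n, r, z⟩ ⟨e, h₁, h⟩ ⟨e', h₂, h'⟩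
        dsimp only at e h₁ h e' h₂ h'
        subst h₁ h₂
        exact ⟨e.trans e', O.act_trans _ _ _, fun i => (h' _).trans (h i)⟩ }

/-- The terms `p(x 0, …, x (n-1))` with an operation `p` and labels `x i`: the free algebra on the
set of labels. -/
def Term (Λ : Type w₁) : Type max w w₁ := Quotient (O.termSetoid Λ)

variable {O} {Λ : Type w₁} {Λ' : Type w₂} {Λ'' : Type w₃}

/-- The term `p(x 0, …, x (n-1))`. -/
def tm {n : ℕ} (p : O.obj n) (x : Fin n → Λ) : O.Term Λ := Quotient.mk _ ⟨n, p, x⟩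

theorem Term.exists_rep (t : O.Term Λ) : ∃ (n : ℕ) (p : O.obj n) (x : Fin n → Λ), t = tm p x := by
  obtain ⟨⟨n, p, x⟩, rfl⟩ := Quotient.exists_rep t
  exact ⟨n, p, x, rfl⟩

theorem tm_eq_tm_iff {m n : ℕ} {p : O.obj m} {q : O.obj n} {x : Fin m → Λ} {y : Fin n → Λ} :
    tm p x = tm q y ↔ ∃ e : Fin m ≃ Fin n, O.act e p = q ∧ ∀ i, y (e i) = x i :=
  Quotient.eq

theorem tm_act {m n : ℕ} (e : Fin m ≃ Fin n) (p : O.obj m) (x : Fin n → Λ) :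
    tm (O.act e p) x = tm p fun i => x (e i) :=
  (tm_eq_tm_iff.mpr ⟨e, rfl, fun _ => rfl⟩).symm

/-- The term consisting of a single label. -/
def Term.pure (l : Λ) : O.Term Λ := tm O.one fun _ => l

/-- Renaming of labels. -/
def Term.map (f : Λ → Λ') : O.Term Λ → O.Term Λ' :=
  Quotient.map (fun t => ⟨t.arity, t.op, fun i => f (t.label i)⟩) (by
    rintro _ _ ⟨e, h, h'⟩
    exact ⟨e, h, fun i => congrArg f (h' i)⟩)

@[simp]
theorem map_tm {n : ℕ} (f : Λ → Λ') (p : O.obj n) (x : Fin n → Λ) :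
    (tm p x).map f = tm p fun i => f (x i) := rfl

/-- Substitution of terms for labels, which is given by the composition of the operad. Together with
`Term.pure`, it makes the terms a monad; this packages the axioms of an operad. -/
def Term.bind (t : O.Term Λ) (f : Λ → O.Term Λ') : O.Term Λ' :=
  Quotient.liftOn t
    (fun t => tm (O.comp (fun i => (f (t.label i)).out.arity) t.op
      fun i => (f (t.label i)).out.op) (blockLabel _ fun i => (f (t.label i)).out.label)) (by
    rintro ⟨m, p, x⟩ ⟨n, q, y⟩ ⟨e, h', h⟩
    dsimp only at e h' h
    subst h'
    obtain rfl : x = fun i => y (e i) := funext fun i => (h i).symm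
    refine tm_eq_tm_iff.mpr ⟨blockEquiv e fun i => (f (y i)).out.arity,
      (O.act_comp e _ p fun i => (f (y i)).out.op).symm, fun j => ?_⟩
    obtain ⟨⟨i, j⟩, rfl⟩ := (flat _).surjective j
    rw [blockEquiv_flat e fun i => (f (y i)).out.arity]
    simp)

/-- The substitution can be computed with arbitrary representatives of the inserted terms; by
`SetOperad.comp_act`, the choice in the definition is immaterial. -/
theorem tm_bind {s : ℕ} {p : O.obj s} {x : Fin s → Λ} {f : Λ → O.Term Λ'} {n : Fin s → ℕ}
    (q : ∀ i, O.obj (n i)) (y : ∀ i, Fin (n i) → Λ') (h : ∀ i, f (x i) = tm (q i) (y i)) :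
    (tm p x).bind f =
      tm (O.comp n p q) (blockLabel n y) := by
  have h' : ∀ i, ∃ e : Fin (n i) ≃ Fin (f (x i)).out.arity,
      O.act e (q i) = (f (x i)).out.op ∧ ∀ j, (f (x i)).out.label (e j) = y i j := fun i =>
    tm_eq_tm_iff.mp ((h i).symm.trans (Quotient.out_eq _).symm)
  choose τ h₁ h₂ using h'
  symm
  refine tm_eq_tm_iff.mpr ⟨sumEquiv τ, ?_, fun j => ?_⟩
  · rw [← O.comp_act]
    exact congrArg _ (funext h₁)
  · obtain ⟨⟨i, j⟩, rfl⟩ := (flat _).surjective j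
    rw [sumEquiv_flat, blockLabel_flat, blockLabel_flat]
    exact h₂ i j

@[simp]
theorem pure_bind (l : Λ) (f : Λ → O.Term Λ') : (Term.pure l).bind f = f l := by
  obtain ⟨n, q, y, h⟩ := (f l).exists_rep
  rw [h, Term.pure, tm_bind (fun _ => q) (fun _ => y) fun _ => h, O.one_comp, tm_act]
  simp

@[simp]
theorem map_pure (f : Λ → Λ') (l : Λ) : (Term.pure l : O.Term Λ).map f = Term.pure (f l) := rfl

@[simp]
theorem map_map (t : O.Term Λ) (f : Λ → Λ') (g : Λ' → Λ'') :
    (t.map f).map g = t.map fun l => g (f l) := by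
  obtain ⟨n, p, x, rfl⟩ := t.exists_rep
  rfl

theorem map_id (t : O.Term Λ) : t.map id = t := by
  obtain ⟨n, p, x, rfl⟩ := t.exists_rep
  rfl

theorem bind_pure_comp (t : O.Term Λ) (f : Λ → Λ') :
    (t.bind fun l => Term.pure (f l)) = t.map f := by
  obtain ⟨n, p, x, rfl⟩ := t.exists_rep
  rw [tm_bind (f := fun l => Term.pure (f l)) (fun _ => O.one) (fun i _ => f (x i)) fun _ => rfl,
    O.comp_one, tm_act]
  simp

@[simp]
theorem bind_pure (t : O.Term Λ) : t.bind Term.pure = t := by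
  rw [← map_id t]
  exact (bind_pure_comp (t.map id) id).trans (map_id _)

@[simp]
theorem bind_map (t : O.Term Λ) (g : Λ → Λ') (f : Λ' → O.Term Λ'') :
    (t.map g).bind f = t.bind fun l => f (g l) := by
  obtain ⟨n, p, x, rfl⟩ := t.exists_rep
  rfl

@[simp]
theorem bind_assoc (t : O.Term Λ) (f : Λ → O.Term Λ') (g : Λ' → O.Term Λ'') :
    (t.bind f).bind g = t.bind fun l => (f l).bind g := by
  obtain ⟨s, p, x, rfl⟩ := t.exists_rep
  choose n q y h using fun i => (f (x i)).exists_rep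
  choose m r z h' using fun j => (g (blockLabel n y j)).exists_rep
  have h'' : ∀ i, (f (x i)).bind g = tm (O.comp _ (q i) fun j => r (flat n ⟨i, j⟩))
      (blockLabel _ fun j => z (flat n ⟨i, j⟩)) := fun i => by
    rw [h]
    exact tm_bind (fun j => r (flat n ⟨i, j⟩)) (fun j => z (flat n ⟨i, j⟩)) fun j => by
      rw [← h', blockLabel_flat]
  rw [tm_bind q y h, tm_bind r z h', tm_bind (f := fun l => (f l).bind g) _ _ h'', O.comp_assoc,
    tm_act]
  congr 1
  funext j
  obtain ⟨⟨i, j⟩, rfl⟩ := (flat _).surjective j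
  obtain ⟨⟨j, x⟩, rfl⟩ := (flat _).surjective j
  rw [assocEquiv_flat, blockLabel_flat, blockLabel_flat, blockLabel_flat]

@[simp]
theorem map_bind (t : O.Term Λ) (f : Λ → O.Term Λ') (g : Λ' → Λ'') :
    (t.bind f).map g = t.bind fun l => (f l).map g := by
  simp only [← bind_pure_comp, bind_assoc]

theorem bind_congr {t : O.Term Λ} {f g : Λ → O.Term Λ'} (h : ∀ l, f l = g l) :
    t.bind f = t.bind g := by
  rw [funext h]

/-- An operation, as a term whose labels are the numbers of its inputs. -/
def opTerm {n : ℕ} (p : O.obj n) : O.Term (Fin n) := tm p id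

/-- Operations can be compared as terms, where no renumbering of the inputs has to be tracked. -/
theorem opTerm_injective {n : ℕ} : Function.Injective (opTerm : O.obj n → O.Term (Fin n)) := by
  intro p q h
  obtain ⟨e, rfl, he⟩ := tm_eq_tm_iff.mp h
  obtain rfl : e = Equiv.refl _ := Equiv.ext he
  exact (O.act_refl p).symm

theorem opTerm_map {n : ℕ} (p : O.obj n) (x : Fin n → Λ) : (opTerm p).map x = tm p x := rfl

theorem opTerm_one : opTerm O.one = Term.pure 0 :=
  congrArg (tm _) (funext fun _ => Subsingleton.elim _ _)

theorem opTerm_act {m n : ℕ} (e : Fin m ≃ Fin n) (p : O.obj m) :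
    opTerm (O.act e p) = (opTerm p).map e := tm_act _ _ _

theorem opTerm_comp {s : ℕ} (n : Fin s → ℕ) (p : O.obj s) (q : ∀ i, O.obj (n i)) :
    opTerm (O.comp n p q) =
      (opTerm p).bind fun i => (opTerm (q i)).map fun j => flat n ⟨i, j⟩ := by
  refine ((tm_bind q (fun i j => flat n ⟨i, j⟩) fun i => rfl).trans ?_).symm
  exact congrArg (tm _) (funext fun j => (flat n).apply_symm_apply j)

/-- A composite operation, applied to labels, as a substitution. -/
theorem tm_comp {s : ℕ} (n : Fin s → ℕ) (p : O.obj s) (q : ∀ i, O.obj (n i))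
    (x : Fin (∑ i, n i) → Λ) :
    tm (O.comp n p q) x =
      (opTerm p).bind fun i => tm (q i) fun j => x (flat n ⟨i, j⟩) := by
  rw [← opTerm_map, opTerm_comp, map_bind]
  rfl

/-! ### Linear terms -/

/-- A term is linear in the variables `S` if each of them occurs exactly once. The labels of the
first kind are constants, which may occur arbitrarily. -/
def Term.IsLinear {S : Type w₂} (t : O.Term (Λ ⊕ S)) : Prop :=
  ∃ (n : ℕ) (p : O.obj n) (x : Fin n → Λ ⊕ S), t = tm p x ∧ ∀ s, ∃! i, x i = Sum.inr s

theorem isLinear_tm {S : Type w₂} {n : ℕ} {p : O.obj n} {x : Fin n → Λ ⊕ S} :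
    (tm p x).IsLinear ↔ ∀ s, ∃! i, x i = Sum.inr s := by
  refine ⟨?_, fun h => ⟨n, p, x, rfl, h⟩⟩
  rintro ⟨m, q, y, h, h'⟩ s
  obtain ⟨e, -, he⟩ := tm_eq_tm_iff.mp h
  obtain ⟨i, hi, hi'⟩ := h' s
  refine ⟨e.symm i, ?_, fun j hj => ?_⟩
  · simp only [← he, Equiv.apply_symm_apply, hi]
  · rw [Equiv.eq_symm_apply]
    exact hi' _ ((he j).trans hj)

/-- The linear term `p(a 0, …, a (k-1), 0, …, n-1)`. -/
def std {k n : ℕ} (p : O.obj (k + n)) (a : Fin k → Λ) : O.Term (Λ ⊕ Fin n) :=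
  tm p fun i => Sum.map a id (finSumFinEquiv.symm i)

theorem isLinear_std {k n : ℕ} (p : O.obj (k + n)) (a : Fin k → Λ) : (std p a).IsLinear := by
  refine isLinear_tm.mpr fun s => ⟨finSumFinEquiv (Sum.inr s), by simp, fun i hi => ?_⟩
  obtain ⟨j | j, rfl⟩ := finSumFinEquiv.surjective i
  · simp at hi
  · simp only [Equiv.symm_apply_apply, Sum.map_inr, id, Sum.inr.injEq] at hi
    rw [hi]

/-- Every linear term with `n` variables has a representative in which the constants precede the
variables. -/
theorem Term.IsLinear.exists_std {n : ℕ} {t : O.Term (Λ ⊕ Fin n)} (h : t.IsLinear) :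
    ∃ (k : ℕ) (p : O.obj (k + n)) (a : Fin k → Λ), t = std p a := by
  classical
  obtain ⟨m, p, x, rfl, h⟩ := h
  let e₁ : {i // (x i).isLeft} ≃ Fin (Fintype.card {i // (x i).isLeft}) := Fintype.equivFin _
  let f : {i // ¬ (x i).isLeft} → Fin n := fun i => (x i.1).getRight (by simpa using i.2)
  have hf : ∀ i, x i.1 = Sum.inr (f i) := fun i => by simp [f]
  have hf' : Function.Bijective f := by
    constructor
    · intro i j hij
      exact Subtype.ext ((h (f i)).unique (hf i) (hij ▸ hf j))
    · intro s
      obtain ⟨i, hi, -⟩ := h s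
      refine ⟨⟨i, by simp [hi]⟩, ?_⟩
      have := hf ⟨i, by simp [hi]⟩
      exact Sum.inr_injective (this.symm.trans hi)
  let e : Fin m ≃ Fin (_ + n) := (Equiv.sumCompl fun i => ((x i).isLeft : Prop)).symm.trans
    ((Equiv.sumCongr e₁ (Equiv.ofBijective f hf')).trans finSumFinEquiv)
  refine ⟨_, O.act e p, fun j => (x (e₁.symm j).1).getLeft (e₁.symm j).2, ?_⟩
  rw [std, tm_act]
  congr 1
  funext i
  obtain ⟨j | j, rfl⟩ := (Equiv.sumCompl fun i => ((x i).isLeft : Prop)).surjective i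
  · simp [e]
  · simp [e, hf]

/-- Linear terms are closed under substitution of terms without variables for the constants and of
linear terms for the variables. The variables of the term which is substituted for `s` are named by
`T s`, and `κ` names the variables of the result. -/
theorem Term.IsLinear.bind {S : Type*} {T : S → Type*} {R : Type*} (κ : (Σ s, T s) ≃ R)
    {t : O.Term (Λ ⊕ S)} (ht : t.IsLinear) (f : Λ → O.Term Λ') {u : ∀ s, O.Term (Λ' ⊕ T s)}
    (hu : ∀ s, (u s).IsLinear) :
    (t.bind (Sum.elim (fun l => (f l).map Sum.inl)
      fun s => (u s).map (Sum.map id fun j => κ ⟨s, j⟩))).IsLinear := by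
  obtain ⟨m, p, x, rfl, hx⟩ := ht
  choose nl ql yl hl using fun l => (f l).exists_rep
  choose nu qu yu hu₁ hu₂ using hu
  let n : Λ ⊕ S → ℕ := Sum.elim nl nu
  let q : ∀ c, O.obj (n c) := Sum.rec ql qu
  let y : ∀ c, Fin (n c) → Λ' ⊕ R := Sum.rec (fun l i => Sum.inl (yl l i))
    fun s i => Sum.map id (fun j => κ ⟨s, j⟩) (yu s i)
  rw [tm_bind (fun i => q (x i)) (fun i => y (x i)) ?_]
  · rw [isLinear_tm]
    intro r
    obtain ⟨⟨s, j⟩, rfl⟩ := κ.surjective r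
    obtain ⟨i, hi, hi'⟩ := hx s
    have aux : ∀ c (j' : Fin (n c)), y c j' = Sum.inr (κ ⟨s, j⟩) → c = Sum.inr s := by
      rintro (l | s') j' h
      · simp [y] at h
      · simp only [y] at h
        rcases h' : yu s' j' with a | b
        · simp [h'] at h
        · simp only [h', Sum.map_inr, Sum.inr.injEq, EmbeddingLike.apply_eq_iff_eq] at h
          rw [(Sigma.mk.inj h).1]
    have aux' : ∀ c, c = Sum.inr s → ∃! j', y c j' = Sum.inr (κ ⟨s, j⟩) := by
      rintro _ rfl
      obtain ⟨j', h₁, h₂⟩ := hu₂ s j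
      refine ⟨j', by simp [y, h₁], fun j'' h => h₂ _ ?_⟩
      simp only [y] at h
      rcases h' : yu s j'' with a | b
      · simp [h'] at h
      · simp only [h', Sum.map_inr, Sum.inr.injEq, EmbeddingLike.apply_eq_iff_eq] at h
        exact h'.trans (congrArg Sum.inr (by simpa using h))
    obtain ⟨j', hj', hj''⟩ := aux' _ hi
    refine ⟨flat _ ⟨i, j'⟩, (blockLabel_flat (fun i => n (x i)) (fun i => y (x i)) i j').trans hj',
      fun z hz => ?_⟩
    obtain ⟨⟨i', z⟩, rfl⟩ := (flat _).surjective z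
    rw [blockLabel_flat] at hz
    obtain rfl := hi' _ (aux _ _ hz)
    rw [hj'' _ hz]
  · intro i
    rcases x i with l | s
    · simp [hl, q, y]
      rfl
    · simp [hu₁, q, y]
      rfl

theorem Term.IsLinear.map {S S' : Type*} {t : O.Term (Λ ⊕ S)} (ht : t.IsLinear) (f : Λ → Λ')
    (e : S ≃ S') : (t.map (Sum.map f e)).IsLinear := by
  obtain ⟨m, p, x, rfl, hx⟩ := ht
  rw [map_tm, isLinear_tm]
  intro s
  obtain ⟨i, hi, hi'⟩ := hx (e.symm s)
  refine ⟨i, by simp [hi], fun j hj => hi' j ?_⟩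
  rcases h : x j with a | b
  · simp [h] at hj
  · simp only [h, Sum.map_inr, Sum.inr.injEq] at hj
    simp [← hj, h]

/-! ### Morphisms and algebras -/

/-- A morphism of operads of sets. -/
structure Hom (O O' : SetOperad.{w}) where
  app : ∀ {n : ℕ}, O.obj n → O'.obj n
  act_app : ∀ {m n : ℕ} (e : Fin m ≃ Fin n) (p : O.obj m), app (O.act e p) = O'.act e (app p)
  one_app : app O.one = O'.one
  comp_app : ∀ {s : ℕ} (n : Fin s → ℕ) (p : O.obj s) (q : ∀ i, O.obj (n i)),
    app (O.comp n p q) = O'.comp n (app p) fun i => app (q i)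

variable {O' : SetOperad.{w}}

/-- The map on terms induced by a morphism of operads. -/
def Term.mapOp (φ : Hom O O') : O.Term Λ → O'.Term Λ :=
  Quotient.map (fun t => ⟨t.arity, φ.app t.op, t.label⟩) (by
    rintro ⟨m, p, x⟩ ⟨n, q, y⟩ ⟨e, h', h⟩
    dsimp only at e h' h
    subst h'
    exact ⟨e, (φ.act_app e p).symm, h⟩)

@[simp]
theorem mapOp_tm (φ : Hom O O') {n : ℕ} (p : O.obj n) (x : Fin n → Λ) :
    (tm p x).mapOp φ = tm (φ.app p) x := rfl

@[simp]
theorem mapOp_map (φ : Hom O O') (t : O.Term Λ) (f : Λ → Λ') :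
    (t.map f).mapOp φ = (t.mapOp φ).map f := by
  obtain ⟨n, p, x, rfl⟩ := t.exists_rep
  rfl

@[simp]
theorem mapOp_pure (φ : Hom O O') (l : Λ) :
    (Term.pure l : O.Term Λ).mapOp φ = Term.pure l :=
  congrArg (tm · fun _ => l) φ.one_app

@[simp]
theorem mapOp_bind (φ : Hom O O') (t : O.Term Λ) (f : Λ → O.Term Λ') :
    (t.bind f).mapOp φ = (t.mapOp φ).bind fun l => (f l).mapOp φ := by
  obtain ⟨s, p, x, rfl⟩ := t.exists_rep
  choose n q y h using fun i => (f (x i)).exists_rep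
  rw [tm_bind q y h, mapOp_tm, mapOp_tm, tm_bind (fun i => φ.app (q i)) y fun i => by simp [h],
    φ.comp_app]

/-- An algebra over an operad of sets. -/
structure Algebra (O : SetOperad.{w}) (X : Type w₁) where
  /-- The action of the operations. -/
  smul : ∀ {n : ℕ}, O.obj n → (Fin n → X) → X
  one_smul : ∀ x : Fin 1 → X, smul O.one x = x 0
  comp_smul : ∀ {s : ℕ} (n : Fin s → ℕ) (p : O.obj s) (q : ∀ i, O.obj (n i))
    (x : Fin (∑ i, n i) → X), smul (O.comp n p q) x =
      smul p fun i => smul (q i) fun j => x (flat n ⟨i, j⟩)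
  act_smul : ∀ {m n : ℕ} (e : Fin m ≃ Fin n) (p : O.obj m) (x : Fin n → X),
    smul (O.act e p) x = smul p fun i => x (e i)

/-- Evaluation of terms in an algebra. -/
def Algebra.eval {X : Type w₁} (A : O.Algebra X) : O.Term X → X :=
  Quotient.lift (fun t => A.smul t.op t.label) (by
    rintro ⟨m, p, x⟩ ⟨n, q, y⟩ ⟨e, h', h⟩
    dsimp only at e h' h
    subst h'
    obtain rfl : x = fun i => y (e i) := funext fun i => (h i).symm
    exact (A.act_smul e p y).symm)

@[simp]
theorem Algebra.eval_pure {X : Type w₁} (A : O.Algebra X) (x : X) :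
    A.eval (Term.pure x) = x := A.one_smul _

end SetOperad

end Terms

/-! ### The operad of elements of an operad -/

section Elements

variable {C : Type u} [Category.{v} C] [MonoidalCategory C] [SymmetricCategory C]

/-- The elements of an operad form an operad of sets. -/
def SymOperad.elts (P : SymOperad C) : SetOperad.{max u v} where
  obj n := Elt (P.obj n)
  act e := Elt.map (P.act e)
  one := Elt.map P.one (Elt.unit C)
  comp n p q := Elt.map (P.comp _ n) (p ⋆ tprod q)
  act_refl p := by rw [P.act_refl, Elt.map_id]
  act_trans e e' p := by rw [P.act_trans, Elt.map_comp]
  one_comp {n} q := by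
    simpa using Elt.congr_map (P.one_comp n) (Elt.unit C ⋆ tprod fun _ => q)
  comp_one {n} p := by
    simpa using Elt.congr_map (P.comp_one n) (p ⋆ tprod fun _ => Elt.unit C)
  comp_assoc {s} n m p q r := by
    simpa using Elt.congr_map (P.comp_assoc s n m) (p ⋆ tprod q ⋆ tprod r)
  act_comp {s t} σ n p q := by
    simpa using Elt.congr_map (P.act_comp σ n) (p ⋆ tprod q)
  comp_act {s} n n' τ p q := by
    simpa using Elt.congr_map (P.comp_act n n' τ) (p ⋆ tprod q)

theorem SymOperad.Hom.map_act {P Q : SymOperad C} (φ : P.Hom Q) {m n : ℕ} (e : Fin m ≃ Fin n)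
    (p : Elt (P.obj m)) :
    Elt.map (φ.app n) (Elt.map (P.act e) p) = Elt.map (Q.act e) (Elt.map (φ.app m) p) := by
  rw [← Elt.map_comp, φ.act_app, Elt.map_comp]

theorem SymOperad.Hom.map_comp {P Q : SymOperad C} (φ : P.Hom Q) {s : ℕ} (n : Fin s → ℕ)
    (p : Elt (P.obj s)) (q : ∀ i, Elt (P.obj (n i))) :
    Elt.map (φ.app _) (Elt.map (P.comp s n) (p ⋆ tprod q)) =
      Elt.map (Q.comp s n) (Elt.map (φ.app s) p ⋆ tprod fun i => Elt.map (φ.app (n i)) (q i)) := by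
  simpa using Elt.congr_map (φ.comp_app s n) (p ⋆ tprod q)

/-- The map on elements induced by a morphism of operads. -/
def SymOperad.Hom.elts {P Q : SymOperad C} (φ : P.Hom Q) : SetOperad.Hom P.elts Q.elts where
  app {n} := Elt.map (φ.app n)
  act_app e p := φ.map_act e p
  one_app := ((Elt.map_comp _ _ (Elt.unit C)).symm).trans (Elt.congr_map φ.one_app (Elt.unit C))
  comp_app n p q := φ.map_comp n p q

theorem SymOperad.Algebra.map_comp_smul {P : SymOperad C} (A : P.Algebra) {s : ℕ} (n : Fin s → ℕ)
    (p : Elt (P.obj s)) (q : ∀ i, Elt (P.obj (n i))) (x : Fin (∑ i, n i) → Elt A.X) :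
    Elt.map (A.smul _) (Elt.map (P.comp s n) (p ⋆ tprod q) ⋆ tprod x) =
      Elt.map (A.smul s) (p ⋆ tprod fun i => Elt.map (A.smul (n i))
        (q i ⋆ tprod fun j => x (flat n ⟨i, j⟩))) := by
  have := Elt.congr_map (A.comp_smul s n) (p ⋆ tprod q ⋆ tprod x)
  simp only [Elt.map_comp, Elt.map_whiskerRight, Elt.map_associator_hom,
    Elt.map_whiskerLeft] at this
  rw [this]
  exact congrArg (fun z => Elt.map (A.smul s) (p ⋆ z)) (map_blockMap n (fun i => A.smul (n i)) q x)

theorem SymOperad.Algebra.map_act_smul {P : SymOperad C} (A : P.Algebra) {m n : ℕ}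
    (e : Fin m ≃ Fin n) (p : Elt (P.obj m)) (x : Fin n → Elt A.X) :
    Elt.map (A.smul n) (Elt.map (P.act e) p ⋆ tprod x) =
      Elt.map (A.smul m) (p ⋆ tprod fun i => x (e i)) := by
  have := Elt.congr_map (A.act_smul e) (p ⋆ tprod x)
  simp only [Elt.map_comp, Elt.map_whiskerRight, Elt.map_whiskerLeft] at this
  rw [this]
  exact congrArg (fun z => Elt.map (A.smul m) (p ⋆ z)) (map_tensPerm_hom e x)

theorem SymOperad.Algebra.map_one_smul {P : SymOperad C} (A : P.Algebra) (x : Fin 1 → Elt A.X) :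
    Elt.map (A.smul 1) (Elt.map P.one (Elt.unit C) ⋆ tprod x) = x 0 := by
  simpa using Elt.congr_map A.one_smul (Elt.unit C ⋆ tprod x)

/-- The elements of an algebra form an algebra of sets. -/
def SymOperad.Algebra.elts {P : SymOperad C} (A : P.Algebra) : P.elts.Algebra (Elt A.X) where
  smul {n} p x := Elt.map (A.smul n) (p ⋆ tprod x)
  one_smul := A.map_one_smul
  comp_smul := A.map_comp_smul
  act_smul := A.map_act_smul

end Elements

section Elements

variable {C : Type u} [Category.{v} C] [MonoidalCategory C] [SymmetricCategory C]

/-- The term `p(x 0, …, x (n-1))` over the elements of an operad. -/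
abbrev SymOperad.tm (P : SymOperad C) {Λ : Type*} {n : ℕ} (p : Elt (P.obj n)) (x : Fin n → Λ) :
    P.elts.Term Λ := SetOperad.tm (O := P.elts) p x

/-- An element of an operad, as a term. -/
abbrev SymOperad.op (P : SymOperad C) {n : ℕ} (p : Elt (P.obj n)) : P.elts.Term (Fin n) :=
  SetOperad.opTerm (O := P.elts) p

/-- The linear term `p(a 0, …, a (k-1), 0, …, n-1)` over the elements of an operad. -/
abbrev SymOperad.std (P : SymOperad C) {Λ : Type*} {k n : ℕ} (p : Elt (P.obj (k + n)))
    (a : Fin k → Λ) : P.elts.Term (Λ ⊕ Fin n) := SetOperad.std (O := P.elts) p a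

/-! ### Composition with two groups of inputs -/

/-- The tensor product of a family indexed by a disjoint union. -/
def tensSum {k n : ℕ} (X : Fin k ⊕ Fin n → C) :
    tens (fun i => X (Sum.inl i)) ⊗ tens (fun i => X (Sum.inr i)) ≅
      tens fun i => X (finSumFinEquiv.symm i) :=
  (tensCongr (fun i => by rw [finSumFinEquiv_symm_apply_castAdd]) ⊗ᵢ
    tensCongr (fun i => by rw [finSumFinEquiv_symm_apply_natAdd])) ≪≫
    (tensSplit fun i : Fin (k + n) => X (finSumFinEquiv.symm i)).symm

theorem map_tensSum_hom {k n : ℕ} {X : Fin k ⊕ Fin n → C} (x : ∀ c, Elt (X c)) :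
    Elt.map (tensSum X).hom ((tprod fun i => x (Sum.inl i)) ⋆ tprod fun i => x (Sum.inr i)) =
      tprod fun i => x (finSumFinEquiv.symm i) := by
  have h := map_tensSplit_inv fun i : Fin (k + n) => x (finSumFinEquiv.symm i)
  rw [tensSum, Iso.trans_hom, Elt.map_comp]
  refine Eq.trans ?_ h
  refine congrArg (Elt.map _) ?_
  refine (Elt.map_tensorHom _ _ _ _).trans ?_
  rw [map_tensCongr_hom, map_tensCongr_hom]
  refine congrArg₂ Elt.mul (congrArg tprod (funext fun i => ?_))
    (congrArg tprod (funext fun i => ?_))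
  · exact Elt.map_eqToHom x (finSumFinEquiv_symm_apply_castAdd i).symm _
  · exact Elt.map_eqToHom x (finSumFinEquiv_symm_apply_natAdd i).symm _

/-- The inputs of an operation which is composed with two groups of operations. -/
def sumPatternEquiv {k s : ℕ} (n : Fin k ⊕ Fin s → ℕ) :
    Fin (∑ i : Fin (k + s), n (finSumFinEquiv.symm i)) ≃
      (Σ i, Fin (n (Sum.inl i))) ⊕ Σ i, Fin (n (Sum.inr i)) :=
  (flat fun i : Fin (k + s) => n (finSumFinEquiv.symm i)).symm.trans
    ((Equiv.sigmaCongrLeft (β := fun c => Fin (n c)) finSumFinEquiv.symm).trans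
      (Equiv.sumSigmaDistrib fun c => Fin (n c)))

theorem sumPatternEquiv_flat {k s : ℕ} (n : Fin k ⊕ Fin s → ℕ) (i : Fin (k + s))
    (j : Fin (n (finSumFinEquiv.symm i))) :
    sumPatternEquiv n (flat (fun i : Fin (k + s) => n (finSumFinEquiv.symm i)) ⟨i, j⟩) =
      Equiv.sumSigmaDistrib (fun c => Fin (n c)) ⟨finSumFinEquiv.symm i, j⟩ := by
  simp [sumPatternEquiv]

/-- The composition of an operation with two groups of operations, where the inputs of the composite
are renamed along `E`. -/
def SymOperad.compSum (Q : SymOperad C) {k s N : ℕ} (n : Fin k ⊕ Fin s → ℕ)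
    (E : ((Σ i, Fin (n (Sum.inl i))) ⊕ Σ i, Fin (n (Sum.inr i))) ≃ Fin N) :
    Q.obj (k + s) ⊗ (tens (fun i => Q.obj (n (Sum.inl i))) ⊗
      tens (fun i => Q.obj (n (Sum.inr i)))) ⟶ Q.obj N :=
  Q.obj (k + s) ◁ (tensSum fun c => Q.obj (n c)).hom ≫ Q.comp _ _ ≫
    Q.act ((sumPatternEquiv n).trans E)

theorem SymOperad.op_compSum (Q : SymOperad C) {k s N : ℕ} (n : Fin k ⊕ Fin s → ℕ)
    (E : ((Σ i, Fin (n (Sum.inl i))) ⊕ Σ i, Fin (n (Sum.inr i))) ≃ Fin N)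
    (p : Elt (Q.obj (k + s))) (q : ∀ i, Elt (Q.obj (n (Sum.inl i))))
    (r : ∀ i, Elt (Q.obj (n (Sum.inr i)))) :
    Q.op (Elt.map (Q.compSum n E) (p ⋆ (tprod q ⋆ tprod r))) =
      (Q.std p id).bind (Sum.elim (fun i => Q.tm (q i) fun j => E (Sum.inl ⟨i, j⟩))
        fun i => Q.tm (r i) fun j => E (Sum.inr ⟨i, j⟩)) := by
  let x : ∀ c, Elt (Q.obj (n c)) := Sum.rec q r
  have h : Elt.map (Q.compSum n E) (p ⋆ (tprod q ⋆ tprod r)) =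
      Elt.map (Q.act ((sumPatternEquiv n).trans E)) (Elt.map (Q.comp _ _)
        (p ⋆ tprod fun i => x (finSumFinEquiv.symm i))) := by
    rw [SymOperad.compSum, Elt.map_comp, Elt.map_comp, Elt.map_whiskerLeft]
    exact congrArg (fun z => Elt.map _ (Elt.map _ (p ⋆ z))) (map_tensSum_hom x)
  rw [h]
  refine (SetOperad.opTerm_act (O := Q.elts) _ _).trans ?_
  refine (congrArg _ (SetOperad.opTerm_comp (O := Q.elts) _ p
    fun i => x (finSumFinEquiv.symm i))).trans ?_
  rw [SetOperad.map_bind]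
  refine Eq.trans ?_ (SetOperad.bind_map (Q.op p)
    (fun i => Sum.map id id (finSumFinEquiv.symm i)) _).symm
  refine SetOperad.bind_congr fun i => ?_
  rw [SetOperad.map_map]
  simp only [Equiv.trans_apply]
  have : ∀ j, sumPatternEquiv n (flat (fun i : Fin (k + s) => n (finSumFinEquiv.symm i)) ⟨i, j⟩) =
      Equiv.sumSigmaDistrib (fun c => Fin (n c)) ⟨finSumFinEquiv.symm i, j⟩ :=
    sumPatternEquiv_flat n i
  simp only [this]
  generalize finSumFinEquiv.symm i = c
  rcases c with i | i <;> rfl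

end Elements

/-! ### The objects of the enveloping operad -/

section Enveloping

variable {C : Type u} [Category.{v} C] [MonoidalCategory C] [SymmetricCategory C]
  {P : SymOperad C} (A : P.Algebra)

/-- The object `P(k+n) ⊗ A ⊗ ⋯ ⊗ A` of operations with `n` free inputs whose first `k` inputs are
filled with constants. -/
abbrev gen (n k : ℕ) : C := P.obj (k + n) ⊗ tens (fun _ : Fin k => A.X)

/-- The index set of the relations: arities `k + n` of an operation `p` and `l i` of operations
`q i`, and a numbering by `0, …, K-1` of the inputs of all the `q i`. -/
structure RelIndex where
  /-- The number of constants on the right hand side. -/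
  k : ℕ
  /-- The arities of the operations `q i`. -/
  l : Fin k → ℕ
  /-- The number of constants on the left hand side. -/
  K : ℕ
  /-- The labelling of the inputs. -/
  ε : Fin (∑ i, l i) ≃ Fin K

/-- The arities of the operations which are inserted into `p` on the left hand side. -/
abbrev RelIndex.arity (r : RelIndex) (n : ℕ) : Fin r.k ⊕ Fin n → ℕ := Sum.elim r.l fun _ => 1

/-- The labelling of the inputs of the left hand side of a relation. -/
def RelIndex.equiv (r : RelIndex) (n : ℕ) :
    ((Σ i, Fin (r.arity n (Sum.inl i))) ⊕ Σ i, Fin (r.arity n (Sum.inr i))) ≃ Fin (r.K + n) :=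
  (Equiv.sumCongr ((flat r.l).trans r.ε)
    (Equiv.sigmaUnique (Fin n) fun _ => Fin 1)).trans finSumFinEquiv

theorem RelIndex.equiv_symm_inl (r : RelIndex) (n : ℕ) (i : Fin r.k) (j : Fin (r.l i)) :
    finSumFinEquiv.symm (r.equiv n (Sum.inl ⟨i, j⟩)) = Sum.inl (r.ε (flat r.l ⟨i, j⟩)) :=
  finSumFinEquiv.symm_apply_apply (Sum.inl (r.ε (flat r.l ⟨i, j⟩)))

theorem RelIndex.equiv_symm_inr (r : RelIndex) (n : ℕ) (i : Fin n) (j : Fin 1) :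
    finSumFinEquiv.symm (r.equiv n (Sum.inr ⟨i, j⟩)) = Sum.inr i :=
  finSumFinEquiv.symm_apply_apply (Sum.inr i)

/-- The object of the elements `p, (q i), (a j)` of which a relation consists. -/
abbrev relObj (n : ℕ) (r : RelIndex) : C :=
  (P.obj (r.k + n) ⊗ tens fun i => P.obj (r.l i)) ⊗ tens fun _ : Fin r.K => A.X

/-- The left hand side `p(q 0, …, q (k-1), 1, …, 1), a` of a relation. -/
def relLeft (n : ℕ) (r : RelIndex) : relObj A n r ⟶ gen A n r.K :=
  (P.obj (r.k + n) ◁ ((ρ_ _).inv ≫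
      (tens fun i => P.obj (r.l i)) ◁ ((tensUnits n).inv ≫ tensMap fun _ => P.one)) ≫
    P.compSum (r.arity n) (r.equiv n)) ▷ tens fun _ : Fin r.K => A.X

/-- The right hand side `p, (q 0 a, …, q (k-1) a)` of a relation. -/
def relRight (n : ℕ) (r : RelIndex) : relObj A n r ⟶ gen A n r.k :=
  (α_ _ _ _).hom ≫ P.obj (r.k + n) ◁
    ((tens fun i => P.obj (r.l i)) ◁ (tensPerm r.ε fun _ => A.X).hom ≫
      blockMap r.l (fun i => P.obj (r.l i)) (fun _ => A.X) (fun _ => A.X) fun i => A.smul (r.l i))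

/-- The composite `p(q 0, …, q (k-1), 1, …, 1)`. -/
def relOp {P : SymOperad C} {n : ℕ} (r : RelIndex) (p : Elt (P.obj (r.k + n)))
    (q : ∀ i, Elt (P.obj (r.l i))) : Elt (P.obj (r.K + n)) :=
  Elt.map (P.compSum (r.arity n) (r.equiv n))
    (p ⋆ (tprod q ⋆ tprod fun _ : Fin n => Elt.map P.one (Elt.unit C)))

theorem map_relLeft {n : ℕ} (r : RelIndex) (p : Elt (P.obj (r.k + n)))
    (q : ∀ i, Elt (P.obj (r.l i))) (a : Fin r.K → Elt A.X) :
    Elt.map (relLeft A n r) (p ⋆ tprod q ⋆ tprod a) = relOp r p q ⋆ tprod a := by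
  refine (Elt.map_whiskerRight _ _ _).trans (congrArg (· ⋆ tprod a) ?_)
  refine (Elt.map_comp _ _ _).trans ?_
  refine congrArg (Elt.map _) ?_
  rw [Elt.map_whiskerLeft, Elt.map_comp, Elt.map_rightUnitor_inv, Elt.map_whiskerLeft,
    Elt.map_comp, map_tensUnits_inv, map_tensMap]
  rfl

theorem map_relRight {n : ℕ} (r : RelIndex) (p : Elt (P.obj (r.k + n)))
    (q : ∀ i, Elt (P.obj (r.l i))) (a : Fin r.K → Elt A.X) :
    Elt.map (relRight A n r) (p ⋆ tprod q ⋆ tprod a) =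
      p ⋆ tprod fun i => A.elts.eval (P.tm (q i) fun j => a (r.ε (flat r.l ⟨i, j⟩))) := by
  refine (Elt.map_comp _ _ _).trans ?_
  rw [Elt.map_associator_hom, Elt.map_whiskerLeft, Elt.map_comp,
    Elt.map_whiskerLeft, map_tensPerm_hom]
  exact congrArg (p ⋆ ·) (map_blockMap _ _ _ _)

/-- The left hand side of a relation, as a term. -/
theorem std_relOp {n : ℕ} (r : RelIndex) (p : Elt (P.obj (r.k + n)))
    (q : ∀ i, Elt (P.obj (r.l i))) {Λ : Type*} (a : Fin r.K → Λ) :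
    P.std (relOp r p q) a = (P.std p id).bind
      (Sum.elim (fun i => (P.tm (q i) fun j => a (r.ε (flat r.l ⟨i, j⟩))).map Sum.inl)
        fun j => SetOperad.Term.pure (Sum.inr j)) := by
  have h := congrArg (SetOperad.Term.map fun i => Sum.map a id (finSumFinEquiv.symm i))
    (P.op_compSum (r.arity n) (r.equiv n) p q fun _ => Elt.map P.one (Elt.unit C))
  refine h.trans ?_
  rw [SetOperad.map_bind]
  refine SetOperad.bind_congr ?_
  rintro (i | i)
  · exact congrArg (P.tm (q i)) (funext fun j => congrArg (Sum.map a id) (r.equiv_symm_inl n i j))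
  · exact congrArg (P.tm (Elt.map P.one (Elt.unit C))) (funext fun j =>
      congrArg (Sum.map a id) (r.equiv_symm_inr n i j))

theorem tm_injective {Λ : Type*} {n : ℕ} {p p' : Elt (P.obj n)} {x : Fin n → Λ}
    (hx : Function.Injective x) (h : P.tm p x = P.tm p' x) : p = p' := by
  obtain ⟨e, he, he'⟩ := SetOperad.tm_eq_tm_iff.mp h
  obtain rfl : e = Equiv.refl _ := Equiv.ext fun i => hx (he' i)
  exact (P.elts.act_refl p).symm.trans he

/-- The elements of the form `p, a 0, …, a (k-1)`. -/
def genSet (n k : ℕ) : Set (Elt (gen A n k)) :=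
  {z | ∃ (p : Elt (P.obj (k + n))) (a : Fin k → Elt A.X), z = p ⋆ tprod a}

theorem detecting_genSet (n k : ℕ) : Detecting (genSet A n k) := by
  refine ((detecting_univ _).mul (detecting_tens fun _ => detecting_univ _)).mono ?_
  rintro _ ⟨p, -, _, ⟨a, -, rfl⟩, rfl⟩
  exact ⟨p, a, rfl⟩

section Colimits

variable [HasColimits C]

/-- The object of `n`-ary operations of the enveloping operad: the quotient of the coproduct of the
objects `P(k+n) ⊗ A ⊗ ⋯ ⊗ A` by the relations
`p(q 0, …, q (k-1), 1, …, 1), a ∼ p, (q 0 a, …, q (k-1) a)`. -/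
def envObj (n : ℕ) : C :=
  coequalizer (Sigma.desc fun r => relLeft A n r ≫ Sigma.ι (gen A n) r.K)
    (Sigma.desc fun r => relRight A n r ≫ Sigma.ι (gen A n) r.k)

/-- The structure morphism from the object of operations with `k` constants. -/
def envι (n k : ℕ) : gen A n k ⟶ envObj A n := Sigma.ι (gen A n) k ≫ coequalizer.π _ _

theorem relLeft_envι (n : ℕ) (r : RelIndex) :
    relLeft A n r ≫ envι A n r.K = relRight A n r ≫ envι A n r.k := by
  have := congrArg (Sigma.ι (relObj A n) r ≫ ·) (coequalizer.condition
    (Sigma.desc fun r => relLeft A n r ≫ Sigma.ι (gen A n) r.K)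
    (Sigma.desc fun r => relRight A n r ≫ Sigma.ι (gen A n) r.k))
  simpa [envι, envObj] using this

variable [MonoidalClosed C]

/-- Morphisms out of `P_A(n) ⊗ Y` can be defined on generators, since the functor `– ⊗ Y` has a
right adjoint and hence preserves the defining colimit. -/
theorem exists_envObj_desc {n : ℕ} {Y Z : C} (f : ∀ k, gen A n k ⊗ Y ⟶ Z)
    (h : ∀ r, relLeft A n r ▷ Y ≫ f r.K = relRight A n r ▷ Y ≫ f r.k) :
    ∃ g : envObj A n ⊗ Y ⟶ Z, ∀ k, envι A n k ▷ Y ≫ g = f k := by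
  have nat : ∀ {X X' : C} (a : X ⟶ X') (b : X' ⊗ Y ⟶ Z),
      a ≫ MonoidalClosed.curry ((β_ Y X').hom ≫ b) =
        MonoidalClosed.curry ((β_ Y X).hom ≫ a ▷ Y ≫ b) := by
    intro X X' a b
    rw [← MonoidalClosed.curry_natural_left, BraidedCategory.braiding_naturality_right_assoc]
  let F : ∐ gen A n ⟶ (ihom Y).obj Z :=
    Sigma.desc fun k => MonoidalClosed.curry ((β_ Y _).hom ≫ f k)
  let g : envObj A n ⟶ (ihom Y).obj Z := coequalizer.desc F (by
    refine Sigma.hom_ext _ _ fun r => ?_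
    simp only [F, colimit.ι_desc_assoc, Cofan.mk_ι_app, Category.assoc, colimit.ι_desc,
      Discrete.functor_obj_eq_as]
    rw [nat, nat, h])
  refine ⟨(β_ _ _).hom ≫ MonoidalClosed.uncurry g, fun k => ?_⟩
  rw [BraidedCategory.braiding_naturality_left_assoc, ← MonoidalClosed.uncurry_natural_left]
  have : envι A n k ≫ g = MonoidalClosed.curry ((β_ Y _).hom ≫ f k) := by
    simp [envι, g, F, envObj]
  rw [this, MonoidalClosed.uncurry_curry, SymmetricCategory.symmetry_assoc]

/-- The generators are jointly epimorphic, also after tensoring with an object. -/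
theorem envObj_hom_ext {n : ℕ} ⦃Y Z : C⦄ (f g : envObj A n ⊗ Y ⟶ Z)
    (h : ∀ k, envι A n k ▷ Y ≫ f = envι A n k ▷ Y ≫ g) : f = g := by
  rw [← cancel_epi (β_ Y _).hom]
  apply MonoidalClosed.curry_injective
  have key : ∀ k, envι A n k ≫ MonoidalClosed.curry ((β_ Y (envObj A n)).hom ≫ f) =
      envι A n k ≫ MonoidalClosed.curry ((β_ Y (envObj A n)).hom ≫ g) := fun k => by
    rw [← MonoidalClosed.curry_natural_left, ← MonoidalClosed.curry_natural_left,
      BraidedCategory.braiding_naturality_right_assoc,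
      BraidedCategory.braiding_naturality_right_assoc, h]
  refine coequalizer.hom_ext (Sigma.hom_ext _ _ fun k => ?_)
  exact (Category.assoc _ _ _).symm.trans ((key k).trans (Category.assoc _ _ _))

end Colimits

end Enveloping

/-! ### Terms as elements of the enveloping operad -/

section Enveloping

variable {C : Type u} [Category.{v} C] [MonoidalCategory C] [SymmetricCategory C]
  {P : SymOperad C} (A : P.Algebra)

open SetOperad

variable {A} in
/-- The relation between terms which replaces subterms without variables, on the left hand side, by
their values in `A`, on the right hand side. These are the defining relations of the enveloping
operad, in terms of elements. -/
def Step {n : ℕ} (t t' : P.elts.Term (Elt A.X ⊕ Fin n)) : Prop :=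
  ∃ (k : ℕ) (p : Elt (P.obj (k + n))) (r : Fin k → P.elts.Term (Elt A.X)),
    t = (P.std p id).bind (Sum.elim (fun i => (r i).map Sum.inl) fun j => Term.pure (Sum.inr j)) ∧
    t' = P.std p fun i => A.elts.eval (r i)

theorem std_eq_map {Λ : Type*} {k n : ℕ} (p : Elt (P.obj (k + n))) (a : Fin k → Λ) :
    P.std p a = (P.std p id).map (Sum.map a id) :=
  congrArg (P.tm p) (funext fun i => by simp)

variable {A} in
/-- The values of terms can be inserted for the constants of any linear term, not only of one in
standard form. -/
theorem SetOperad.Term.IsLinear.step {n : ℕ} {Λ : Type*} {t : P.elts.Term (Λ ⊕ Fin n)}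
    (ht : t.IsLinear) (r : Λ → P.elts.Term (Elt A.X)) :
    Step (t.bind (Sum.elim (fun i => (r i).map Sum.inl) fun j => Term.pure (Sum.inr j)))
      (t.map (Sum.map (fun i => A.elts.eval (r i)) id)) := by
  obtain ⟨k, p, a, rfl⟩ := ht.exists_std
  refine ⟨k, p, fun i => r (a i), ?_, ?_⟩
  · refine (congrArg (fun t => Term.bind t _) (std_eq_map p a)).trans ?_
    rw [bind_map]
    refine bind_congr ?_
    rintro (i | i) <;> rfl
  · exact (congrArg (fun t => Term.map _ t) (std_eq_map p a)).trans
      ((map_map _ _ _).trans (Eq.trans (congrArg (fun f => Term.map f (P.std p id))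
        (funext fun l => by cases l <;> rfl)) (std_eq_map p _).symm))

variable {A} in
theorem Step.refl {n : ℕ} {t : P.elts.Term (Elt A.X ⊕ Fin n)} (ht : t.IsLinear) : Step t t := by
  have h := Term.IsLinear.step ht fun a => (Term.pure a : P.elts.Term (Elt A.X))
  simp only [map_pure, Algebra.eval_pure] at h
  convert h using 1
  · refine (bind_pure t).symm.trans (bind_congr ?_)
    rintro (a | i) <;> rfl
  · refine (map_id t).symm.trans (congrArg (fun f => Term.map f t) (funext ?_))
    rintro (a | i) <;> rfl

/-- A bijection of disjoint unions which is the identity on the second summand is induced by a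
bijection of the first summands. -/
theorem exists_equiv_of_inr {k k' n : ℕ} (e : Fin k ⊕ Fin n ≃ Fin k' ⊕ Fin n)
    (h : ∀ i, e (Sum.inr i) = Sum.inr i) :
    ∃ ε : Fin k ≃ Fin k', ∀ c, e c = Sum.map ε id c := by
  have h₁ : ∀ i, ∃ j, e (Sum.inl i) = Sum.inl j := fun i => by
    rcases h' : e (Sum.inl i) with j | j
    · exact ⟨j, rfl⟩
    · exact absurd (e.injective (h'.trans (h j).symm)) (by simp)
  choose f hf using h₁
  refine ⟨Equiv.ofBijective f ⟨fun i j hij => ?_, fun j => ?_⟩, ?_⟩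
  · exact Sum.inl_injective (e.injective ((hf i).trans ((congrArg _ hij).trans (hf j).symm)))
  · obtain ⟨i | i, hi⟩ := e.surjective (Sum.inl j)
    · exact ⟨i, Sum.inl_injective ((hf i).symm.trans hi)⟩
    · exact absurd ((h i).symm.trans hi) (by simp)
  · rintro (i | i)
    · exact hf i
    · exact h i

variable [HasColimits C]

/-- The defining relations of the enveloping operad, on elements. -/
theorem envι_rel {n : ℕ} (r : RelIndex) (p : Elt (P.obj (r.k + n)))
    (q : ∀ i, Elt (P.obj (r.l i))) (a : Fin r.K → Elt A.X) :
    Elt.map (envι A n r.K) (relOp r p q ⋆ tprod a) = Elt.map (envι A n r.k)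
      (p ⋆ tprod fun i => A.elts.eval (P.tm (q i) fun j => a (r.ε (flat r.l ⟨i, j⟩)))) := by
  rw [← map_relLeft, ← map_relRight, ← Elt.map_comp, ← Elt.map_comp, relLeft_envι]

/-- The class of a generator depends only on the term which it represents. The equality of terms
provides a permutation of the constants, and this is absorbed by the relation in which all the `q i`
are the operad unit. -/
theorem envι_eq_of_std_eq {n k k' : ℕ} {p : Elt (P.obj (k + n))} {p' : Elt (P.obj (k' + n))}
    {a : Fin k → Elt A.X} {a' : Fin k' → Elt A.X} (h : P.std p a = P.std p' a') :
    Elt.map (envι A n k) (p ⋆ tprod a) = Elt.map (envι A n k') (p' ⋆ tprod a') := by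
  obtain ⟨e, rfl, he⟩ := tm_eq_tm_iff.mp h
  obtain ⟨ε, hε⟩ := exists_equiv_of_inr (n := n)
    (finSumFinEquiv.trans (e.trans finSumFinEquiv.symm)) fun i => by
      have := he (finSumFinEquiv (Sum.inr i))
      rw [Equiv.symm_apply_apply] at this
      change finSumFinEquiv.symm (e _) = _
      rcases h' : finSumFinEquiv.symm (e (finSumFinEquiv (Sum.inr i))) with j | j
      · rw [h'] at this
        simp at this
      · rw [h'] at this
        exact congrArg Sum.inr (Sum.inr_injective this)
  have ha : ∀ i, a' (ε i) = a i := fun i => by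
    have := he (finSumFinEquiv (Sum.inl i))
    rw [Equiv.symm_apply_apply] at this
    have h' : finSumFinEquiv.symm (e (finSumFinEquiv (Sum.inl i))) = Sum.inl (ε i) :=
      hε (Sum.inl i)
    rw [h'] at this
    exact Sum.inl_injective this
  let r : RelIndex := ⟨k, fun _ => 1, k', (compOneEquiv k).symm.trans ε⟩
  have hr : ∀ i j, r.ε (flat r.l ⟨i, j⟩) = ε i := fun i j => by
    obtain rfl : j = 0 := Subsingleton.elim _ _
    exact congrArg ε ((compOneEquiv k).symm_apply_apply i)
  have h₁ := envι_rel A (n := n) r p (fun _ => Elt.map P.one (Elt.unit C)) a'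
  have h₂ : relOp (n := n) r p (fun _ => Elt.map P.one (Elt.unit C)) = P.elts.act e p := by
    refine tm_injective (x := fun i => Sum.map id id (finSumFinEquiv.symm i))
      (fun i j hij => ?_) ((std_relOp r p (fun _ => Elt.map P.one (Elt.unit C)) id).trans ?_)
    · exact finSumFinEquiv.symm.injective (by simpa using hij)
    · refine Eq.trans ?_ (tm_act (O := P.elts) e p _).symm
      have : ∀ i, finSumFinEquiv.symm (e i) = Sum.map ε id (finSumFinEquiv.symm i) := fun i => by
        have := hε (finSumFinEquiv.symm i)
        rw [← this]
        exact congrArg (fun i => finSumFinEquiv.symm (e i)) (Equiv.apply_symm_apply _ i).symm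
      simp only [this]
      refine Eq.trans ?_ ((SetOperad.bind_pure_comp (P.std p id) (Sum.map ε id)).trans
        (congrArg (P.tm p) (funext fun i => by simp)))
      refine bind_congr ?_
      rintro (i | i)
      · exact congrArg (fun f => P.tm (Elt.map P.one (Elt.unit C)) f)
          (funext fun j => congrArg Sum.inl (hr i j))
      · rfl
  rw [h₂] at h₁
  refine Eq.trans ?_ h₁.symm
  refine congrArg (fun z => Elt.map (envι A n k) (p ⋆ tprod z)) (funext fun i => ?_)
  refine Eq.trans ?_ (A.elts.one_smul fun j => a' (r.ε (flat r.l ⟨i, j⟩))).symm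
  rw [hr, ha]

variable {A} in
/-- `z` is the element of the enveloping operad which is represented by `t`. -/
def IsClass {n : ℕ} (t : P.elts.Term (Elt A.X ⊕ Fin n)) (z : Elt (envObj A n)) : Prop :=
  ∃ (k : ℕ) (p : Elt (P.obj (k + n))) (a : Fin k → Elt A.X),
    t = P.std p a ∧ z = Elt.map (envι A n k) (p ⋆ tprod a)

open Classical in
/-- The element of the enveloping operad which is represented by a linear term. It is `none` if the
term is not linear. -/
def cls {n : ℕ} (t : P.elts.Term (Elt A.X ⊕ Fin n)) : Elt (envObj A n) :=
  if h : ∃ z, IsClass t z then h.choose else (show Elt _ from none)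

theorem cls_std {n k : ℕ} (p : Elt (P.obj (k + n))) (a : Fin k → Elt A.X) :
    cls A (P.std p a) = Elt.map (envι A n k) (p ⋆ tprod a) := by
  have h : ∃ z, IsClass (P.std p a) z := ⟨_, k, p, a, rfl, rfl⟩
  rw [cls, dif_pos h]
  obtain ⟨k', p', a', ht, hz⟩ := h.choose_spec
  rw [hz]
  exact (envι_eq_of_std_eq A ht).symm

variable {A} in
theorem Step.cls_eq {n : ℕ} {t t' : P.elts.Term (Elt A.X ⊕ Fin n)} (h : Step t t') :
    cls A t = cls A t' := by
  obtain ⟨k, p, r, rfl, rfl⟩ := h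
  choose l q b hr using fun i => (r i).exists_rep
  obtain rfl : r = fun i => tm (q i) (b i) := funext hr
  let R : RelIndex := ⟨k, l, _, Equiv.refl _⟩
  have h := std_relOp R p q (blockLabel l b)
  have h' := envι_rel A R p q (blockLabel l b)
  have hb : ∀ i j, blockLabel l b (R.ε (flat R.l ⟨i, j⟩)) = b i j := blockLabel_flat l b
  simp only [hb] at h h'
  rw [← cls_std, ← cls_std] at h'
  exact (congrArg (cls A) h.symm).trans h'

variable [MonoidalClosed C]

/-- The elements of the enveloping operad which are represented by linear terms. -/
def clsSet (n : ℕ) : Set (Elt (envObj A n)) :=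
  {z | ∃ t : P.elts.Term (Elt A.X ⊕ Fin n), t.IsLinear ∧ z = cls A t}

theorem detecting_clsSet (n : ℕ) : Detecting (clsSet A n) := by
  refine (Detecting.map (envι A n) (envObj_hom_ext A) (detecting_genSet A n)).mono ?_
  rintro _ ⟨k, _, ⟨p, a, rfl⟩, rfl⟩
  exact ⟨P.std p a, isLinear_std _ _, (cls_std A p a).symm⟩

/-- A function of terms which is invariant under `Step`, and which is given by morphisms on the
terms in standard form, is induced by a morphism out of `P_A(n) ⊗ Y`. The parameters `S` name a
detecting set of elements of `Y`. -/
theorem exists_desc {n : ℕ} {S : Type*} {Y Z : C} {d : S → Elt Y} (hd : Detecting (Set.range d))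
    (Φ : P.elts.Term (Elt A.X ⊕ Fin n) → S → Elt Z)
    (hf : ∀ k, ∃ f : gen A n k ⊗ Y ⟶ Z, ∀ (p : Elt (P.obj (k + n))) (a : Fin k → Elt A.X) (σ : S),
      Elt.map f (p ⋆ tprod a ⋆ d σ) = Φ (P.std p a) σ)
    (hΦ : ∀ t t', Step t t' → ∀ σ, Φ t σ = Φ t' σ) :
    ∃ g : envObj A n ⊗ Y ⟶ Z, ∀ t : P.elts.Term (Elt A.X ⊕ Fin n), t.IsLinear → ∀ σ,
      Elt.map g (cls A t ⋆ d σ) = Φ t σ := by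
  choose f hf using hf
  obtain ⟨g, hg⟩ := exists_envObj_desc A f fun r => by
    refine ((((detecting_univ _).mul (detecting_tens fun _ => detecting_univ _)).mul
      (detecting_tens fun _ => detecting_univ _)).mul hd).eq_of_map_eq ?_
    rintro _ ⟨_, ⟨_, ⟨p, -, _, ⟨q, -, rfl⟩, rfl⟩, _, ⟨a, -, rfl⟩, rfl⟩, _, ⟨σ, rfl⟩, rfl⟩
    rw [Elt.map_comp, Elt.map_comp, Elt.map_whiskerRight, Elt.map_whiskerRight, map_relLeft,
      map_relRight, hf, hf]
    refine hΦ _ _ ⟨r.k, p, fun i => P.tm (q i) fun j => a (r.ε (flat r.l ⟨i, j⟩)), ?_, rfl⟩ σ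
    exact std_relOp r p q a
  refine ⟨g, fun t ht σ => ?_⟩
  obtain ⟨k, p, a, rfl⟩ := ht.exists_std
  refine Eq.trans ?_ (hf k p a σ)
  rw [← hg, Elt.map_comp, Elt.map_whiskerRight]
  exact congrArg (fun z => Elt.map g (z ⋆ d σ)) (cls_std A p a)

/-- The version of `exists_desc` for several terms. It is proved by induction, where the classes of
all terms but one are treated as parameters. -/
theorem exists_desc_tens {s : ℕ} (n : Fin s → ℕ) {S : Type (max u v)} {Y Z : C} {d : S → Elt Y}
    (hd : Detecting (Set.range d)) (Φ : (∀ i, P.elts.Term (Elt A.X ⊕ Fin (n i))) → S → Elt Z)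
    (hf : ∀ k : Fin s → ℕ, ∃ f : Y ⊗ tens (fun i => gen A (n i) (k i)) ⟶ Z,
      ∀ (p : ∀ i, Elt (P.obj (k i + n i))) (a : ∀ i, Fin (k i) → Elt A.X) (σ : S),
        Elt.map f (d σ ⋆ tprod fun i => p i ⋆ tprod (a i)) = Φ (fun i => P.std (p i) (a i)) σ)
    (hΦ : ∀ t t', (∀ i, Step (t i) (t' i)) → ∀ σ, Φ t σ = Φ t' σ) :
    ∃ g : Y ⊗ tens (fun i => envObj A (n i)) ⟶ Z,
      ∀ t : ∀ i, P.elts.Term (Elt A.X ⊕ Fin (n i)), (∀ i, (t i).IsLinear) → ∀ σ,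
        Elt.map g (d σ ⋆ tprod fun i => cls A (t i)) = Φ t σ := by
  induction s generalizing S Y Z with
  | zero =>
    obtain ⟨f, hf⟩ := hf fun i => i.elim0
    refine ⟨f, fun t _ σ => ?_⟩
    refine (hf (fun i => i.elim0) (fun i => i.elim0) σ).trans ?_
    exact congrArg (Φ · σ) (funext fun i => i.elim0)
  | succ s ih =>
    -- the classes of the last term are adjoined to the parameters
    let S' := S × {t : P.elts.Term (Elt A.X ⊕ Fin (n (Fin.last s))) // t.IsLinear}
    let d' : S' → Elt (Y ⊗ envObj A (n (Fin.last s))) := fun σ => d σ.1 ⋆ cls A σ.2.1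
    have hd' : Detecting (Set.range d') := by
      refine (hd.mul (detecting_clsSet A _)).mono ?_
      rintro _ ⟨_, ⟨σ, rfl⟩, _, ⟨t, ht, rfl⟩, rfl⟩
      exact ⟨(σ, ⟨t, ht⟩), rfl⟩
    have hsnoc : ∀ t : ∀ i, P.elts.Term (Elt A.X ⊕ Fin (n i)),
        (Fin.lastCases (motive := fun i => P.elts.Term (Elt A.X ⊕ Fin (n i))) (t (Fin.last s))
          fun i => t i.castSucc) = t := fun t =>
      funext fun i => Fin.lastCases (by simp) (fun i => by simp) i
    refine (ih (fun i => n i.castSucc) hd'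
      (fun t σ => Φ (Fin.lastCases (motive := fun i => P.elts.Term (Elt A.X ⊕ Fin (n i))) σ.2.1 t)
        σ.1) (fun k' => ?_)
      (fun t t' h σ => ?_)).elim fun g hg => ?_
    rotate_left 2
    · refine ⟨_ ◁ (β_ _ _).hom ≫ (α_ _ _ _).inv ≫ g, fun t ht σ => ?_⟩
      have := hg (fun i => t i.castSucc) (fun i => ht _) (σ, ⟨t (Fin.last s), ht _⟩)
      rw [hsnoc] at this
      rw [← this, tprod_succ]
      simp only [d']
      refine (Elt.map_comp _ _ _).trans ?_
      refine (congrArg _ ((Elt.map_whiskerLeft _ _ _).trans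
        (congrArg (d σ ⋆ ·) (Elt.map_braiding_hom _ _)))).trans ?_
      rw [Elt.map_comp, Elt.map_associator_inv]
    · have key : ∀ k₀, ∃ f : gen A (n (Fin.last s)) k₀ ⊗
          (Y ⊗ tens (fun i => gen A (n i.castSucc) (k' i))) ⟶ Z,
          ∀ (p : Elt (P.obj (k₀ + n (Fin.last s)))) (a : Fin k₀ → Elt A.X)
            (q : ∀ i, Elt (P.obj (k' i + n i.castSucc))) (b : ∀ i, Fin (k' i) → Elt A.X) (σ : S),
          Elt.map f (p ⋆ tprod a ⋆ (d σ ⋆ tprod fun i => q i ⋆ tprod (b i))) =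
            Φ (Fin.lastCases (motive := fun i => P.elts.Term (Elt A.X ⊕ Fin (n i))) (P.std p a)
              fun i => P.std (q i) (b i)) σ := by
        intro k₀
        obtain ⟨k, rfl, rfl⟩ : ∃ k : Fin (s + 1) → ℕ,
            (fun i => k (Fin.castSucc i)) = k' ∧ k (Fin.last s) = k₀ :=
          ⟨Fin.lastCases k₀ k', funext fun i => by simp, by simp⟩
        obtain ⟨f, hf⟩ := hf k
        refine ⟨(β_ _ _).hom ≫ (α_ _ _ _).hom ≫ f, fun p a q b σ => ?_⟩
        have := hf (Fin.lastCases (motive := fun i => Elt (P.obj (k i + n i))) p q)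
          (Fin.lastCases (motive := fun i => Fin (k i) → Elt A.X) a b) σ
        rw [Elt.map_comp, Elt.map_braiding_hom]
        refine (Elt.map_comp _ _ _).trans ?_
        rw [Elt.map_associator_hom]
        refine Eq.trans ?_ (this.trans (congrArg (Φ · σ) (funext fun i => ?_)))
        · rw [tprod_succ]
          simp only [Fin.lastCases_last, Fin.lastCases_castSucc]
          rfl
        · refine Fin.lastCases ?_ (fun i => ?_) i
          · simp only [Fin.lastCases_last]
          · simp only [Fin.lastCases_castSucc]
      -- for the last term, the representatives of all other terms serve as parameters
      let e : (∀ i, (Elt (P.obj (k' i + n i.castSucc)) × (Fin (k' i) → Elt A.X))) →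
          Elt (tens fun i => gen A (n i.castSucc) (k' i)) :=
        fun x => tprod fun i => (x i).1 ⋆ tprod (x i).2
      have he : Detecting (Set.range e) := by
        refine (detecting_tens fun i => detecting_genSet A (n i.castSucc) (k' i)).mono ?_
        rintro _ ⟨x, hx, rfl⟩
        choose p a h using hx
        exact ⟨fun i => (p i, a i), congrArg tprod (funext fun i => (h i).symm)⟩
      have hde : Detecting (Set.range fun σ : S × _ => d σ.1 ⋆ e σ.2) := by
        refine (hd.mul he).mono ?_
        rintro _ ⟨_, ⟨σ, rfl⟩, _, ⟨x, rfl⟩, rfl⟩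
        exact ⟨(σ, x), rfl⟩
      refine (exists_desc A (n := n (Fin.last s)) hde
        (fun t σ => Φ (Fin.lastCases (motive := fun i => P.elts.Term (Elt A.X ⊕ Fin (n i))) t
          fun i => P.std (σ.2 i).1 (σ.2 i).2) σ.1) (fun k₀ => ?_)
        (fun t t' h σ => ?_)).elim fun g hg => ?_
      rotate_left 2
      · refine ⟨(β_ _ _).hom ▷ _ ≫ (α_ _ _ _).hom ≫ g, fun p a σ => ?_⟩
        refine Eq.trans ?_ (hg σ.2.1 σ.2.2 (σ.1, fun i => (p i, a i)))
        simp only [Elt.map_comp, d']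
        rw [Elt.map_whiskerRight, Elt.map_braiding_hom, Elt.map_associator_hom]
      · obtain ⟨f, hf⟩ := key k₀
        exact ⟨f, fun p a σ => hf p a _ _ _⟩
      · obtain ⟨σ, x⟩ := σ
        refine hΦ _ _ (fun i => ?_) σ
        refine Fin.lastCases ?_ (fun i => ?_) i
        · simpa only [Fin.lastCases_last] using h
        · simpa only [Fin.lastCases_castSucc] using Step.refl (isLinear_std _ _)
    · obtain ⟨σ, t₀, ht₀⟩ := σ
      refine hΦ _ _ (fun i => ?_) σ
      refine Fin.lastCases ?_ (fun i => ?_) i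
      · simpa using Step.refl ht₀
      · simpa using h i

end Enveloping

/-! ### Substitution of linear terms -/

namespace SetOperad

variable {O : SetOperad} {Λ Λ' : Type*}

/-- The substitution of the terms `u i` for the variables of `t`. -/
def Term.subst {s : ℕ} (n : Fin s → ℕ) (t : O.Term (Λ ⊕ Fin s)) (u : ∀ i, O.Term (Λ ⊕ Fin (n i))) :
    O.Term (Λ ⊕ Fin (∑ i, n i)) :=
  t.bind (Sum.elim (fun a => Term.pure (Sum.inl a))
    fun i => (u i).map (Sum.map id fun j => flat n ⟨i, j⟩))

theorem Term.IsLinear.subst {s : ℕ} {n : Fin s → ℕ} {t : O.Term (Λ ⊕ Fin s)} (ht : t.IsLinear)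
    {u : ∀ i, O.Term (Λ ⊕ Fin (n i))} (hu : ∀ i, (u i).IsLinear) : (t.subst n u).IsLinear :=
  ht.bind (flat n) Term.pure hu

theorem isLinear_pure : (Term.pure (Sum.inr 0) : O.Term (Λ ⊕ Fin 1)).IsLinear :=
  isLinear_tm.mpr fun _ =>
    ⟨0, congrArg Sum.inr (Subsingleton.elim _ _), fun _ _ => Subsingleton.elim _ _⟩

end SetOperad

section Enveloping

variable {C : Type u} [Category.{v} C] [MonoidalCategory C] [SymmetricCategory C]
  {P : SymOperad C} {A : P.Algebra}

open SetOperad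

/-- The replacements in a term and in the terms which are substituted for its variables can be made
simultaneously. -/
theorem Step.subst {s : ℕ} (n : Fin s → ℕ) {t t' : P.elts.Term (Elt A.X ⊕ Fin s)}
    (h : Step t t') {u u' : ∀ i, P.elts.Term (Elt A.X ⊕ Fin (n i))} (hu : ∀ i, Step (u i) (u' i)) :
    Step (t.subst n u) (t'.subst n u') := by
  obtain ⟨k, p, r, rfl, rfl⟩ := h
  choose k' q b hb hb' using hu
  obtain rfl := funext hb
  obtain rfl := funext hb'
  -- the linear term `w` has all the constants of the given terms as its constants, so that all
  -- replacements happen at once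
  let w : P.elts.Term ((Fin k ⊕ Σ i, Fin (k' i)) ⊕ Fin (∑ i, n i)) :=
    (P.std p id).bind (Sum.elim (fun i => Term.pure (Sum.inl (Sum.inl i)))
      fun i => (P.std (q i) id).map (Sum.map (fun j => Sum.inr ⟨i, j⟩) fun j => flat n ⟨i, j⟩))
  have hw : w.IsLinear := by
    have := (isLinear_std (O := P.elts) p (id : Fin k → Fin k)).bind (flat n)
      (fun l => Term.pure (Sum.inl l : Fin k ⊕ Σ i, Fin (k' i)))
      (fun i => (isLinear_std (O := P.elts) (q i) (id : Fin (k' i) → Fin (k' i))).map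
        (fun j => (Sum.inr ⟨i, j⟩ : Fin k ⊕ Σ i, Fin (k' i))) (Equiv.refl _))
    convert this using 4 with i
    · rfl
    rw [SetOperad.map_map]
    refine congrArg (fun f => Term.map f _) (funext fun c => ?_)
    cases c <;> rfl
  have := hw.step (Sum.elim r fun x => b x.1 x.2)
  convert this using 1
  · simp only [w, Term.subst, SetOperad.bind_assoc]
    refine SetOperad.bind_congr ?_
    rintro (i | i)
    · simp [SetOperad.bind_pure_comp]
    · simp only [Sum.elim_inr, SetOperad.pure_bind, SetOperad.map_bind, SetOperad.bind_map]
      refine SetOperad.bind_congr ?_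
      rintro (j | j)
      · simp
      · rfl
  · simp only [w, Term.subst]
    rw [std_eq_map p, SetOperad.bind_map, SetOperad.map_bind]
    refine SetOperad.bind_congr ?_
    rintro (i | i)
    · rfl
    · simp only [Sum.map_inr, Sum.elim_inr, id]
      rw [std_eq_map (q i), SetOperad.map_map, SetOperad.map_map]
      refine congrArg (fun f => Term.map f _) (funext fun c => ?_)
      cases c <;> rfl

/-! ### Composition in the enveloping operad -/

/-- A product of products can be rearranged such that the last factors form a single family. -/
theorem exists_unzip {s : ℕ} (k : Fin s → ℕ) (X : Fin s → C) (B : C) :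
    ∃ g : tens (fun i => X i ⊗ tens fun _ : Fin (k i) => B) ⟶
        tens X ⊗ tens fun _ : Fin (∑ i, k i) => B,
      ∀ (x : ∀ i, Elt (X i)) (b : ∀ i, Fin (k i) → Elt B),
        Elt.map g (tprod fun i => x i ⋆ tprod (b i)) = tprod x ⋆ tprod (blockLabel k b) := by
  induction s with
  | zero =>
    refine ⟨(λ_ (𝟙_ C)).inv ≫ 𝟙_ C ◁ (tensCast (Fin.sum_univ_zero k).symm fun _ => B).hom,
      fun x b => ?_⟩
    refine (Elt.map_comp _ _ _).trans ?_
    refine (congrArg _ (Elt.map_leftUnitor_inv _)).trans ?_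
    refine (Elt.map_whiskerLeft _ _ _).trans (congrArg (Elt.unit C ⋆ ·) ?_)
    refine (map_tensCast_hom _ fun i => i.elim0).trans ?_
    exact congrArg tprod (funext fun i => ((flat k).symm i).1.elim0)
  | succ s ih =>
    obtain ⟨g, hg⟩ := ih (fun i => k i.castSucc) fun i => X i.castSucc
    have h := (Fin.sum_univ_castSucc k).symm
    refine ⟨g ▷ _ ≫ tensorμ _ _ _ _ ≫ _ ◁ ((tensSplit fun _ => B).inv ≫
      (tensCast h fun _ => B).inv), fun x b => ?_⟩
    have h₁ := Elt.map_inv_eq _ (map_tensCast_hom h (blockLabel k b))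
    have h₂ := map_tensSplit_inv fun i => blockLabel k b (Fin.cast h i)
    have h₃ : ∀ z, blockLabel k b (Fin.cast h (Fin.castAdd _ z)) =
        blockLabel (fun i => k (Fin.castSucc i)) (fun i => b i.castSucc) z := fun z => by
      obtain ⟨⟨i, j⟩, rfl⟩ := (flat _).surjective z
      rw [flat_castSucc k i j, blockLabel_flat, blockLabel_flat]
    have h₄ : ∀ j, blockLabel k b (Fin.cast h (Fin.natAdd _ j)) = b (Fin.last s) j := fun j => by
      rw [flat_last k j, blockLabel_flat]
    simp only [h₃, h₄] at h₂
    refine (Elt.map_comp _ _ _).trans ?_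
    refine (congrArg _ ((Elt.map_whiskerRight _ _ _).trans (congrArg (· ⋆ _) (hg _ _)))).trans ?_
    refine (Elt.map_comp _ _ _).trans ?_
    refine (congrArg _ (Elt.map_tensorμ _ _ _ _)).trans ?_
    refine (Elt.map_whiskerLeft _ _ _).trans ?_
    refine congrArg (_ ⋆ ·) ?_
    exact (Elt.map_comp _ _ _).trans ((congrArg _ h₂).trans h₁)

/-- The numbering of the inputs of a composite of operations with constants: the constants of the
outer operation, the constants of the inner operations and the free inputs. -/
def constEquiv (k : ℕ) {s : ℕ} (k' n : Fin s → ℕ) :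
    ((Σ _ : Fin k, Fin 1) ⊕ Σ i, Fin (k' i + n i)) ≃ Fin ((k + ∑ i, k' i) + ∑ i, n i) :=
  (Equiv.sumCongr (Equiv.sigmaUnique (Fin k) fun _ => Fin 1)
    ((Equiv.sigmaCongrRight fun _ => finSumFinEquiv.symm).trans
      ((Equiv.sigmaSumDistrib (fun i => Fin (k' i)) fun i => Fin (n i)).trans
        (Equiv.sumCongr (flat k') (flat n))))).trans
    ((Equiv.sumAssoc _ _ _).symm.trans
      ((Equiv.sumCongr finSumFinEquiv (Equiv.refl _)).trans finSumFinEquiv))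

theorem constEquiv_inl (k : ℕ) {s : ℕ} (k' n : Fin s → ℕ) (i : Fin k) (j : Fin 1) :
    constEquiv k k' n (Sum.inl ⟨i, j⟩) =
      finSumFinEquiv (Sum.inl (finSumFinEquiv (Sum.inl i))) := rfl

theorem constEquiv_inr (k : ℕ) {s : ℕ} (k' n : Fin s → ℕ) (i : Fin s) (c : Fin (k' i) ⊕ Fin (n i)) :
    constEquiv k k' n (Sum.inr ⟨i, finSumFinEquiv c⟩) =
      finSumFinEquiv (Sum.map (fun j => finSumFinEquiv (Sum.inr (flat k' ⟨i, j⟩)))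
        (fun j => flat n ⟨i, j⟩) c) := by
  cases c <;> simp [constEquiv]

variable (P) in
/-- The composition of operations with constants is given by a morphism. -/
theorem exists_std_subst (B : C) {s : ℕ} (k : ℕ) (k' n : Fin s → ℕ) :
    ∃ g : (P.obj (k + s) ⊗ tens fun _ : Fin k => B) ⊗
        tens (fun i => P.obj (k' i + n i) ⊗ tens fun _ : Fin (k' i) => B) ⟶
        P.obj ((k + ∑ i, k' i) + ∑ i, n i) ⊗ tens fun _ : Fin (k + ∑ i, k' i) => B,
      ∀ (p : Elt (P.obj (k + s))) (a : Fin k → Elt B) (q : ∀ i, Elt (P.obj (k' i + n i)))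
        (b : ∀ i, Fin (k' i) → Elt B), ∃ (r : Elt (P.obj ((k + ∑ i, k' i) + ∑ i, n i)))
          (c : Fin (k + ∑ i, k' i) → Elt B),
        Elt.map g (p ⋆ tprod a ⋆ tprod fun i => q i ⋆ tprod (b i)) = r ⋆ tprod c ∧
        P.std r c = (P.std p a).subst n fun i => P.std (q i) (b i) := by
  obtain ⟨g, hg⟩ := exists_unzip k' (fun i => P.obj (k' i + n i)) B
  let N : Fin k ⊕ Fin s → ℕ := Sum.elim (fun _ => 1) fun i => k' i + n i
  let E : ((Σ i, Fin (N (Sum.inl i))) ⊕ Σ i, Fin (N (Sum.inr i))) ≃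
    Fin ((k + ∑ i, k' i) + ∑ i, n i) := constEquiv k k' n
  refine ⟨_ ◁ g ≫ tensorμ _ _ _ _ ≫ ((P.obj (k + s) ◁ ((λ_ _).inv ≫
    ((tensUnits k).inv ≫ tensMap fun _ => P.one) ▷ _) ≫ P.compSum N E) ⊗ₘ
      (tensSum fun _ => B).hom), fun p a q b => ?_⟩
  refine ⟨Elt.map (P.compSum N E) (p ⋆ ((tprod fun _ => Elt.map P.one (Elt.unit C)) ⋆ tprod q)),
    fun i => Sum.elim a (blockLabel k' b) (finSumFinEquiv.symm i), ?_, ?_⟩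
  · rw [Elt.map_comp, Elt.map_whiskerLeft, hg, Elt.map_comp, Elt.map_tensorμ, Elt.map_tensorHom]
    refine congrArg₂ Elt.mul ?_ (map_tensSum_hom (X := fun _ => B) (Sum.elim a (blockLabel k' b)))
    refine (Elt.map_comp _ _ _).trans (congrArg (Elt.map _) ?_)
    rw [Elt.map_whiskerLeft, Elt.map_comp, Elt.map_leftUnitor_inv, Elt.map_whiskerRight,
      Elt.map_comp, map_tensUnits_inv, map_tensMap]
    rfl
  · let G : Fin ((k + ∑ i, k' i) + ∑ i, n i) → Elt B ⊕ Fin (∑ i, n i) := fun i => Sum.map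
      (fun i => Sum.elim a (blockLabel k' b) (finSumFinEquiv.symm i)) id (finSumFinEquiv.symm i)
    refine (congrArg (Term.map G)
      (P.op_compSum N E p (fun _ => Elt.map P.one (Elt.unit C)) q)).trans ?_
    rw [SetOperad.map_bind, Term.subst, std_eq_map p a, SetOperad.bind_map]
    refine SetOperad.bind_congr ?_
    rintro (i | i)
    · refine congrArg (P.tm (Elt.map P.one (Elt.unit C))) (funext fun j => ?_)
      exact (congrArg G (constEquiv_inl k k' n i j)).trans (by simp [G])
    · refine congrArg (P.tm (q i)) (funext fun j => ?_)
      obtain ⟨c, rfl⟩ := finSumFinEquiv.surjective j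
      refine (congrArg G (constEquiv_inr k k' n i c)).trans ?_
      refine Eq.trans ?_ (congrArg
        (fun c => Sum.map id (fun j => flat n ⟨i, j⟩) (Sum.map (b i) id c))
        (finSumFinEquiv.symm_apply_apply c).symm)
      cases c <;> simp [G]

end Enveloping

namespace SetOperad

variable {O : SetOperad} {Λ Λ' : Type*}

theorem Term.map_eq_bind (t : O.Term Λ) (f : Λ → Λ') : t.map f = t.bind fun l => Term.pure (f l) :=
  (SetOperad.bind_pure_comp t f).symm

theorem Term.map_congr {t : O.Term Λ} {f g : Λ → Λ'} (h : ∀ l, f l = g l) : t.map f = t.map g := by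
  rw [funext h]

theorem pure_subst {n : ℕ} (u : O.Term (Λ ⊕ Fin n)) :
    (Term.pure (Sum.inr 0) : O.Term (Λ ⊕ Fin 1)).subst (fun _ => n) (fun _ => u) =
      u.map (Sum.map id (oneCompEquiv n)) :=
  SetOperad.pure_bind _ _

theorem subst_pure {n : ℕ} (t : O.Term (Λ ⊕ Fin n)) :
    t.subst (fun _ => 1) (fun _ => Term.pure (Sum.inr 0)) =
      t.map (Sum.map id (compOneEquiv n)) := by
  rw [Term.map_eq_bind]
  refine SetOperad.bind_congr ?_
  rintro (a | i) <;> rfl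

theorem subst_subst {s : ℕ} (n : Fin s → ℕ) (m : Fin (∑ i, n i) → ℕ) (t : O.Term (Λ ⊕ Fin s))
    (u : ∀ i, O.Term (Λ ⊕ Fin (n i))) (w : ∀ x, O.Term (Λ ⊕ Fin (m x))) :
    (t.subst n u).subst m w = (t.subst (fun i => ∑ j, m (flat n ⟨i, j⟩)) fun i =>
      (u i).subst (fun j => m (flat n ⟨i, j⟩)) fun j => w (flat n ⟨i, j⟩)).map
        (Sum.map id (assocEquiv n m)) := by
  simp only [Term.subst, SetOperad.bind_assoc, SetOperad.map_bind]
  refine SetOperad.bind_congr ?_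
  rintro (a | i)
  · exact SetOperad.pure_bind _ _
  simp only [Sum.elim_inr, SetOperad.bind_map, SetOperad.map_bind]
  refine SetOperad.bind_congr ?_
  rintro (a | j)
  · rfl
  simp only [Sum.map_inr, Sum.elim_inr, SetOperad.map_map]
  refine Term.map_congr ?_
  rintro (a | x)
  · rfl
  · exact congrArg Sum.inr (assocEquiv_flat n m i j x).symm

theorem map_subst {s r : ℕ} (σ : Fin s ≃ Fin r) (n : Fin r → ℕ) (t : O.Term (Λ ⊕ Fin s))
    (u : ∀ i, O.Term (Λ ⊕ Fin (n i))) :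
    (t.map (Sum.map id σ)).subst n u =
      (t.subst (fun i => n (σ i)) fun i => u (σ i)).map (Sum.map id (blockEquiv σ n)) := by
  simp only [Term.subst, SetOperad.bind_map, SetOperad.map_bind]
  refine SetOperad.bind_congr ?_
  rintro (a | i)
  · rfl
  simp only [Sum.map_inr, Sum.elim_inr, SetOperad.map_map]
  refine Term.map_congr ?_
  rintro (a | j)
  · rfl
  · exact congrArg Sum.inr (blockEquiv_flat σ n i j).symm

theorem subst_map {s : ℕ} (n n' : Fin s → ℕ) (τ : ∀ i, Fin (n i) ≃ Fin (n' i))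
    (t : O.Term (Λ ⊕ Fin s)) (u : ∀ i, O.Term (Λ ⊕ Fin (n i))) :
    t.subst n' (fun i => (u i).map (Sum.map id (τ i))) =
      (t.subst n u).map (Sum.map id (sumEquiv τ)) := by
  simp only [Term.subst, SetOperad.map_bind]
  refine SetOperad.bind_congr ?_
  rintro (a | i)
  · rfl
  simp only [Sum.elim_inr, SetOperad.map_map]
  refine Term.map_congr ?_
  rintro (a | j)
  · rfl
  · exact congrArg Sum.inr (sumEquiv_flat τ i j).symm

end SetOperad

section Enveloping

variable {C : Type u} [Category.{v} C] [MonoidalCategory C] [SymmetricCategory C]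
  {P : SymOperad C} {A : P.Algebra}

open SetOperad

theorem Step.map {m n : ℕ} (e : Fin m ≃ Fin n) {t t' : P.elts.Term (Elt A.X ⊕ Fin m)}
    (h : Step t t') : Step (t.map (Sum.map id e)) (t'.map (Sum.map id e)) := by
  obtain ⟨k, p, r, rfl, rfl⟩ := h
  have := ((isLinear_std (O := P.elts) p (id : Fin k → Fin k)).map id e).step r
  convert this using 1
  · rw [SetOperad.map_bind, SetOperad.bind_map]
    refine SetOperad.bind_congr ?_
    rintro (i | i)
    · simp only [Sum.elim_inl, SetOperad.map_map, Sum.map_inl, id]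
    · rfl
  · rw [std_eq_map p, SetOperad.map_map, SetOperad.map_map]
    refine Term.map_congr ?_
    rintro (i | i) <;> rfl

theorem isLinear_tm_inr {n : ℕ} (p : Elt (P.obj n)) :
    (P.tm p Sum.inr : P.elts.Term (Elt A.X ⊕ Fin n)).IsLinear :=
  isLinear_tm.mpr fun i => ⟨i, rfl, fun _ h => Sum.inr_injective h⟩

variable (C) in
theorem detecting_unit : Detecting (Set.range fun _ : Unit => Elt.unit C) := by
  refine (detecting_tens (X := fun _ : Fin 0 => 𝟙_ C) fun _ => detecting_univ _).mono ?_
  rintro _ ⟨x, -, rfl⟩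
  exact ⟨⟨⟩, rfl⟩

variable [HasColimits C] (A)

/-- The morphism from the given operad to the enveloping operad. -/
def envη (n : ℕ) : P.obj n ⟶ envObj A n :=
  (ρ_ _).inv ≫ P.act (finCongr (Nat.zero_add n).symm) ▷ 𝟙_ C ≫ envι A n 0

theorem map_envη {n : ℕ} (p : Elt (P.obj n)) :
    Elt.map (envη A n) p = cls A (P.tm p Sum.inr) := by
  refine (Elt.map_comp _ _ _).trans ?_
  refine (congrArg _ (Elt.map_rightUnitor_inv p)).trans ?_
  refine (Elt.map_comp _ _ _).trans ?_
  refine (congrArg _ (Elt.map_whiskerRight _ _ _)).trans ?_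
  refine (cls_std A (n := n) (k := 0) (P.elts.act (finCongr (Nat.zero_add n).symm) p)
    fun i => i.elim0).symm.trans (congrArg (cls A) ?_)
  refine (tm_act (O := P.elts) _ p _).trans (congrArg (P.tm p) (funext fun i => ?_))
  rw [show finCongr (Nat.zero_add n).symm i = finSumFinEquiv (Sum.inr i) from Fin.ext (by simp),
    Equiv.symm_apply_apply]
  rfl

theorem map_envη_one : Elt.map (P.one ≫ envη A 1) (Elt.unit C) =
    cls A (Term.pure (Sum.inr 0)) := by
  rw [Elt.map_comp, map_envη]
  exact congrArg (fun x => cls A (P.tm _ x))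
    (funext fun i => congrArg Sum.inr (Subsingleton.elim i 0))

variable [MonoidalClosed C]

theorem detecting_tens_cls {s : ℕ} (n : Fin s → ℕ) :
    Detecting {z | ∃ t : ∀ i, P.elts.Term (Elt A.X ⊕ Fin (n i)), (∀ i, (t i).IsLinear) ∧
      z = tprod fun i => cls A (t i)} := by
  refine (detecting_tens fun i => detecting_clsSet A (n i)).mono ?_
  rintro _ ⟨x, hx, rfl⟩
  choose t ht hx using hx
  exact ⟨t, ht, congrArg tprod (funext hx)⟩

/-- The version of `exists_desc` without a second variable. -/
theorem exists_desc_one {n : ℕ} {Z : C} (Φ : P.elts.Term (Elt A.X ⊕ Fin n) → Elt Z)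
    (hf : ∀ k, ∃ f : gen A n k ⟶ Z, ∀ (p : Elt (P.obj (k + n))) (a : Fin k → Elt A.X),
      Elt.map f (p ⋆ tprod a) = Φ (P.std p a))
    (hΦ : ∀ t t', Step t t' → Φ t = Φ t') :
    ∃ g : envObj A n ⟶ Z, ∀ t : P.elts.Term (Elt A.X ⊕ Fin n), t.IsLinear →
      Elt.map g (cls A t) = Φ t := by
  obtain ⟨g, hg⟩ := exists_desc A (detecting_unit C) (fun t _ => Φ t) (fun k => by
    obtain ⟨f, hf⟩ := hf k
    refine ⟨(ρ_ _).hom ≫ f, fun p a _ => ?_⟩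
    rw [Elt.map_comp, Elt.map_rightUnitor_hom, hf]) fun t t' h _ => hΦ t t' h
  refine ⟨(ρ_ _).inv ≫ g, fun t ht => ?_⟩
  rw [Elt.map_comp, Elt.map_rightUnitor_inv]
  exact hg t ht ⟨⟩

theorem exists_envAct {m n : ℕ} (e : Fin m ≃ Fin n) :
    ∃ g : envObj A m ⟶ envObj A n, ∀ t : P.elts.Term (Elt A.X ⊕ Fin m), t.IsLinear →
      Elt.map g (cls A t) = cls A (t.map (Sum.map id e)) := by
  refine exists_desc_one A (fun t => cls A (t.map (Sum.map id e))) (fun k => ?_) fun t t' h =>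
    (h.map e).cls_eq
  let e' : Fin (k + m) ≃ Fin (k + n) :=
    finSumFinEquiv.symm.trans ((Equiv.sumCongr (Equiv.refl _) e).trans finSumFinEquiv)
  refine ⟨P.act e' ▷ _ ≫ envι A n k, fun p a => ?_⟩
  rw [Elt.map_comp, Elt.map_whiskerRight]
  refine (cls_std A (n := n) (P.elts.act e' p) a).symm.trans (congrArg (cls A) ?_)
  refine (tm_act (O := P.elts) e' p _).trans (congrArg (P.tm p) (funext fun i => ?_))
  obtain ⟨c, rfl⟩ := finSumFinEquiv.surjective i
  cases c <;> simp [e']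

theorem exists_envComp (s : ℕ) (n : Fin s → ℕ) :
    ∃ g : envObj A s ⊗ tens (fun i => envObj A (n i)) ⟶ envObj A (∑ i, n i),
      ∀ t : P.elts.Term (Elt A.X ⊕ Fin s), t.IsLinear →
        ∀ u : ∀ i, P.elts.Term (Elt A.X ⊕ Fin (n i)), (∀ i, (u i).IsLinear) →
          Elt.map g (cls A t ⋆ tprod fun i => cls A (u i)) = cls A (t.subst n u) := by
  have hd : Detecting (Set.range
      fun u : ∀ i, {u : P.elts.Term (Elt A.X ⊕ Fin (n i)) // u.IsLinear} =>
        tprod fun i => cls A (u i).1) := by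
    refine (detecting_tens_cls A n).mono ?_
    rintro _ ⟨t, ht, rfl⟩
    exact ⟨fun i => ⟨t i, ht i⟩, rfl⟩
  refine (exists_desc A hd (fun t u => cls A (t.subst n fun i => (u i).1)) (fun k => ?_)
    fun t t' h u => (h.subst n fun i => Step.refl (u i).2).cls_eq).imp
      fun g hg t ht u hu => hg t ht fun i => ⟨u i, hu i⟩
  have hd' : Detecting (Set.range fun σ : Elt (P.obj (k + s)) × (Fin k → Elt A.X) =>
      σ.1 ⋆ tprod σ.2) := by
    refine (detecting_genSet A s k).mono ?_
    rintro _ ⟨p, a, rfl⟩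
    exact ⟨(p, a), rfl⟩
  refine (exists_desc_tens A n hd' (fun u σ => cls A ((P.std σ.1 σ.2).subst n u)) (fun k' => ?_)
    fun u u' h σ => ((Step.refl (isLinear_std _ _)).subst n h).cls_eq).imp
      fun g hg p a u => hg _ (fun i => (u i).2) (p, a)
  obtain ⟨g, hg⟩ := exists_std_subst P A.X k k' n
  refine ⟨g ≫ envι A _ _, fun q b σ => ?_⟩
  obtain ⟨r, c, h₁, h₂⟩ := hg σ.1 σ.2 q b
  rw [Elt.map_comp, h₁, ← cls_std, h₂]

/-- The symmetric group actions of the enveloping operad, given by the renaming of variables. -/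
def envAct {m n : ℕ} (e : Fin m ≃ Fin n) : envObj A m ⟶ envObj A n := (exists_envAct A e).choose

/-- The composition of the enveloping operad, given by the substitution of terms. -/
def envComp (s : ℕ) (n : Fin s → ℕ) :
    envObj A s ⊗ tens (fun i => envObj A (n i)) ⟶ envObj A (∑ i, n i) :=
  (exists_envComp A s n).choose

variable {A}

theorem map_envAct {m n : ℕ} (e : Fin m ≃ Fin n) {t : P.elts.Term (Elt A.X ⊕ Fin m)}
    (ht : t.IsLinear) : Elt.map (envAct A e) (cls A t) = cls A (t.map (Sum.map id e)) :=
  (exists_envAct A e).choose_spec t ht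

theorem map_envComp {s : ℕ} {n : Fin s → ℕ} {t : P.elts.Term (Elt A.X ⊕ Fin s)} (ht : t.IsLinear)
    {u : ∀ i, P.elts.Term (Elt A.X ⊕ Fin (n i))} (hu : ∀ i, (u i).IsLinear) :
    Elt.map (envComp A s n) (cls A t ⋆ tprod fun i => cls A (u i)) = cls A (t.subst n u) :=
  (exists_envComp A s n).choose_spec t ht u hu

variable (A) in
/-- The enveloping operad of an algebra. Its operations are represented by linear terms, which are
composed by substitution. -/
def envOperad : SymOperad C where
  obj := envObj A
  act := envAct A
  one := P.one ≫ envη A 1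
  comp := envComp A
  act_refl n := by
    refine (detecting_clsSet A n).eq_of_map_eq ?_
    rintro _ ⟨t, ht, rfl⟩
    rw [map_envAct _ ht, Elt.map_id]
    exact congrArg (cls A) ((Term.map_congr (by rintro (a | i) <;> rfl)).trans (SetOperad.map_id t))
  act_trans e e' := by
    refine (detecting_clsSet A _).eq_of_map_eq ?_
    rintro _ ⟨t, ht, rfl⟩
    rw [Elt.map_comp, map_envAct _ ht, map_envAct _ ht, map_envAct _ (ht.map _ _),
      SetOperad.map_map]
    exact congrArg (cls A) (Term.map_congr (by rintro (a | i) <;> rfl))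
  one_comp n := by
    refine ((detecting_unit C).mul (detecting_tens fun _ => detecting_clsSet A n)).eq_of_map_eq ?_
    rintro _ ⟨_, ⟨_, rfl⟩, _, ⟨x, hx, rfl⟩, rfl⟩
    obtain ⟨u, hu, hx⟩ := hx 0
    obtain rfl : x = fun _ => cls A u := funext fun i => by
      rw [← hx, Subsingleton.elim i 0]
    rw [Elt.map_comp, Elt.map_whiskerRight, map_envη_one]
    refine (map_envComp isLinear_pure fun _ => hu).trans ?_
    rw [Elt.map_comp, Elt.map_leftUnitor_hom, Elt.map_comp, map_tensOne_hom, map_envAct _ hu,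
      pure_subst]
  comp_one n := by
    refine ((detecting_clsSet A n).mul (detecting_tens fun _ => detecting_unit C)).eq_of_map_eq ?_
    rintro _ ⟨_, ⟨t, ht, rfl⟩, _, ⟨x, hx, rfl⟩, rfl⟩
    obtain rfl : x = fun _ => Elt.unit C := funext fun i => (hx i).choose_spec.symm
    rw [Elt.map_comp, Elt.map_whiskerLeft, map_tensMap, map_envη_one]
    refine (map_envComp ht fun _ => isLinear_pure).trans ?_
    rw [Elt.map_comp, Elt.map_whiskerLeft, map_tensUnits_hom, Elt.map_comp,
      Elt.map_rightUnitor_hom, map_envAct _ ht, subst_pure]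
  comp_assoc s n m := by
    refine (((detecting_clsSet A s).mul (detecting_tens_cls A n)).mul
      (detecting_tens_cls A m)).eq_of_map_eq ?_
    rintro _ ⟨_, ⟨_, ⟨t, ht, rfl⟩, _, ⟨u, hu, rfl⟩, rfl⟩, _, ⟨w, hw, rfl⟩, rfl⟩
    rw [Elt.map_comp, Elt.map_whiskerRight, map_envComp ht hu, map_envComp (ht.subst hu) hw,
      Elt.map_comp, Elt.map_associator_hom, Elt.map_comp, Elt.map_whiskerLeft, Elt.map_comp]
    have h : ∀ i, ((u i).subst (fun j => m (flat n ⟨i, j⟩)) fun j => w (flat n ⟨i, j⟩)).IsLinear :=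
      fun i => (hu i).subst fun j => hw _
    have h' := map_blockMap n (fun i => envComp A (n i) fun j => m (flat n ⟨i, j⟩))
      (fun i => cls A (u i)) fun x => cls A (w x)
    simp only [fun i => map_envComp (hu i) fun j => hw (flat n ⟨i, j⟩)] at h'
    refine Eq.trans ?_ (congrArg (fun z => Elt.map _ (Elt.map _ (cls A t ⋆ z))) h').symm
    rw [map_envComp ht h, map_envAct _ (ht.subst h), subst_subst]
  act_comp σ n := by
    refine ((detecting_clsSet A _).mul (detecting_tens_cls A n)).eq_of_map_eq ?_
    rintro _ ⟨_, ⟨t, ht, rfl⟩, _, ⟨u, hu, rfl⟩, rfl⟩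
    rw [Elt.map_comp, Elt.map_whiskerRight, map_envAct _ ht, map_envComp (ht.map _ _) hu,
      Elt.map_comp, Elt.map_whiskerLeft, map_tensPerm_hom, Elt.map_comp,
      map_envComp ht fun i => hu (σ i), map_envAct _ (ht.subst fun i => hu (σ i)), map_subst]
  comp_act n n' τ := by
    refine ((detecting_clsSet A _).mul (detecting_tens_cls A n)).eq_of_map_eq ?_
    rintro _ ⟨_, ⟨t, ht, rfl⟩, _, ⟨u, hu, rfl⟩, rfl⟩
    rw [Elt.map_comp, Elt.map_whiskerLeft, map_tensMap, Elt.map_comp, map_envComp ht hu,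
      map_envAct _ (ht.subst hu)]
    simp only [fun i => map_envAct (τ i) (hu i)]
    rw [map_envComp ht fun i => (hu i).map _ _, subst_map]

end Enveloping

/-! ### The universal property -/

section Enveloping

variable {C : Type u} [Category.{v} C] [MonoidalCategory C] [SymmetricCategory C]

open SetOperad

/-- The number of inputs which remain after plugging constants into the first `k` inputs. -/
abbrev plugArity (k n : ℕ) : Fin k ⊕ Fin n → ℕ := Sum.elim (fun _ => 0) fun _ => 1

/-- The numbering of the inputs which remain after plugging constants into the first `k` inputs. -/
def plugEquiv (k n : ℕ) : ((Σ i, Fin (plugArity k n (Sum.inl i))) ⊕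
    Σ i, Fin (plugArity k n (Sum.inr i))) ≃ Fin n :=
  haveI : IsEmpty (Σ i, Fin (plugArity k n (Sum.inl i))) := ⟨fun x => x.2.elim0⟩
  (Equiv.emptySum _ _).trans (Equiv.sigmaUnique (Fin n) fun _ => Fin 1)

/-- The operation of plugging constants into the first `k` inputs. -/
def SymOperad.plug (Q : SymOperad C) (k n : ℕ) :
    Q.obj (k + n) ⊗ tens (fun _ : Fin k => Q.obj 0) ⟶ Q.obj n :=
  Q.obj (k + n) ◁ ((ρ_ _).inv ≫
      tens (fun _ : Fin k => Q.obj 0) ◁ ((tensUnits n).inv ≫ tensMap fun _ => Q.one)) ≫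
    Q.compSum (plugArity k n) (plugEquiv k n)

theorem SymOperad.map_plug (Q : SymOperad C) {k n : ℕ} (p : Elt (Q.obj (k + n)))
    (b : Fin k → Elt (Q.obj 0)) :
    Elt.map (Q.plug k n) (p ⋆ tprod b) = Elt.map (Q.compSum (plugArity k n) (plugEquiv k n))
      (p ⋆ (tprod b ⋆ tprod fun _ : Fin n => Elt.map Q.one (Elt.unit C))) := by
  refine (Elt.map_comp _ _ _).trans ?_
  refine congrArg (Elt.map _) ?_
  rw [Elt.map_whiskerLeft, Elt.map_comp, Elt.map_rightUnitor_inv, Elt.map_whiskerLeft,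
    Elt.map_comp, map_tensUnits_inv, map_tensMap]
  rfl

/-- A constant, as a term. -/
def SymOperad.const (Q : SymOperad C) {Λ : Type*} (b : Elt (Q.obj 0)) : Q.elts.Term Λ :=
  Q.tm b fun i => i.elim0

theorem SymOperad.const_eq (Q : SymOperad C) {Λ : Type*} (b : Elt (Q.obj 0)) (x : Fin 0 → Λ) :
    Q.tm b x = Q.const b :=
  congrArg (Q.tm b) (Subsingleton.elim _ _)

theorem SymOperad.op_plug (Q : SymOperad C) {k n : ℕ} (p : Elt (Q.obj (k + n)))
    (b : Fin k → Elt (Q.obj 0)) :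
    Q.op (Elt.map (Q.plug k n) (p ⋆ tprod b)) =
      (Q.std p b).bind (Sum.elim Q.const Term.pure) := by
  rw [Q.map_plug]
  refine (Q.op_compSum (plugArity k n) (plugEquiv k n) p b
    fun _ => Elt.map Q.one (Elt.unit C)).trans ?_
  rw [std_eq_map p b, SetOperad.bind_map]
  refine SetOperad.bind_congr ?_
  rintro (i | i)
  · exact Q.const_eq _ _
  · rfl

theorem SymOperad.exists_tm {Q : SymOperad C} {Λ : Type*} (t : Q.elts.Term Λ) :
    ∃ (n : ℕ) (p : Elt (Q.obj n)) (x : Fin n → Λ), t = Q.tm p x := t.exists_rep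

theorem SymOperad.exists_std {Q : SymOperad C} {Λ : Type*} {n : ℕ} {t : Q.elts.Term (Λ ⊕ Fin n)}
    (ht : t.IsLinear) : ∃ (k : ℕ) (p : Elt (Q.obj (k + n))) (a : Fin k → Λ), t = Q.std p a :=
  ht.exists_std

variable {P : SymOperad C} {A : P.Algebra}

/-- The interpretation of a term with constants in `A` in an operad `Q` under `P`, given a map from
`A` to the constants of `Q`. -/
def interp {Q : SymOperad C} (φ : P.Hom Q) (ψ : A.X ⟶ Q.obj 0) {n : ℕ}
    (t : P.elts.Term (Elt A.X ⊕ Fin n)) : Q.elts.Term (Fin n) :=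
  (t.mapOp φ.elts).bind (Sum.elim (fun a => Q.const (Elt.map ψ a)) Term.pure)

section Interp

variable {Q : SymOperad C} (φ : P.Hom Q) (ψ : A.X ⟶ Q.obj 0)

theorem interp_pure_inl {n : ℕ} (a : Elt A.X) :
    interp φ ψ (Term.pure (Sum.inl a) : P.elts.Term (Elt A.X ⊕ Fin n)) =
      Q.const (Elt.map ψ a) := by
  rw [interp, SetOperad.mapOp_pure, SetOperad.pure_bind, Sum.elim_inl]

theorem interp_pure_inr {n : ℕ} (i : Fin n) :
    interp φ ψ (Term.pure (Sum.inr i) : P.elts.Term (Elt A.X ⊕ Fin n)) = Term.pure i := by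
  rw [interp, SetOperad.mapOp_pure, SetOperad.pure_bind, Sum.elim_inr]

theorem interp_tm_inr {n : ℕ} (p : Elt (P.obj n)) :
    interp φ ψ (P.tm p Sum.inr : P.elts.Term (Elt A.X ⊕ Fin n)) = Q.op (Elt.map (φ.app n) p) :=
  (SetOperad.bind_map (Q.op (Elt.map (φ.app n) p)) Sum.inr _).trans (SetOperad.bind_pure _)

theorem SymOperad.const_map {Λ Λ' : Type*} (b : Elt (Q.obj 0)) (f : Λ → Λ') :
    (Q.const b : Q.elts.Term Λ).map f = Q.const b :=
  Q.const_eq b _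

theorem SymOperad.const_bind {Λ Λ' : Type*} (b : Elt (Q.obj 0)) (f : Λ → Q.elts.Term Λ') :
    (Q.const b : Q.elts.Term Λ).bind f = Q.const b := by
  have h : (Q.const b : Q.elts.Term Λ) = (Q.const b : Q.elts.Term Empty).map Empty.elim :=
    (Q.const_map b _).symm
  rw [h, SetOperad.bind_map]
  refine Eq.trans ?_ ((SetOperad.bind_pure_comp _ Empty.elim).trans (Q.const_map b _))
  exact SetOperad.bind_congr fun l => l.elim

theorem interp_map {m n : ℕ} (e : Fin m → Fin n) (t : P.elts.Term (Elt A.X ⊕ Fin m)) :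
    interp φ ψ (t.map (Sum.map id e)) = (interp φ ψ t).map e := by
  rw [interp, interp, SetOperad.mapOp_map, SetOperad.bind_map, SetOperad.map_bind]
  refine SetOperad.bind_congr ?_
  rintro (a | i)
  · exact (SymOperad.const_map _ _).symm
  · rfl

theorem interp_subst {s : ℕ} (n : Fin s → ℕ) (t : P.elts.Term (Elt A.X ⊕ Fin s))
    (u : ∀ i, P.elts.Term (Elt A.X ⊕ Fin (n i))) :
    interp φ ψ (t.subst n u) =
      (interp φ ψ t).bind fun i => (interp φ ψ (u i)).map fun j => flat n ⟨i, j⟩ := by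
  rw [interp, interp, Term.subst, SetOperad.mapOp_bind, SetOperad.bind_assoc, SetOperad.bind_assoc]
  refine SetOperad.bind_congr ?_
  rintro (a | i)
  · simp only [Sum.elim_inl, SetOperad.mapOp_pure, SetOperad.pure_bind]
    exact (SymOperad.const_bind _ _).symm
  · rw [Sum.elim_inr, Sum.elim_inr, SetOperad.pure_bind, ← interp_map]
    exact congrArg (interp φ ψ) (Term.map_congr (by rintro (a | i) <;> rfl))

/-- On terms in standard form, the interpretation is given by a morphism. -/
theorem interp_std {n k : ℕ} (p : Elt (P.obj (k + n))) (a : Fin k → Elt A.X) :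
    interp φ ψ (P.std p a) = Q.op (Elt.map ((φ.app _ ⊗ₘ tensMap fun _ => ψ) ≫ Q.plug k n)
      (p ⋆ tprod a)) := by
  rw [Elt.map_comp, Elt.map_tensorHom, map_tensMap, Q.op_plug, interp]
  rw [std_eq_map p a, SetOperad.mapOp_map, SetOperad.bind_map,
    std_eq_map (P := Q) (Elt.map (φ.app (k + n)) p), SetOperad.bind_map]
  refine SetOperad.bind_congr ?_
  rintro (i | i) <;> rfl

/-- The value in `A` of a term is sent to the interpretation of the term, since the map from `A` to
the constants of `Q` is a morphism of algebras. -/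
theorem const_eval (ψ : A.Hom (Q.zeroAlgebra.restrict φ)) {Λ : Type*}
    (r : P.elts.Term (Elt A.X)) : (Q.const (Elt.map ψ.hom (A.elts.eval r)) : Q.elts.Term Λ) =
      (r.mapOp φ.elts).bind fun a => Q.const (Elt.map ψ.hom a) := by
  obtain ⟨n, q, b, rfl⟩ := SymOperad.exists_tm r
  have h : Elt.map ψ.hom (A.elts.eval (P.tm q b)) = Elt.map (Q.act (finCongr (by simp)))
      (Elt.map (Q.comp n fun _ => 0)
        (Elt.map (φ.app n) q ⋆ tprod fun i => Elt.map ψ.hom (b i))) := by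
    refine (Elt.map_comp _ _ _).symm.trans ((Elt.congr_map (ψ.smul_hom n) (q ⋆ tprod b)).trans ?_)
    refine (Elt.map_comp _ _ _).trans ?_
    rw [Elt.map_whiskerLeft, map_tensMap]
    refine (Elt.map_comp _ _ _).trans ?_
    refine (congrArg _ (Elt.map_whiskerRight _ _ _)).trans ?_
    exact Elt.map_comp _ _ _
  refine (congrArg Q.const h).trans ?_
  refine (tm_act (O := Q.elts) _ _ _).trans ?_
  refine (tm_comp (O := Q.elts) (fun _ => 0) _ _ _).trans ?_
  refine Eq.trans ?_ (SetOperad.bind_map (Q.op (Elt.map (φ.app n) q)) b _).symm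
  exact SetOperad.bind_congr fun i => Q.const_eq _ _

theorem Step.interp_eq (ψ : A.Hom (Q.zeroAlgebra.restrict φ)) {n : ℕ}
    {t t' : P.elts.Term (Elt A.X ⊕ Fin n)} (h : Step t t') :
    interp φ ψ.hom t = interp φ ψ.hom t' := by
  obtain ⟨k, p, r, rfl, rfl⟩ := h
  rw [std_eq_map p fun i => A.elts.eval (r i)]
  unfold interp
  rw [SetOperad.mapOp_map, SetOperad.mapOp_bind, SetOperad.bind_map, SetOperad.bind_assoc]
  refine SetOperad.bind_congr ?_
  rintro (i | i)
  · simp only [Sum.elim_inl, Sum.map_inl, SetOperad.mapOp_map, SetOperad.bind_map]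
    exact (const_eval φ ψ (r i)).symm
  · simp only [Sum.elim_inr, Sum.map_inr, SetOperad.mapOp_pure, SetOperad.pure_bind, id]

end Interp

variable (A) in
theorem isLinear_pure_inl (a : Elt A.X) :
    (Term.pure (Sum.inl a) : P.elts.Term (Elt A.X ⊕ Fin 0)).IsLinear :=
  isLinear_tm.mpr fun i => i.elim0

variable [HasColimits C]

variable (A) in
/-- The morphism from a `P`-algebra to the constants of its enveloping operad. -/
def envConst : A.X ⟶ envObj A 0 :=
  (λ_ _).inv ≫ (P.one ⊗ₘ (tensOne fun _ => A.X).inv) ≫ envι A 0 1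

variable (A) in
theorem map_envConst (a : Elt A.X) :
    Elt.map (envConst A) a = cls A (Term.pure (Sum.inl a)) := by
  rw [envConst, Elt.map_comp, Elt.map_leftUnitor_inv]
  refine (Elt.map_comp _ _ _).trans ?_
  refine (congrArg _ (Elt.map_tensorHom _ _ _ _)).trans ?_
  rw [map_tensOne_inv]
  refine (cls_std A (n := 0) (k := 1) (Elt.map P.one (Elt.unit C)) fun _ => a).symm.trans ?_
  refine congrArg (fun x => cls A (P.tm (Elt.map P.one (Elt.unit C)) x)) (funext fun i => ?_)
  obtain ⟨c | c, rfl⟩ := finSumFinEquiv.surjective i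
  · rw [Equiv.symm_apply_apply]
    rfl
  · exact c.elim0

variable [MonoidalClosed C]

variable (A) in
/-- The morphism from `P` to the enveloping operad of a `P`-algebra. -/
def envHom : P.Hom (envOperad A) where
  app := envη A
  act_app {m n} e := by
    change P.act e ≫ envη A n = envη A m ≫ envAct A e
    refine (detecting_univ _).eq_of_map_eq fun p _ => ?_
    rw [Elt.map_comp, Elt.map_comp, map_envη, map_envη]
    refine Eq.trans ?_ (map_envAct e (isLinear_tm_inr p)).symm
    exact congrArg (cls A) (tm_act (O := P.elts) e p _)
  one_app := rfl
  comp_app s n := by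
    change P.comp s n ≫ envη A _ = (envη A s ⊗ₘ tensMap fun i => envη A (n i)) ≫ envComp A s n
    refine ((detecting_univ _).mul (detecting_tens fun _ => detecting_univ _)).eq_of_map_eq ?_
    rintro _ ⟨p, -, _, ⟨q, -, rfl⟩, rfl⟩
    rw [Elt.map_comp, Elt.map_comp, map_envη, Elt.map_tensorHom, map_envη, map_tensMap]
    simp only [map_envη]
    refine Eq.trans ?_ (map_envComp (isLinear_tm_inr p) fun i => isLinear_tm_inr (q i)).symm
    refine congrArg (cls A) ((tm_comp (O := P.elts) n p q _).trans ?_)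
    refine Eq.trans ?_ (SetOperad.bind_map (P.op p) Sum.inr _).symm
    rfl

variable (A) in
/-- The morphism of algebras from a `P`-algebra to the constants of its enveloping operad. -/
def envConstHom : A.Hom ((envOperad A).zeroAlgebra.restrict (envHom A)) where
  hom := envConst A
  smul_hom n := by
    change A.smul n ≫ envConst A = P.obj n ◁ tensMap (fun _ => envConst A) ≫
      envη A n ▷ tens (fun _ => envObj A 0) ≫ envComp A n (fun _ => 0) ≫
        envAct A (finCongr (by simp))
    refine ((detecting_univ _).mul (detecting_tens fun _ => detecting_univ _)).eq_of_map_eq ?_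
    rintro _ ⟨p, -, _, ⟨a, -, rfl⟩, rfl⟩
    rw [Elt.map_comp, map_envConst, Elt.map_comp, Elt.map_whiskerLeft, map_tensMap]
    simp only [map_envConst]
    rw [Elt.map_comp, Elt.map_whiskerRight, map_envη, Elt.map_comp, map_envComp (isLinear_tm_inr p)
      fun i => isLinear_pure_inl A (a i), map_envAct _ ((isLinear_tm_inr p).subst
      fun i => isLinear_pure_inl A (a i))]
    have h : (Term.pure (Sum.inl ()) : P.elts.Term (Unit ⊕ Fin 0)).IsLinear :=
      isLinear_tm.mpr fun i => i.elim0
    have := (h.step fun _ => P.tm p a).cls_eq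
    rw [SetOperad.pure_bind] at this
    refine this.symm.trans (congrArg (cls A) ?_)
    rw [Term.subst, SetOperad.map_bind]
    refine Eq.trans ?_ (SetOperad.bind_map (P.op p) Sum.inr _).symm
    exact (SetOperad.bind_pure_comp (P.op p) fun i => Sum.inl (a i)).symm

/-- The operation which is represented by a term is the interpretation of this term in the
enveloping operad. Since interpretations are preserved by morphisms of operads, this gives the
uniqueness in the universal property. -/
theorem op_cls {n : ℕ} {t : P.elts.Term (Elt A.X ⊕ Fin n)} (ht : t.IsLinear) :
    (envOperad A).op (cls A t) = interp (envHom A) (envConst A) t := by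
  obtain ⟨k, p, a, rfl⟩ := SymOperad.exists_std ht
  let N := plugArity k n
  let x : ∀ c, P.elts.Term (Elt A.X ⊕ Fin (N c)) :=
    Sum.rec (fun i => Term.pure (Sum.inl (a i))) fun _ => Term.pure (Sum.inr (0 : Fin 1))
  have hx : ∀ c, (x c).IsLinear :=
    Sum.rec (fun i => isLinear_pure_inl A (a i)) fun _ => isLinear_pure (O := P.elts)
  have h₁ : Elt.map ((envOperad A).compSum N (plugEquiv k n)) (cls A (P.tm p Sum.inr) ⋆
      ((tprod fun i => cls A (x (Sum.inl i))) ⋆ tprod fun i => cls A (x (Sum.inr i)))) =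
      cls A (P.std p a) := by
    refine (Elt.map_comp _ _ _).trans ?_
    refine (congrArg _ ((Elt.map_whiskerLeft _ _ _).trans
      (congrArg (_ ⋆ ·) (map_tensSum_hom fun c => cls A (x c))))).trans ?_
    refine (Elt.map_comp _ _ _).trans ?_
    refine (congrArg _
      (map_envComp (isLinear_tm_inr p) fun i => hx (finSumFinEquiv.symm i))).trans ?_
    refine (map_envAct _ ((isLinear_tm_inr p).subst fun i => hx (finSumFinEquiv.symm i))).trans ?_
    refine congrArg (cls A) ?_
    rw [Term.subst, SetOperad.map_bind]
    refine (SetOperad.bind_map (P.op p) Sum.inr _).trans ?_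
    refine Eq.trans ?_ (SetOperad.bind_pure_comp (P.op p)
      fun i => Sum.map a id (finSumFinEquiv.symm i))
    refine SetOperad.bind_congr fun i => ?_
    rw [Sum.elim_inr, SetOperad.map_map]
    have : ∀ j, sumPatternEquiv N (flat (fun i : Fin (k + n) => N (finSumFinEquiv.symm i)) ⟨i, j⟩) =
        Equiv.sumSigmaDistrib (fun c => Fin (N c)) ⟨finSumFinEquiv.symm i, j⟩ :=
      sumPatternEquiv_flat N i
    refine (Term.map_congr (g := Sum.map id fun j =>
      plugEquiv k n (Equiv.sumSigmaDistrib (fun c => Fin (N c)) ⟨finSumFinEquiv.symm i, j⟩))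
      (Sum.rec (fun _ => rfl)
        fun j => congrArg (fun z => Sum.inr (plugEquiv k n z)) (this j))).trans ?_
    generalize finSumFinEquiv.symm i = c
    rcases c with i | i <;> rfl
  refine (congrArg (envOperad A).op h₁.symm).trans (Eq.trans ?_ (interp_std _ _ p a).symm)
  refine congrArg (envOperad A).op (Eq.symm ?_)
  refine (Elt.map_comp _ _ _).trans ?_
  refine (congrArg _ ((Elt.map_tensorHom _ _ _ _).trans (congrArg₂ Elt.mul (map_envη A p)
    ((map_tensMap _ _).trans (congrArg tprod (funext fun i => map_envConst A (a i))))))).trans ?_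
  refine ((envOperad A).map_plug _ _).trans ?_
  exact congrArg (fun z => Elt.map _ (_ ⋆ (_ ⋆ tprod fun _ => z))) (map_envη_one A)

end Enveloping

section Enveloping

variable {C : Type u} [Category.{v} C] [MonoidalCategory C] [SymmetricCategory C]
  {P : SymOperad C} {A : P.Algebra}

open SetOperad

theorem SymOperad.Hom.mapOp_comp {Q R : SymOperad C} (φ : P.Hom Q) (θ : Q.Hom R) {Λ : Type*}
    (t : P.elts.Term Λ) : (t.mapOp φ.elts).mapOp θ.elts = t.mapOp (φ.comp θ).elts := by
  obtain ⟨n, p, x, rfl⟩ := SymOperad.exists_tm t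
  exact congrArg (fun p => R.tm p x) (Elt.map_comp _ _ p).symm

theorem SymOperad.Hom.mapOp_op {Q R : SymOperad C} (θ : Q.Hom R) {n : ℕ} (q : Elt (Q.obj n)) :
    (Q.op q).mapOp θ.elts = R.op (Elt.map (θ.app n) q) :=
  rfl

/-- Interpretations are preserved by morphisms of operads. -/
theorem mapOp_interp {Q R : SymOperad C} (φ : P.Hom Q) (ψ : A.X ⟶ Q.obj 0) (θ : Q.Hom R) {n : ℕ}
    (t : P.elts.Term (Elt A.X ⊕ Fin n)) :
    (interp φ ψ t).mapOp θ.elts = interp (φ.comp θ) (ψ ≫ θ.app 0) t := by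
  rw [interp, interp, SetOperad.mapOp_bind, φ.mapOp_comp]
  refine SetOperad.bind_congr ?_
  rintro (a | i)
  · exact congrArg R.const (Elt.map_comp _ _ _).symm
  · exact SetOperad.mapOp_pure _ _

/-- Elements of an operad which agree as terms are equal. -/
theorem op_injective {Q : SymOperad C} {n : ℕ} {q q' : Elt (Q.obj n)} (h : Q.op q = Q.op q') :
    q = q' := SetOperad.opTerm_injective h

variable [HasColimits C] [MonoidalClosed C]

section

variable {Q : SymOperad C} (φ : P.Hom Q) (ψ : A.X ⟶ Q.obj 0)

/-- The interpretation in `Q` is invariant under the replacement of constants by terms. -/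
def InterpRespectsStep : Prop :=
  ∀ ⦃n : ℕ⦄ ⦃t t' : P.elts.Term (Elt A.X ⊕ Fin n)⦄, Step t t' → interp φ ψ t = interp φ ψ t'

theorem exists_envDesc (hψ : InterpRespectsStep φ ψ) (n : ℕ) : ∃ g : envObj A n ⟶ Q.obj n,
    ∀ t : P.elts.Term (Elt A.X ⊕ Fin n), t.IsLinear →
      Q.op (Elt.map g (cls A t)) = interp φ ψ t := by
  have : Nonempty (Elt (Q.obj n)) := ⟨(none : Option _)⟩
  -- the value of the morphism on elements is recovered from the interpretation, since `Q.op` is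
  -- injective
  have hΦ := Function.leftInverse_invFun (f := Q.op (n := n)) fun _ _ => op_injective
  have hf : ∀ {k : ℕ} (p : Elt (P.obj (k + n))) (a : Fin k → Elt A.X), Elt.map
      ((φ.app _ ⊗ₘ tensMap fun _ => ψ) ≫ Q.plug k n) (p ⋆ tprod a) =
        Function.invFun Q.op (interp φ ψ (P.std p a)) :=
    fun p a => (hΦ _).symm.trans (congrArg _ (interp_std φ ψ p a).symm)
  obtain ⟨g, hg⟩ := exists_desc_one A (fun t => Function.invFun Q.op (interp φ ψ t))
    (fun k => ⟨_, hf⟩) fun t t' h => by rw [hψ h]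
  refine ⟨g, fun t ht => ?_⟩
  rw [hg t ht]
  obtain ⟨k, p, a, rfl⟩ := SymOperad.exists_std ht
  rw [← hf, interp_std]

/-- The morphism out of the enveloping operad given by its universal property. -/
def envDesc (hψ : InterpRespectsStep φ ψ) : (envOperad A).Hom Q where
  app n := (exists_envDesc φ ψ hψ n).choose
  act_app {m n} e := by
    change envAct A e ≫ (exists_envDesc φ ψ hψ n).choose =
      (exists_envDesc φ ψ hψ m).choose ≫ Q.act e
    refine (detecting_clsSet A m).eq_of_map_eq ?_
    rintro _ ⟨t, ht, rfl⟩
    rw [Elt.map_comp, Elt.map_comp]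
    refine op_injective ?_
    refine (congrArg (fun z => Q.op (Elt.map _ z)) (map_envAct e ht)).trans ?_
    refine ((exists_envDesc φ ψ hψ n).choose_spec _ (ht.map _ _)).trans ?_
    rw [interp_map, ← (exists_envDesc φ ψ hψ m).choose_spec t ht]
    exact (SetOperad.opTerm_act (O := Q.elts) e _).symm
  one_app := by
    change (P.one ≫ envη A 1) ≫ (exists_envDesc φ ψ hψ 1).choose = Q.one
    refine (detecting_unit C).eq_of_map_eq ?_
    rintro _ ⟨_, rfl⟩
    rw [Elt.map_comp]
    refine op_injective ?_
    refine (congrArg (fun z => Q.op (Elt.map _ z)) (map_envη_one A)).trans ?_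
    refine ((exists_envDesc φ ψ hψ 1).choose_spec _ isLinear_pure).trans ?_
    rw [interp_pure_inr]
    exact (SetOperad.opTerm_one (O := Q.elts)).symm
  comp_app s n := by
    change envComp A s n ≫ (exists_envDesc φ ψ hψ _).choose =
      ((exists_envDesc φ ψ hψ s).choose ⊗ₘ
        tensMap fun i => (exists_envDesc φ ψ hψ (n i)).choose) ≫ Q.comp s n
    refine ((detecting_clsSet A s).mul (detecting_tens_cls A n)).eq_of_map_eq ?_
    rintro _ ⟨_, ⟨t, ht, rfl⟩, _, ⟨u, hu, rfl⟩, rfl⟩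
    rw [Elt.map_comp, Elt.map_comp]
    refine op_injective ?_
    refine (congrArg (fun z => Q.op (Elt.map _ z)) (map_envComp ht hu)).trans ?_
    refine ((exists_envDesc φ ψ hψ _).choose_spec _ (ht.subst hu)).trans ?_
    refine Eq.trans ?_ (congrArg (fun z => Q.op (Elt.map (Q.comp s n) z))
      ((Elt.map_tensorHom _ _ _ _).trans (congrArg (Elt.mul _) (map_tensMap _ _)))).symm
    refine Eq.trans ?_ (SetOperad.opTerm_comp (O := Q.elts) n _ _).symm
    rw [interp_subst, ← (exists_envDesc φ ψ hψ s).choose_spec t ht]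
    refine SetOperad.bind_congr fun i => ?_
    rw [← (exists_envDesc φ ψ hψ (n i)).choose_spec (u i) (hu i)]

/-- The morphism out of the enveloping operad sends the class of a term to its interpretation. -/
theorem op_map_envDesc (hψ : InterpRespectsStep φ ψ) {n : ℕ} {t : P.elts.Term (Elt A.X ⊕ Fin n)}
    (ht : t.IsLinear) :
    Q.op (Elt.map ((envDesc φ ψ hψ).app n) (cls A t)) = interp φ ψ t :=
  (exists_envDesc φ ψ hψ n).choose_spec t ht

end

variable (A) in
/-- The enveloping operad with its universal property. -/
def envelopingOperad : EnvelopingOperad A where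
  operad := envOperad A
  η := envHom A
  ηAlg := envConstHom A
  existsUnique_hom Q φ ψ := by
    have hψ : InterpRespectsStep φ ψ.hom := fun _ _ _ h => h.interp_eq φ ψ
    refine ⟨envDesc φ ψ.hom hψ, ⟨?_, ?_⟩, ?_⟩
    · refine SymOperad.Hom.ext (funext fun n => ?_)
      refine (detecting_univ _).eq_of_map_eq fun p _ => op_injective ?_
      refine (congrArg Q.op (Elt.map_comp _ _ p)).trans ?_
      refine (congrArg (fun z => Q.op (Elt.map _ z)) (map_envη A p)).trans ?_
      exact (op_map_envDesc φ ψ.hom hψ (isLinear_tm_inr p)).trans (interp_tm_inr φ ψ.hom p)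
    · refine (detecting_univ _).eq_of_map_eq fun a _ => op_injective ?_
      refine (congrArg Q.op (Elt.map_comp _ _ a)).trans ?_
      refine (congrArg (fun z => Q.op (Elt.map _ z)) (map_envConst A a)).trans ?_
      refine (op_map_envDesc φ ψ.hom hψ (isLinear_pure_inl A a)).trans ?_
      exact (interp_pure_inl φ ψ.hom a).trans (Q.const_eq _ _).symm
    · rintro θ ⟨h₁, h₂⟩
      refine SymOperad.Hom.ext (funext fun n => ?_)
      refine (detecting_clsSet A n).eq_of_map_eq ?_
      rintro _ ⟨t, ht, rfl⟩
      refine op_injective ((θ.mapOp_op _).symm.trans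
        (Eq.trans ?_ (op_map_envDesc φ ψ.hom hψ ht).symm))
      refine (congrArg (Term.mapOp θ.elts) (op_cls ht)).trans ((mapOp_interp _ _ θ t).trans ?_)
      exact congrArg₂ (fun φ ψ => interp φ ψ t) h₁ h₂

end Enveloping

/-! ### Modules in terms of elements -/

section Modules

variable {C : Type u} [Category.{v} C] [MonoidalCategory C]

open SetOperad

theorem Elt.map_eqToHom_trans {X Y Z : C} (h : X = Y) (h' : Y = Z) (x : Elt X) :
    Elt.map (eqToHom h') (Elt.map (eqToHom h) x) = Elt.map (eqToHom (h.trans h')) x := by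
  rw [← Elt.map_comp, eqToHom_trans]

/-- The family of elements with the element `m` of `M` at the index `k` and the elements `a i` of
`A` at the other indices; the value of `a` at `k` is not used. -/
def markElt {A M : C} {n : ℕ} (k : Fin n) (a : Fin n → Elt A) (m : Elt M) (i : Fin n) :
    Elt (mark A M k i) :=
  if h : i = k then Elt.map (eqToHom (by rw [h, mark_self])) m
  else Elt.map (eqToHom (mark_of_ne A M h).symm) (a i)

section

variable {A M : C} {n : ℕ} {k : Fin n} {a : Fin n → Elt A} {m : Elt M}

theorem markElt_self {i : Fin n} (h : i = k) (h' : M = mark A M k i) :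
    markElt k a m i = Elt.map (eqToHom h') m := dif_pos h

theorem markElt_of_ne {i : Fin n} (h : i ≠ k) :
    markElt k a m i = Elt.map (eqToHom (mark_of_ne A M h).symm) (a i) := dif_neg h

theorem markElt_congr {a' : Fin n → Elt A} (h : ∀ i, i ≠ k → a i = a' i) :
    markElt (M := M) k a m = markElt k a' m := by
  funext i
  by_cases hi : i = k
  · rw [markElt_self hi (by rw [hi, mark_self]), markElt_self hi]
  · rw [markElt_of_ne hi, markElt_of_ne hi, h i hi]

theorem exists_markElt (z : ∀ i, Elt (mark A M k i)) :
    ∃ (a : Fin n → Elt A) (m : Elt M), z = markElt k a m := by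
  have h : ∀ i, ∃ a : Elt A,
      ∀ h : i ≠ k, Elt.map (eqToHom (mark_of_ne A M h)) (z i) = a := fun i => by
    by_cases h : i = k
    · exact ⟨(none : Option _), fun h' => absurd h h'⟩
    · exact ⟨Elt.map (eqToHom (mark_of_ne A M h)) (z i), fun _ => rfl⟩
  choose a ha using h
  refine ⟨a, Elt.map (eqToHom (mark_self A M k)) (z k), funext fun i => ?_⟩
  by_cases h : i = k
  · subst h
    rw [markElt_self rfl (mark_self A M i).symm, Elt.map_eqToHom_trans]
    exact (Elt.map_id _).symm
  · rw [markElt_of_ne h, ← ha i h, Elt.map_eqToHom_trans]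
    exact (Elt.map_id _).symm

theorem map_markMap {N : C} (f : M ⟶ N) (i : Fin n) :
    Elt.map (markMap A f k i) (markElt k a m i) = markElt k a (Elt.map f m) i := by
  by_cases h : i = k
  · subst h
    rw [markElt_self rfl (mark_self A M i).symm, markElt_self rfl (mark_self A N i).symm, markMap,
      dif_pos rfl, Elt.map_comp, Elt.map_comp, Elt.map_eqToHom_trans]
    exact congrArg (fun z => Elt.map _ (Elt.map f z)) (Elt.map_id m)
  · rw [markElt_of_ne h, markElt_of_ne h, markMap, dif_neg h, Elt.map_eqToHom_trans]

end

variable [SymmetricCategory C]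

theorem detecting_markElt {n : ℕ} (A M : C) (k : Fin n) :
    Detecting {z | ∃ (a : Fin n → Elt A) (m : Elt M), z = tprod (markElt k a m)} := by
  refine (detecting_tens fun i => detecting_univ (mark A M k i)).mono ?_
  rintro _ ⟨z, -, rfl⟩
  obtain ⟨a, m, rfl⟩ := exists_markElt z
  exact ⟨a, m, rfl⟩

variable {P : SymOperad C} {A : P.Algebra}

theorem map_blockAct {M : C} (μ : ∀ {n : ℕ} (k : Fin n), P.obj n ⊗ tens (mark A.X M k) ⟶ M)
    {s : ℕ} (n : Fin s → ℕ) (l : Fin s) (r : Fin (n l)) (q : ∀ i, Elt (P.obj (n i)))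
    (a : Fin (∑ i, n i) → Elt A.X) (m : Elt M) (i : Fin s) :
    Elt.map (blockAct A M μ n l r i)
      (q i ⋆ tprod fun j => markElt (flat n ⟨l, r⟩) a m (flat n ⟨i, j⟩)) =
    markElt l (fun i => A.elts.eval (P.tm (q i) fun j => a (flat n ⟨i, j⟩)))
      (Elt.map (μ r) (q l ⋆ tprod (markElt r (fun j => a (flat n ⟨l, j⟩)) m))) i := by
  by_cases h : i = l
  · subst h
    rw [blockAct, dif_pos rfl, markElt_self rfl (mark_self _ _ _).symm, Elt.map_comp, Elt.map_comp,
      Elt.map_whiskerLeft, map_tensCongr_hom]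
    refine congrArg (fun z => Elt.map _ (Elt.map (μ r) (q i ⋆ tprod z))) (funext fun j => ?_)
    by_cases hj : j = r
    · rw [markElt_self (A := A.X) (M := M) (congrArg (fun j => flat n ⟨i, j⟩) hj)
          (by rw [hj, mark_self]),
        Elt.map_eqToHom_trans]
      exact (markElt_self (A := A.X) (M := M) hj _).symm
    · rw [markElt_of_ne fun h => hj (by simpa using h), Elt.map_eqToHom_trans]
      exact (markElt_of_ne (M := M) (a := fun j => a (flat n ⟨i, j⟩)) hj).symm
  · rw [blockAct, dif_neg h, markElt_of_ne h, Elt.map_comp, Elt.map_comp, Elt.map_whiskerLeft,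
      map_tensCongr_hom]
    refine congrArg (fun z => Elt.map _ (Elt.map (A.smul _) (q i ⋆ tprod z))) (funext fun j => ?_)
    rw [markElt_of_ne fun h' => h (congrArg Sigma.fst ((flat n).injective h')),
      Elt.map_eqToHom_trans]
    exact Elt.map_id _

theorem map_tensPerm_markElt {M : C} {m n : ℕ} (e : Fin m ≃ Fin n) (k : Fin m)
    (a : Fin n → Elt A.X) (x : Elt M) :
    Elt.map ((tensPerm e (mark A.X M (e k))).hom ≫
      (tensCongr fun i => mark_equiv A.X M e k i).hom) (tprod (markElt (e k) a x)) =
    tprod (markElt k (fun i => a (e i)) x) := by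
  rw [Elt.map_comp, map_tensPerm_hom, map_tensCongr_hom]
  refine congrArg tprod (funext fun i => ?_)
  by_cases h : i = k
  · rw [markElt_self (A := A.X) (M := M) (congrArg e h) (by rw [h, mark_self]),
      Elt.map_eqToHom_trans]
    exact (markElt_self (A := A.X) (M := M) h _).symm
  · rw [markElt_of_ne fun h' => h (e.injective h'), Elt.map_eqToHom_trans]
    exact (markElt_of_ne (M := M) (a := fun i => a (e i)) h).symm

/-- The module axioms for the effect of given action maps on elements. -/
structure IsModuleAction (A : P.Algebra) {M : C}
    (μ : ∀ {n : ℕ} (k : Fin n), P.obj n ⊗ tens (mark A.X M k) ⟶ M) : Prop where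
  one_smul : ∀ (a : Fin 1 → Elt A.X) (m : Elt M),
    Elt.map (μ 0) (Elt.map P.one (Elt.unit C) ⋆ tprod (markElt 0 a m)) = m
  comp_smul : ∀ {s : ℕ} (n : Fin s → ℕ) (l : Fin s) (r : Fin (n l)) (p : Elt (P.obj s))
    (q : ∀ i, Elt (P.obj (n i))) (a : Fin (∑ i, n i) → Elt A.X) (m : Elt M),
    Elt.map (μ (flat n ⟨l, r⟩))
      (Elt.map (P.comp s n) (p ⋆ tprod q) ⋆ tprod (markElt (flat n ⟨l, r⟩) a m)) =
    Elt.map (μ l) (p ⋆ tprod (markElt l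
      (fun i => A.elts.eval (P.tm (q i) fun j => a (flat n ⟨i, j⟩)))
      (Elt.map (μ r) (q l ⋆ tprod (markElt r (fun j => a (flat n ⟨l, j⟩)) m)))))
  act_smul : ∀ {m n : ℕ} (e : Fin m ≃ Fin n) (k : Fin m) (p : Elt (P.obj m)) (a : Fin n → Elt A.X)
    (x : Elt M), Elt.map (μ (e k)) (Elt.map (P.act e) p ⋆ tprod (markElt (e k) a x)) =
      Elt.map (μ k) (p ⋆ tprod (markElt k (fun i => a (e i)) x))

theorem ModuleStr.isModuleAction {M : C} (S : ModuleStr A M) : IsModuleAction A S.smul where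
  one_smul a m := by
    have := Elt.congr_map S.one_smul (Elt.unit C ⋆ tprod (markElt 0 a m))
    rw [Elt.map_comp, Elt.map_whiskerRight] at this
    rw [this, Elt.map_comp, Elt.map_leftUnitor_hom, Elt.map_comp, map_tensOne_hom,
      markElt_self rfl (mark_self _ _ _).symm, Elt.map_eqToHom_trans]
    exact Elt.map_id m
  comp_smul n l r p q a m := by
    have := Elt.congr_map (S.comp_smul _ n l r)
      (p ⋆ tprod q ⋆ tprod (markElt (flat n ⟨l, r⟩) a m))
    rw [Elt.map_comp, Elt.map_whiskerRight, Elt.map_comp, Elt.map_associator_hom, Elt.map_comp,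
      Elt.map_whiskerLeft, map_blockMap] at this
    rw [this]
    exact congrArg (fun z => Elt.map (S.smul l) (p ⋆ tprod z))
      (funext (map_blockAct S.smul n l r q a m))
  act_smul e k p a x := by
    have := Elt.congr_map (S.act_smul e k) (p ⋆ tprod (markElt (e k) a x))
    rwa [Elt.map_comp, Elt.map_whiskerRight, Elt.map_comp, Elt.map_whiskerLeft,
      map_tensPerm_markElt] at this

/-- A module structure from action maps which satisfy the module axioms on elements. -/
def IsModuleAction.str {M : C} {μ : ∀ {n : ℕ} (k : Fin n), P.obj n ⊗ tens (mark A.X M k) ⟶ M}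
    (h : IsModuleAction A μ) : ModuleStr A M where
  smul := μ
  one_smul := by
    refine ((detecting_unit C).mul (detecting_markElt A.X M 0)).eq_of_map_eq ?_
    rintro _ ⟨_, ⟨_, rfl⟩, _, ⟨a, m, rfl⟩, rfl⟩
    rw [Elt.map_comp, Elt.map_whiskerRight, Elt.map_comp, Elt.map_leftUnitor_hom, Elt.map_comp,
      map_tensOne_hom, markElt_self rfl (mark_self _ _ _).symm, Elt.map_eqToHom_trans, h.one_smul]
    exact (Elt.map_id m).symm
  comp_smul s n l r := by
    refine (((detecting_univ _).mul (detecting_tens fun _ => detecting_univ _)).mul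
      (detecting_markElt A.X M (flat n ⟨l, r⟩))).eq_of_map_eq ?_
    rintro _ ⟨_, ⟨p, -, _, ⟨q, -, rfl⟩, rfl⟩, _, ⟨a, m, rfl⟩, rfl⟩
    rw [Elt.map_comp, Elt.map_whiskerRight, Elt.map_comp, Elt.map_associator_hom, Elt.map_comp,
      Elt.map_whiskerLeft, map_blockMap, h.comp_smul]
    exact congrArg (fun z => Elt.map (μ l) (p ⋆ tprod z))
      (funext (map_blockAct μ n l r q a m)).symm
  act_smul e k := by
    refine ((detecting_univ _).mul (detecting_markElt A.X M (e k))).eq_of_map_eq ?_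
    rintro _ ⟨p, -, _, ⟨a, m, rfl⟩, rfl⟩
    rw [Elt.map_comp, Elt.map_whiskerRight, Elt.map_comp, Elt.map_whiskerLeft,
      map_tensPerm_markElt, h.act_smul]

end Modules

/-! ### The action of terms with one variable -/

section Modules

variable {C : Type u} [Category.{v} C] [MonoidalCategory C] [SymmetricCategory C]
  {P : SymOperad C} {A : P.Algebra}

open SetOperad

/-- The linear term `p(a 0, …, a (k-1), x, a (k+1), …, a (n-1))` with one variable `x`; the value of
`a` at `k` is not used. -/
def markTerm {n : ℕ} (p : Elt (P.obj n)) (k : Fin n) (a : Fin n → Elt A.X) :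
    P.elts.Term (Elt A.X ⊕ Fin 1) :=
  P.tm p fun i => if i = k then Sum.inr 0 else Sum.inl (a i)

theorem isLinear_markTerm {n : ℕ} (p : Elt (P.obj n)) (k : Fin n) (a : Fin n → Elt A.X) :
    (markTerm p k a).IsLinear := by
  refine isLinear_tm.mpr fun s => ⟨k, ?_, fun i hi => ?_⟩
  · simp only [if_true]
    exact congrArg Sum.inr (Subsingleton.elim _ _)
  · by_contra h
    simp [h] at hi

/-- Every linear term with one variable is of the form `p(a 0, …, x, …, a (n-1))`. The unused
constant at the position of the variable is taken to be `none`. -/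
theorem exists_markTerm {t : P.elts.Term (Elt A.X ⊕ Fin 1)} (ht : t.IsLinear) :
    ∃ (n : ℕ) (p : Elt (P.obj n)) (k : Fin n) (a : Fin n → Elt A.X), t = markTerm p k a := by
  obtain ⟨n, p, x, rfl, h⟩ := ht
  obtain ⟨k, hk, hk'⟩ := h 0
  refine ⟨n, p, k, fun i => Sum.elim id (fun _ => (none : Option _)) (x i),
    congrArg (P.tm p) (funext fun i => ?_)⟩
  by_cases hi : i = k
  · rw [if_pos hi, hi, hk]
  · rw [if_neg hi]
    rcases h' : x i with a | j
    · exact congrArg (fun z => Sum.inl (Sum.elim id (fun _ => (none : Option _)) z)) h'.symm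
    · exact absurd (hk' i (h'.trans (congrArg Sum.inr (Subsingleton.elim _ _)))) hi

theorem markTerm_eq {m n : ℕ} {p : Elt (P.obj m)} {k : Fin m} {a : Fin m → Elt A.X}
    {p' : Elt (P.obj n)} {k' : Fin n} {a' : Fin n → Elt A.X}
    (h : markTerm p k a = markTerm p' k' a') : ∃ e : Fin m ≃ Fin n,
      Elt.map (P.act e) p = p' ∧ e k = k' ∧ ∀ i, i ≠ k → a' (e i) = a i := by
  obtain ⟨e, he, h⟩ := tm_eq_tm_iff.mp h
  have hk : e k = k' := by
    by_contra h'
    have := h k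
    rw [if_pos rfl, if_neg h'] at this
    exact absurd this (by simp)
  refine ⟨e, he, hk, fun i hi => ?_⟩
  have := h i
  rw [if_neg hi, if_neg fun h' => hi (e.injective (h'.trans hk.symm))] at this
  exact Sum.inl_injective this

theorem markTerm_one (a : Fin 1 → Elt A.X) :
    markTerm (Elt.map P.one (Elt.unit C)) 0 a = Term.pure (Sum.inr 0) :=
  congrArg (P.tm _) (funext fun i => if_pos (Subsingleton.elim i 0))

theorem markTerm_comp {s : ℕ} (n : Fin s → ℕ) (l : Fin s) (r : Fin (n l)) (p : Elt (P.obj s))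
    (q : ∀ i, Elt (P.obj (n i))) (a : Fin (∑ i, n i) → Elt A.X) :
    markTerm (Elt.map (P.comp s n) (p ⋆ tprod q)) (flat n ⟨l, r⟩) a =
      (P.op p).bind fun i => if i = l then markTerm (q l) r fun j => a (flat n ⟨l, j⟩)
        else (P.tm (q i) fun j => a (flat n ⟨i, j⟩)).map Sum.inl := by
  refine (tm_comp (O := P.elts) n p q _).trans (SetOperad.bind_congr fun i => ?_)
  by_cases h : i = l
  · subst h
    rw [if_pos rfl]
    refine congrArg (P.tm (q i)) (funext fun j => ?_)
    by_cases hj : j = r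
    · rw [if_pos hj, if_pos (by rw [hj])]
    · rw [if_neg hj, if_neg fun h => hj (by simpa using h)]
  · rw [if_neg h]
    exact congrArg (P.tm (q i)) (funext fun j =>
      if_neg fun h' => h (congrArg Sigma.fst ((flat n).injective h')))

section Ev

variable {M : C} (S : ModuleStr A M)

open Classical in
/-- The action of a linear term with one variable on an element of a module, through the action maps
of the module; the equivariance of these maps is used to show that the choice of a representative is
immaterial. The value is `none` if the term is not linear. -/
def ev (t : P.elts.Term (Elt A.X ⊕ Fin 1)) (m : Elt M) : Elt M :=
  if h : ∃ z : Elt M, ∃ (n : ℕ) (p : Elt (P.obj n)) (k : Fin n) (a : Fin n → Elt A.X),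
    t = markTerm p k a ∧ z = Elt.map (S.smul k) (p ⋆ tprod (markElt k a m))
  then h.choose else (show Elt _ from none)

theorem ev_markTerm {n : ℕ} (p : Elt (P.obj n)) (k : Fin n) (a : Fin n → Elt A.X) (m : Elt M) :
    ev S (markTerm p k a) m = Elt.map (S.smul k) (p ⋆ tprod (markElt k a m)) := by
  have h : ∃ z : Elt M, ∃ (n : ℕ) (p' : Elt (P.obj n)) (k' : Fin n) (a' : Fin n → Elt A.X),
    markTerm p k a = markTerm p' k' a' ∧
      z = Elt.map (S.smul k') (p' ⋆ tprod (markElt k' a' m)) := ⟨_, n, p, k, a, rfl, rfl⟩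
  obtain ⟨n', p', k', a', ht, hz⟩ := h.choose_spec
  rw [ev, dif_pos h, hz]
  obtain ⟨e, rfl, rfl, ha⟩ := markTerm_eq ht
  rw [S.isModuleAction.act_smul, markElt_congr ha]

/-- The effect of a composite operation on a module: all the terms `u i` but one have no variable,
and they are evaluated in `A`. -/
theorem ev_bind {s : ℕ} (p : Elt (P.obj s)) (l : Fin s)
    (u : Fin s → P.elts.Term (Elt A.X ⊕ Fin 1)) (r : Fin s → P.elts.Term (Elt A.X))
    (hu : ∀ i, i ≠ l → u i = (r i).map Sum.inl) (hl : (u l).IsLinear) (m : Elt M) :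
    ev S ((P.op p).bind u) m = ev S (markTerm p l fun i => A.elts.eval (r i)) (ev S (u l) m) := by
  have h : ∀ i, ∃ (n : ℕ) (q : Elt (P.obj n)) (a : Fin n → Elt A.X),
      (i ≠ l → r i = P.tm q a) ∧ (i = l → ∃ k, u i = markTerm q k a) := fun i => by
    by_cases h : i = l
    · subst h
      obtain ⟨n, q, k, a, h⟩ := exists_markTerm hl
      exact ⟨n, q, a, fun h => absurd rfl h, fun _ => ⟨k, h⟩⟩
    · obtain ⟨n, q, a, h'⟩ := SymOperad.exists_tm (r i)
      exact ⟨n, q, a, fun _ => h', fun h' => absurd h' h⟩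
  choose n q a h₁ h₂ using h
  obtain ⟨k, hk⟩ := h₂ l rfl
  have key := markTerm_comp n l k p q (blockLabel n a)
  simp only [blockLabel_flat] at key
  have : (P.op p).bind u =
      markTerm (Elt.map (P.comp s n) (p ⋆ tprod q)) (flat n ⟨l, k⟩) (blockLabel n a) := by
    refine (SetOperad.bind_congr fun i => ?_).trans key.symm
    by_cases h : i = l
    · rw [if_pos h, h]
      exact hk
    · rw [if_neg h, hu i h, h₁ i h]
  rw [this, ev_markTerm, S.isModuleAction.comp_smul, ev_markTerm, hk, ev_markTerm]
  simp only [blockLabel_flat]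
  refine congrArg (fun z => Elt.map (S.smul l) (p ⋆ tprod z)) (markElt_congr fun i hi => ?_)
  rw [h₁ i hi]

theorem ev_pure (m : Elt M) : ev S (Term.pure (Sum.inr 0)) m = m := by
  let a : Fin 1 → Elt A.X := fun _ => (none : Option _)
  exact (congrArg (ev S · m) (markTerm_one a).symm).trans
    ((ev_markTerm S _ 0 a m).trans (S.isModuleAction.one_smul a m))

/-- The terms with one variable act associatively. -/
theorem ev_subst {t u : P.elts.Term (Elt A.X ⊕ Fin 1)} (ht : t.IsLinear) (hu : u.IsLinear)
    (m : Elt M) : ev S (t.bind (Sum.elim (fun a => Term.pure (Sum.inl a)) fun _ => u)) m =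
      ev S t (ev S u m) := by
  obtain ⟨n, p, k, a, rfl⟩ := exists_markTerm ht
  have h := ev_bind S p k (fun i => if i = k then u else Term.pure (Sum.inl (a i)))
    (fun i => Term.pure (a i)) (fun i hi => if_neg hi) (by rwa [if_pos rfl]) m
  simp only [if_true, Algebra.eval_pure] at h
  refine Eq.trans (congrArg (ev S · m) ?_) h
  refine (SetOperad.bind_map (P.op p) (fun i => if i = k then Sum.inr 0 else Sum.inl (a i))
    _).trans (SetOperad.bind_congr fun i => ?_)
  by_cases hi : i = k
  · rw [if_pos hi, if_pos hi]
    rfl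
  · rw [if_neg hi, if_neg hi]
    rfl

theorem std_eq_markTerm {k : ℕ} (p : Elt (P.obj (k + 1))) (a : Fin k → Elt A.X) :
    P.std p a = markTerm p (Fin.last k) (Fin.lastCases (none : Option _) a) := by
  refine congrArg (P.tm p) (funext fun i => ?_)
  refine Fin.lastCases ?_ (fun i => ?_) i
  · rw [if_pos rfl, show Fin.last k = finSumFinEquiv (Sum.inr 0) from rfl,
      Equiv.symm_apply_apply]
    rfl
  · rw [if_neg (Fin.castSucc_ne_last i), show i.castSucc = finSumFinEquiv (Sum.inl i) from rfl,
      Equiv.symm_apply_apply]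
    refine congrArg Sum.inl (Eq.symm ?_)
    exact Fin.lastCases_castSucc (motive := fun _ => Elt A.X) i

/-- The action of terms on a module is compatible with the evaluation of subterms in `A`. This is
the associativity of the module structure, in the case where `M` is inserted directly into `p`. -/
theorem Step.ev_eq {t t' : P.elts.Term (Elt A.X ⊕ Fin 1)} (h : Step t t') (m : Elt M) :
    ev S t m = ev S t' m := by
  obtain ⟨k, p, r, rfl, rfl⟩ := h
  let r' : Fin (k + 1) → P.elts.Term (Elt A.X) :=
    Fin.lastCases (Term.pure (none : Option _)) r
  let u : Fin k ⊕ Fin 1 → P.elts.Term (Elt A.X ⊕ Fin 1) :=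
    Sum.elim (fun i => (r i).map Sum.inl) fun j => Term.pure (Sum.inr j)
  have hu : ∀ i, i ≠ Fin.last k → u (finSumFinEquiv.symm i) = (r' i).map Sum.inl := fun i =>
    Fin.lastCases (fun h => absurd rfl h) (fun i _ =>
      (congrArg u (finSumFinEquiv.symm_apply_apply (Sum.inl i))).trans
        (congrArg (Term.map Sum.inl)
          (Fin.lastCases_castSucc (motive := fun _ => P.elts.Term (Elt A.X)) i).symm)) i
  have hl : u (finSumFinEquiv.symm (Fin.last k)) = Term.pure (Sum.inr 0) :=
    congrArg u (finSumFinEquiv.symm_apply_apply (Sum.inr 0))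
  have h := ev_bind S p (Fin.last k) (fun i => u (finSumFinEquiv.symm i)) r' hu
    (by rw [hl]; exact isLinear_pure) m
  refine Eq.trans (congrArg (ev S · m) ?_) (h.trans ?_)
  · refine (SetOperad.bind_map (P.op p)
      (fun i => Sum.map (id : Fin k → Fin k) id (finSumFinEquiv.symm i)) u).trans ?_
    exact SetOperad.bind_congr fun i => congrArg u (by simp)
  · rw [hl, ev_pure, std_eq_markTerm]
    refine congrArg (ev S · m) (congrArg (P.tm p) (funext fun i => ?_))
    refine Fin.lastCases ?_ (fun i => ?_) i
    · rw [if_pos rfl, if_pos rfl]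
    · rw [if_neg (Fin.castSucc_ne_last i), if_neg (Fin.castSucc_ne_last i)]
      refine congrArg Sum.inl ?_
      refine (congrArg A.elts.eval
        (Fin.lastCases_castSucc (motive := fun _ => P.elts.Term (Elt A.X)) i)).trans ?_
      refine Eq.symm ?_
      exact Fin.lastCases_castSucc (motive := fun _ => Elt A.X) i

/-- Morphisms of modules commute with the action of terms. -/
theorem map_ev {N : C} (S' : ModuleStr A N) (f : M ⟶ N) (hf : ∀ {n : ℕ} (k : Fin n),
    S.smul k ≫ f = P.obj n ◁ tensMap (markMap A.X f k) ≫ S'.smul k)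
    {t : P.elts.Term (Elt A.X ⊕ Fin 1)} (ht : t.IsLinear) (m : Elt M) :
    Elt.map f (ev S t m) = ev S' t (Elt.map f m) := by
  obtain ⟨n, p, k, a, rfl⟩ := exists_markTerm ht
  rw [ev_markTerm, ev_markTerm, ← Elt.map_comp, hf, Elt.map_comp, Elt.map_whiskerLeft, map_tensMap]
  simp only [map_markMap]

end Ev

end Modules

/-! ### Unary operations of enveloping operads -/

section Unary

variable {C : Type u} [Category.{v} C] [MonoidalCategory C] [SymmetricCategory C]

open SetOperad

theorem SymOperad.tm_map_eqToHom (Q : SymOperad C) {Λ : Type*} {m n : ℕ} (h : m = n)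
    (h' : Q.obj m = Q.obj n) (z : Elt (Q.obj m)) (x : Fin n → Λ) :
    Q.tm (Elt.map (eqToHom h') z) x = Q.tm z fun i => x (Fin.cast h i) := by
  subst h
  exact congrArg (fun z => Q.tm z x) (Elt.map_id z)

/-- Plugging constants into all inputs but one, as a substitution. -/
theorem op_plugConstants (Q : SymOperad C) {n : ℕ} (k : Fin (n + 1)) (q : Elt (Q.obj (n + 1)))
    (b : Fin (n + 1) → Elt (Q.obj 0)) :
    Q.op (Elt.map (plugConstants Q k) (q ⋆ tprod fun i => b (k.succAbove i))) =
      (Q.op q).bind fun i => if i = k then Term.pure 0 else Q.const (b i) := by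
  let x : ∀ i, Elt (Q.obj (if i = k then 1 else 0)) := fun i =>
    if h : i = k then Elt.map (eqToHom (by rw [if_pos h])) (Elt.map Q.one (Elt.unit C))
    else Elt.map (eqToHom (by rw [if_neg h])) (b i)
  have hx : ∀ i (h : i = k), x i =
      Elt.map (eqToHom (by rw [if_pos h])) (Elt.map Q.one (Elt.unit C)) := fun i h => dif_pos h
  have hx' : ∀ i (h : i ≠ k), x i = Elt.map (eqToHom (by rw [if_neg h])) (b i) :=
    fun i h => dif_neg h
  have h : Elt.map (plugConstants Q k) (q ⋆ tprod fun i => b (k.succAbove i)) =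
      Elt.map (Q.act (finCongr (by simp))) (Elt.map (Q.comp (n + 1) _) (q ⋆ tprod x)) := by
    rw [plugConstants, Elt.map_comp, Elt.map_comp, Elt.map_whiskerLeft]
    refine congrArg (fun z => Elt.map _ (Elt.map _ (q ⋆ z))) ?_
    rw [← map_tensExtract_inv x k, Elt.map_comp, Elt.map_rightUnitor_inv, Elt.map_comp,
      Elt.map_whiskerLeft, Elt.map_comp, Elt.map_tensorHom, map_tensCongr_hom]
    refine congrArg (Elt.map _) (congrArg₂ Elt.mul (congrArg tprod (funext fun i => ?_)) ?_)
    · exact (hx' _ (Fin.succAbove_ne k i)).symm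
    · exact (hx k rfl).symm
  rw [h]
  refine (tm_act (O := Q.elts) _ _ _).trans ?_
  refine (tm_comp (O := Q.elts) _ q x _).trans (SetOperad.bind_congr fun i => ?_)
  by_cases hi : i = k
  · refine Eq.trans ?_ (if_pos hi).symm
    refine (congrArg (fun z => Q.tm z _) (hx i hi)).trans ?_
    refine (Q.tm_map_eqToHom (by rw [if_pos hi]) _ _ _).trans ?_
    exact congrArg (Q.tm _) (funext fun _ => Subsingleton.elim _ _)
  · refine Eq.trans ?_ (if_neg hi).symm
    refine (congrArg (fun z => Q.tm z _) (hx' i hi)).trans ?_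
    refine (Q.tm_map_eqToHom (by rw [if_neg hi]) _ _ _).trans ?_
    exact Q.const_eq _ _

theorem op_unaryMul (Q : SymOperad C) (x y : Elt (Q.obj 1)) :
    Q.op (Elt.map Q.unaryMul (x ⋆ y)) = (Q.op x).bind fun _ => Q.op y := by
  rw [SymOperad.unaryMul, Elt.map_comp, Elt.map_whiskerLeft, map_tensOne_inv, Elt.map_comp]
  refine (tm_act (O := Q.elts) _ _ _).trans ?_
  refine (tm_comp (O := Q.elts) _ x _ _).trans (SetOperad.bind_congr fun i => ?_)
  exact congrArg (Q.tm y) (funext fun _ => Subsingleton.elim _ _)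

/-- The action of an element of a monoid on an element of a module. -/
def modAct {R : C} [MonObj R] (M : Mod C R) (z : Elt R) (m : Elt M.X) : Elt M.X :=
  Elt.map (ModObj.smul (M := R) (X := M.X) : R ⊗ M.X ⟶ M.X) (z ⋆ m)

theorem modAct_one {R : C} [MonObj R] (M : Mod C R) (m : Elt M.X) :
    modAct M (Elt.map (MonObj.one (X := R)) (Elt.unit C)) m = m := by
  have := Elt.congr_map (ModObj.one_smul_self R M.X) (Elt.unit C ⋆ m)
  rwa [Elt.map_comp, Elt.map_whiskerRight, Elt.map_leftUnitor_hom] at this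

theorem modAct_mul {R : C} [MonObj R] (M : Mod C R) (z w : Elt R) (m : Elt M.X) :
    modAct M (Elt.map (MonObj.mul (X := R)) (z ⋆ w)) m = modAct M z (modAct M w m) := by
  have := Elt.congr_map (ModObj.mul_smul_self R M.X) (z ⋆ w ⋆ m)
  rwa [Elt.map_comp, Elt.map_whiskerRight, Elt.map_comp, Elt.map_associator_hom, Elt.map_comp,
    Elt.map_whiskerLeft] at this

theorem map_modAct {R : C} [MonObj R] {M N : Mod C R} (f : M ⟶ N) (z : Elt R) (m : Elt M.X) :
    Elt.map f.hom (modAct M z m) = modAct N z (Elt.map f.hom m) := by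
  have := Elt.congr_map (IsModHom.smul_hom (A := R) (f := f.hom)) (z ⋆ m)
  rw [Elt.map_comp] at this
  refine this.trans ((Elt.map_comp _ _ _).trans ?_)
  exact congrArg (Elt.map _) (Elt.map_whiskerLeft f.hom z m)

variable {P : SymOperad C} {A : P.Algebra} (E : EnvelopingOperad A)

namespace EnvelopingOperad

/-- The element `z` of an enveloping operad is the operation which is denoted by the term `t`. -/
abbrev Denotes {n : ℕ} (z : Elt (E.operad.obj n)) (t : P.elts.Term (Elt A.X ⊕ Fin n)) : Prop :=
  E.operad.op z = interp E.η E.ηAlg.hom t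

variable {E}

theorem Denotes.unique {n : ℕ} {z z' : Elt (E.operad.obj n)}
    {t : P.elts.Term (Elt A.X ⊕ Fin n)} (h : E.Denotes z t) (h' : E.Denotes z' t) : z = z' :=
  op_injective (h.trans h'.symm)

theorem denotes_one : E.Denotes (Elt.map E.operad.one (Elt.unit C)) (Term.pure (Sum.inr 0)) :=
  (opTerm_one (O := E.operad.elts)).trans (interp_pure_inr _ _ _).symm

theorem Denotes.mul {z w : Elt (E.operad.obj 1)} {t u : P.elts.Term (Elt A.X ⊕ Fin 1)}
    (hz : E.Denotes z t) (hw : E.Denotes w u) : E.Denotes (Elt.map E.operad.unaryMul (z ⋆ w))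
      (t.bind (Sum.elim (fun a => Term.pure (Sum.inl a)) fun _ => u)) := by
  rw [Denotes, op_unaryMul, hz, hw]
  unfold interp
  rw [SetOperad.mapOp_bind, SetOperad.bind_assoc, SetOperad.bind_assoc]
  refine SetOperad.bind_congr ?_
  rintro (a | i)
  · rw [Sum.elim_inl, Sum.elim_inl, SetOperad.mapOp_pure, SetOperad.pure_bind, Sum.elim_inl]
    exact SymOperad.const_bind _ _
  · exact SetOperad.pure_bind _ _

theorem interp_markTerm {n : ℕ} (p : Elt (P.obj n)) (k : Fin n) (a : Fin n → Elt A.X) :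
    interp E.η E.ηAlg.hom (markTerm p k a) = (E.operad.op (Elt.map (E.η.app n) p)).bind fun i =>
      if i = k then Term.pure 0 else E.operad.const (Elt.map E.ηAlg.hom (a i)) := by
  refine (SetOperad.bind_map (E.operad.op (Elt.map (E.η.app n) p))
    (fun i => if i = k then Sum.inr 0 else Sum.inl (a i)) _).trans
      (SetOperad.bind_congr fun i => ?_)
  by_cases h : i = k
  · rw [if_pos h, if_pos h]
    rfl
  · rw [if_neg h, if_neg h]
    rfl

variable (E) in
/-- Every term of the form `p(a 0, …, x, …, a (n-1))` denotes an operation, and this operation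
defines the action map of the module over the operad. -/
theorem exists_denotes_markTerm {n : ℕ} (p : Elt (P.obj (n + 1))) (k : Fin (n + 1))
    (a : Fin (n + 1) → Elt A.X) : ∃ z, E.Denotes z (markTerm p k a) ∧
      ∀ (M : Mod C (E.operad.obj 1)) (m : Elt M.X),
        Elt.map (E.smul M k) (p ⋆ tprod (markElt k a m)) = modAct M z m := by
  refine ⟨Elt.map (plugConstants E.operad k) (Elt.map (E.η.app (n + 1)) p ⋆
    tprod fun i => Elt.map E.ηAlg.hom (a (k.succAbove i))), ?_, fun M m => ?_⟩
  · rw [Denotes, interp_markTerm]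
    exact op_plugConstants E.operad k (Elt.map (E.η.app (n + 1)) p)
      fun i => Elt.map E.ηAlg.hom (a i)
  · have h : (fun i => Elt.map (eqToHom (mark_of_ne A.X M.X (Fin.succAbove_ne k i)))
        (markElt k a m (k.succAbove i))) = fun i => a (k.succAbove i) := funext fun i => by
      rw [markElt_of_ne (Fin.succAbove_ne k i), Elt.map_eqToHom_trans]
      exact Elt.map_id _
    have h' : Elt.map ((tensExtract (mark A.X M.X k) k).hom ≫
        ((tensCongr fun i => mark_of_ne A.X M.X (Fin.succAbove_ne k i)).hom ⊗ₘ
          eqToHom (mark_self A.X M.X k))) (tprod (markElt k a m)) =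
        (tprod fun i => a (k.succAbove i)) ⋆ m := by
      rw [Elt.map_comp, map_tensExtract_hom, Elt.map_tensorHom, map_tensCongr_hom, h,
        markElt_self rfl (mark_self A.X M.X k).symm, Elt.map_eqToHom_trans]
      exact congrArg (_ ⋆ ·) (Elt.map_id m)
    refine (Elt.map_comp _ _ _).trans ?_
    refine (congrArg _ ((Elt.map_whiskerLeft _ _ _).trans (congrArg (p ⋆ ·) h'))).trans ?_
    refine (Elt.map_comp _ _ _).trans ?_
    refine (congrArg _ (Elt.map_associator_inv _ _ _)).trans ?_
    refine (Elt.map_comp _ _ _).trans (congrArg (Elt.map _) ?_)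
    refine (Elt.map_whiskerRight _ _ _).trans (congrArg (· ⋆ m) ?_)
    refine (Elt.map_comp _ _ _).trans (congrArg (Elt.map _) ?_)
    exact (Elt.map_tensorHom _ _ _ _).trans (congrArg (_ ⋆ ·) (map_tensMap _ _))

/-- Operations composed with operations on `A` denote the composite terms. -/
theorem Denotes.comp {s : ℕ} {n : Fin s → ℕ} {l : Fin s} {r : Fin (n l)} {p : Elt (P.obj s)}
    {q : ∀ i, Elt (P.obj (n i))} {a : Fin (∑ i, n i) → Elt A.X} {z w : Elt (E.operad.obj 1)}
    (hz : E.Denotes z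
      (markTerm p l fun i => A.elts.eval (P.tm (q i) fun j => a (flat n ⟨i, j⟩))))
    (hw : E.Denotes w (markTerm (q l) r fun j => a (flat n ⟨l, j⟩))) :
    E.Denotes (Elt.map E.operad.unaryMul (z ⋆ w))
      (markTerm (Elt.map (P.comp s n) (p ⋆ tprod q)) (flat n ⟨l, r⟩) a) := by
  rw [Denotes, op_unaryMul, hz, hw, markTerm_comp, interp_markTerm, SetOperad.bind_assoc]
  unfold interp
  rw [SetOperad.mapOp_bind, SetOperad.bind_assoc]
  refine SetOperad.bind_congr fun i => ?_
  by_cases h : i = l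
  · rw [if_pos h, if_pos h]
    exact SetOperad.pure_bind _ _
  · rw [if_neg h, if_neg h, SetOperad.mapOp_map, SetOperad.bind_map]
    exact (SymOperad.const_bind _ _).trans (const_eval E.η E.ηAlg _)

end EnvelopingOperad

end Unary

/-! ### The comparison of modules -/

section

variable {C : Type u} [Category.{v} C] [MonoidalCategory C] {R : C} [MonObj R]

theorem mod_eqToHom_hom {M N : Mod C R} (h : M = N) :
    (eqToHom h).hom = eqToHom (congrArg Mod.X h) := by
  subst h
  rfl

theorem mod_mk_eq (M : Mod C R) (S : ModObj R M.X) (h : S.smul = M.mod.smul) :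
    ({ X := M.X, mod := S } : Mod C R) = M :=
  congrArg (fun S => ({ X := M.X, mod := S } : Mod C R)) (ModObj.ext S M.mod h)

end

section Comparison

variable {C : Type u} [Category.{v} C] [MonoidalCategory C] [SymmetricCategory C]
  {P : SymOperad C} {A : P.Algebra} (E : EnvelopingOperad A)

open SetOperad

namespace EnvelopingOperad

/-- The action maps on a module over the monoid of unary operations of an enveloping operad, for all
arities; there is none in arity zero. -/
def actionMap (M : Mod C (E.operad.obj 1)) :
    ∀ {n : ℕ} (k : Fin n), P.obj n ⊗ tens (mark A.X M.X k) ⟶ M.X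
  | 0, k => k.elim0
  | _ + 1, k => E.smul M k

/-- The version of `exists_denotes_markTerm` for operations of arbitrary arity. -/
theorem exists_denotes {n : ℕ} (p : Elt (P.obj n)) (k : Fin n) (a : Fin n → Elt A.X) :
    ∃ z, E.Denotes z (markTerm p k a) ∧ ∀ (M : Mod C (E.operad.obj 1)) (m : Elt M.X),
      Elt.map (E.actionMap M k) (p ⋆ tprod (markElt k a m)) = modAct M z m := by
  cases n with
  | zero => exact k.elim0
  | succ n => exact E.exists_denotes_markTerm p k a

theorem isModuleAction_actionMap (M : Mod C (E.operad.obj 1)) :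
    IsModuleAction A (E.actionMap M) where
  one_smul a m := by
    obtain ⟨z, hz, h⟩ := E.exists_denotes (Elt.map P.one (Elt.unit C)) 0 a
    rw [markTerm_one] at hz
    rw [h, hz.unique denotes_one]
    exact modAct_one M m
  comp_smul n l r p q a m := by
    obtain ⟨x, hx, h⟩ := E.exists_denotes (Elt.map (P.comp _ n) (p ⋆ tprod q)) (flat n ⟨l, r⟩) a
    obtain ⟨z, hz, h'⟩ := E.exists_denotes p l
      fun i => A.elts.eval (P.tm (q i) fun j => a (flat n ⟨i, j⟩))
    obtain ⟨w, hw, h''⟩ := E.exists_denotes (q l) r fun j => a (flat n ⟨l, j⟩)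
    rw [h, h', h'', hx.unique (hz.comp hw)]
    exact modAct_mul M z w m
  act_smul e k p a x := by
    obtain ⟨z, hz, h⟩ := E.exists_denotes (Elt.map (P.act e) p) (e k) a
    obtain ⟨w, hw, h'⟩ := E.exists_denotes p k fun i => a (e i)
    have : markTerm (A := A) (Elt.map (P.act e) p) (e k) a = markTerm p k fun i => a (e i) := by
      refine (tm_act (O := P.elts) e p _).trans (congrArg (P.tm p) (funext fun i => ?_))
      simp
    rw [this] at hz
    rw [h, h', hz.unique hw]

/-- The functor from modules over the monoid of unary operations of an enveloping operad to modules
over the operad. -/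
def toOperadModule : Mod C (E.operad.obj 1) ⥤ OperadModule A where
  obj M := ⟨M.X, (E.isModuleAction_actionMap M).str⟩
  map {M N} f :=
    { hom := f.hom
      smul_hom := fun {n} k => by
        change E.actionMap M k ≫ f.hom = _ ≫ E.actionMap N k
        refine ((detecting_univ _).mul (detecting_markElt A.X M.X k)).eq_of_map_eq ?_
        rintro _ ⟨p, -, _, ⟨a, m, rfl⟩, rfl⟩
        obtain ⟨z, -, h⟩ := E.exists_denotes p k a
        rw [Elt.map_comp, Elt.map_comp, h, map_modAct, Elt.map_whiskerLeft, map_tensMap]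
        simp only [map_markMap]
        rw [h] }

variable [HasColimits C] [MonoidalClosed C]

/-- The operations which are denoted by terms detect morphisms. For the operad `envOperad A` this
holds since these operations are the classes of terms, and it is transported along the comparison
isomorphism to an arbitrary enveloping operad. -/
theorem detecting_denotes (n : ℕ) :
    Detecting {z | ∃ t : P.elts.Term (Elt A.X ⊕ Fin n), t.IsLinear ∧ E.Denotes z t} := by
  obtain ⟨θ, ⟨h₁, h₂⟩, -⟩ := E.existsUnique_hom (envOperad A) (envHom A) (envConstHom A)
  obtain ⟨θ', ⟨h₁', h₂'⟩, -⟩ := (envelopingOperad A).existsUnique_hom E.operad E.η E.ηAlg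
  let one : E.operad.Hom E.operad :=
    { app := fun _ => 𝟙 _
      act_app := fun _ => by simp
      one_app := by simp
      comp_app := fun _ _ => by rw [tensMap_id]; simp }
  have h : θ.comp θ' = one := (E.existsUnique_hom E.operad E.η E.ηAlg).unique
    ⟨by
      refine SymOperad.Hom.ext (funext fun n => ?_)
      refine (Category.assoc _ _ _).symm.trans ?_
      refine (congrArg (fun φ : P.Hom (envOperad A) => φ.app n ≫ θ'.app n) h₁).trans ?_
      exact congrArg (fun φ : P.Hom E.operad => φ.app n) h₁', by
      refine (Category.assoc _ _ _).symm.trans ?_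
      exact (congrArg (· ≫ θ'.app 0) h₂).trans h₂'⟩
    ⟨SymOperad.Hom.ext (funext fun n => Category.comp_id _), Category.comp_id _⟩
  have h' : θ.app n ≫ θ'.app n = 𝟙 _ := congrArg (fun φ => SymOperad.Hom.app φ n) h
  refine (Detecting.map (fun _ : Unit => θ'.app n) (fun Y Z f g hfg => ?_)
    fun _ => detecting_clsSet A n).mono ?_
  · have := congrArg (θ.app n ▷ Y ≫ ·) (hfg ⟨⟩)
    have key : ∀ f : E.operad.obj n ⊗ Y ⟶ Z, θ.app n ▷ Y ≫ θ'.app n ▷ Y ≫ f = f := fun f =>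
      (comp_whiskerRight_assoc _ _ _ _).symm.trans
        ((congrArg (fun φ => φ ▷ Y ≫ f) h').trans (by simp))
    exact (key f).symm.trans (this.trans (key g))
  · rintro _ ⟨_, _, ⟨t, ht, rfl⟩, rfl⟩
    refine ⟨t, ht, (θ'.mapOp_op (cls A t)).symm.trans ?_⟩
    refine (congrArg (Term.mapOp θ'.elts) (op_cls ht)).trans ((mapOp_interp _ _ θ' t).trans ?_)
    exact congrArg₂ (fun φ ψ => interp φ ψ t) h₁' h₂'

/-- A module over the operad is acted upon by the unary operations of an enveloping operad: an
operation which is denoted by a term acts as this term. -/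
theorem exists_act {M : C} (S : ModuleStr A M) : ∃ α : E.operad.obj 1 ⊗ M ⟶ M,
    ∀ (z : Elt (E.operad.obj 1)) (t : P.elts.Term (Elt A.X ⊕ Fin 1)), t.IsLinear →
      E.Denotes z t → ∀ m, Elt.map α (z ⋆ m) = ev S t m := by
  obtain ⟨θ, ⟨h₁, h₂⟩, -⟩ := E.existsUnique_hom (envOperad A) (envHom A) (envConstHom A)
  have hd : Detecting (Set.range (id : Elt M → Elt M)) := by
    rw [Set.range_id]
    exact detecting_univ M
  obtain ⟨α, hα⟩ := exists_desc A hd (ev S) (fun k => by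
    have h : ∀ i : Fin k, A.X = mark A.X M (Fin.last k) i.castSucc := fun i =>
      (mark_of_ne A.X M (Fin.castSucc_ne_last i)).symm
    have h' := (mark_self A.X M (Fin.last k)).symm
    refine ⟨(α_ _ _ _).hom ≫ P.obj (k + 1) ◁ ((tensCongr h).hom ⊗ₘ eqToHom h') ≫
      S.smul (Fin.last k), fun p a m => ?_⟩
    rw [std_eq_markTerm, ev_markTerm, Elt.map_comp]
    refine (congrArg _ (Elt.map_associator_hom _ _ _)).trans ?_
    refine (Elt.map_comp _ _ _).trans (congrArg (Elt.map _) ?_)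
    refine (Elt.map_whiskerLeft _ _ _).trans (congrArg (p ⋆ ·) ?_)
    rw [Elt.map_tensorHom, map_tensCongr_hom, tprod_succ]
    refine congrArg₂ Elt.mul (congrArg tprod (funext fun i => ?_)) (markElt_self rfl h').symm
    rw [markElt_of_ne (Fin.castSucc_ne_last i)]
    refine congrArg (Elt.map _) (Eq.symm ?_)
    exact Fin.lastCases_castSucc (motive := fun _ => Elt A.X) i) fun t t' h m => h.ev_eq S m
  refine ⟨θ.app 1 ▷ M ≫ α, fun z t ht hz m => ?_⟩
  have hθ : Elt.map (θ.app 1) z = cls A t := by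
    refine op_injective (Q := envOperad A) ((θ.mapOp_op z).symm.trans ?_)
    refine (congrArg (Term.mapOp θ.elts) hz).trans ((mapOp_interp _ _ θ t).trans ?_)
    exact (congrArg₂ (fun φ ψ => interp φ ψ t) h₁ h₂).trans (op_cls ht).symm
  refine (Elt.map_comp _ _ _).trans ((congrArg _ ?_).trans (hα t ht m))
  exact (Elt.map_whiskerRight _ _ _).trans (congrArg (· ⋆ m) hθ)

/-- The action of the unary operations of an enveloping operad on a module over the operad. -/
def act {M : C} (S : ModuleStr A M) : E.operad.obj 1 ⊗ M ⟶ M := (E.exists_act S).choose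

variable {E} in
theorem Denotes.map_act {M : C} (S : ModuleStr A M) {z : Elt (E.operad.obj 1)}
    {t : P.elts.Term (Elt A.X ⊕ Fin 1)} (hz : E.Denotes z t) (ht : t.IsLinear) (m : Elt M) :
    Elt.map (E.act S) (z ⋆ m) = ev S t m :=
  (E.exists_act S).choose_spec z t ht hz m

/-- The structure of a module over the monoid of unary operations of an enveloping operad on a
module over the operad. -/
abbrev modObj {M : C} (S : ModuleStr A M) : ModObj (E.operad.obj 1) M where
  smul := E.act S
  one_smul := by
    change E.operad.one ▷ M ≫ E.act S = (λ_ M).hom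
    refine ((detecting_unit C).mul (detecting_univ M)).eq_of_map_eq ?_
    rintro _ ⟨_, ⟨_, rfl⟩, m, -, rfl⟩
    rw [Elt.map_comp, Elt.map_whiskerRight, Elt.map_leftUnitor_hom,
      denotes_one.map_act S isLinear_pure, ev_pure]
  mul_smul := by
    change E.operad.unaryMul ▷ M ≫ E.act S = (α_ _ _ _).hom ≫ E.operad.obj 1 ◁ E.act S ≫ E.act S
    refine (((E.detecting_denotes 1).mul (E.detecting_denotes 1)).mul
      (detecting_univ M)).eq_of_map_eq ?_
    rintro _ ⟨_, ⟨z, ⟨t, ht, hz⟩, w, ⟨u, hu, hw⟩, rfl⟩, m, -, rfl⟩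
    have hl : (t.bind (Sum.elim (fun a => Term.pure (Sum.inl a)) fun _ => u)).IsLinear := by
      refine Eq.mp (congrArg Term.IsLinear (SetOperad.bind_congr ?_))
        (ht.bind (Equiv.uniqueSigma fun _ : Fin 1 => Fin 1) Term.pure fun _ => hu)
      rintro (a | i)
      · rfl
      · exact (Term.map_congr (Sum.rec (fun _ => rfl) fun _ =>
          congrArg Sum.inr (Subsingleton.elim _ _))).trans (SetOperad.map_id u)
    rw [Elt.map_comp, Elt.map_whiskerRight, (hz.mul hw).map_act S hl, Elt.map_comp,
      Elt.map_associator_hom, Elt.map_comp, Elt.map_whiskerLeft, hw.map_act S hu,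
      hz.map_act S ht, ev_subst S ht hu]

/-- The functor from modules over the operad to modules over the monoid of unary operations of an
enveloping operad. -/
def ofOperadModule : OperadModule A ⥤ Mod C (E.operad.obj 1) where
  obj M := { X := M.X, mod := E.modObj M.str }
  map {M N} f :=
    letI := E.modObj M.str
    letI := E.modObj N.str
    Mod.Hom.mk'' f.hom (by
      change E.act M.str ≫ f.hom = E.operad.obj 1 ◁ f.hom ≫ E.act N.str
      refine ((E.detecting_denotes 1).mul (detecting_univ M.X)).eq_of_map_eq ?_
      rintro _ ⟨z, ⟨t, ht, hz⟩, m, -, rfl⟩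
      rw [Elt.map_comp, Elt.map_comp, Elt.map_whiskerLeft, hz.map_act _ ht, hz.map_act _ ht,
        map_ev _ N.str f.hom f.smul_hom ht])

/-- An action of the unary operations is recovered from its action maps, since the unary operations
are detected by those denoted by terms `p(a 0, …, x, …, a (n-1))`. -/
theorem act_toOperadModule (M : Mod C (E.operad.obj 1)) :
    E.act (E.toOperadModule.obj M).str = ModObj.smul (M := E.operad.obj 1) (X := M.X) := by
  refine ((E.detecting_denotes 1).mul (detecting_univ M.X)).eq_of_map_eq ?_
  rintro _ ⟨z, ⟨t, ht, hz⟩, m, -, rfl⟩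
  refine (hz.map_act (E.toOperadModule.obj M).str ht m).trans ?_
  obtain ⟨n, p, k, a, rfl⟩ := exists_markTerm ht
  obtain ⟨z', hz', h⟩ := E.exists_denotes p k a
  refine (ev_markTerm _ p k a m).trans ?_
  rw [hz.unique hz']
  exact h M m

theorem actionMap_ofOperadModule (M : OperadModule A) {n : ℕ} (k : Fin n) :
    E.actionMap (E.ofOperadModule.obj M) k = M.str.smul k := by
  refine ((detecting_univ _).mul (detecting_markElt A.X M.X k)).eq_of_map_eq ?_
  rintro _ ⟨p, -, _, ⟨a, m, rfl⟩, rfl⟩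
  obtain ⟨z, hz, h⟩ := E.exists_denotes p k a
  refine (h (E.ofOperadModule.obj M) m).trans ?_
  exact (hz.map_act M.str (isLinear_markTerm p k a) m).trans (ev_markTerm M.str p k a m)

end EnvelopingOperad

theorem OperadModule.eqToHom_hom {M N : OperadModule A} (h : M = N) :
    OperadModule.Hom.hom (eqToHom h) = eqToHom (congrArg OperadModule.X h) := by
  subst h
  rfl

variable [HasColimits C] [MonoidalClosed C]

theorem EnvelopingOperad.toOperadModule_comp_ofOperadModule :
    E.toOperadModule ⋙ E.ofOperadModule = 𝟭 _ := by
  refine CategoryTheory.Functor.ext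
    (fun M => mod_mk_eq M _ (E.act_toOperadModule M)) fun M N f => Mod.hom_ext _ _ ?_
  refine Eq.trans ?_ (congrArg₂ (fun φ ψ => φ ≫ f.hom ≫ ψ) (mod_eqToHom_hom _)
    (mod_eqToHom_hom _)).symm
  exact ((Category.id_comp _).trans (Category.comp_id _)).symm

theorem EnvelopingOperad.ofOperadModule_comp_toOperadModule :
    E.ofOperadModule ⋙ E.toOperadModule = 𝟭 _ := by
  refine CategoryTheory.Functor.ext (fun M => congrArg (OperadModule.mk M.X) (ModuleStr.ext ?_))
    fun M N f => OperadModule.Hom.ext ?_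
  · funext n k
    exact E.actionMap_ofOperadModule M k
  · refine Eq.trans ?_ (congrArg₂ (fun φ ψ => φ ≫ f.hom ≫ ψ) (OperadModule.eqToHom_hom _)
      (OperadModule.eqToHom_hom _)).symm
    exact ((Category.id_comp _).trans (Category.comp_id _)).symm

end Comparison

end OperadTheory

end

theorem mainTheorem1 {C : Type u} [Category.{v} C] [MonoidalCategory C] [SymmetricCategory C]
    [MonoidalClosed C] [HasLimits C] [HasColimits C]
    (P : OperadTheory.SymOperad C) (A : P.Algebra) :
    Nonempty (OperadTheory.EnvelopingOperad A) ∧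
    ∀ E : OperadTheory.EnvelopingOperad A,
      ∃ (F : Mod C (E.operad.obj 1) ⥤ OperadTheory.OperadModule A)
        (G : OperadTheory.OperadModule A ⥤ Mod C (E.operad.obj 1)),
        F ⋙ G = 𝟭 _ ∧ G ⋙ F = 𝟭 _ ∧
        F ⋙ OperadTheory.OperadModule.forget A = Mod.forget (E.operad.obj 1) ∧
        ∀ M : Mod C (E.operad.obj 1), ∃ S : OperadTheory.ModuleStr A M.X,
          F.obj M = ⟨M.X, S⟩ ∧
          ∀ (n : ℕ) (k : Fin (n + 1)), S.smul k = E.smul M k := by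
  refine ⟨⟨OperadTheory.envelopingOperad A⟩, fun E => ⟨E.toOperadModule, E.ofOperadModule,
    E.toOperadModule_comp_ofOperadModule, E.ofOperadModule_comp_toOperadModule, rfl, fun M =>
      ⟨(E.toOperadModule.obj M).str, rfl, fun n k => rfl⟩⟩⟩
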